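/- The incremental network design problem with minimum spanning trees (IND-MST) is the following. Given are a graph $G=(V,E)$, a weight function $w:E\to\mathbb{R}$ and a set $E_0\subseteq E$ of existing edges such that the subgraph $(V,E_0)$ is connected. Let $T=|E\setminus E_0|$. Find a sequence $X_0,X_1,\ldots,X_T$ of (edge sets of) spanning trees of $G$ which minimizes $w(X_0)+w(X_1)+\cdots+w(X_T)$ subject to $X_0\subseteq E_0$ and $|X_i\cap(E\setminus(E_0\cup X_1\cup\cdots\cup X_{i-1}))|\le 1$ for $1\le i\le T$. Theorem. The problem IND-MST for a graph with $n$ vertices and $m$ edges can be solved in time $O(\max\{n^2,\ m\log m\})$. That is, there are a single program for a random access machine and an absolute constant $C$ such that, for every instance (given as a list of its $m$ edges with their end vertices, their weights and their membership in $E_0$), the program stops after at most $C\cdot\max\{n^2,\ m\log m\}$ elementary operations and returns an optimal solution. The optimal solution is returned as the initial tree $X_0$ together with a list of $k\le T$ exchange pairs $(e_1,e_1'),\ldots,(e_k,e_k')$, which stands for the sequence $X_i=(X_{i-1}\setminus\{e_i\})\cup\{e_i'\}$ for $1\le i\le k$ and $X_i=X_k$ for $k<i\le T$. The machine works with words of $O(\log(n+m))$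 bits, arithmetic on words, and additions, subtractions and comparisons of real numbers, each at unit cost. -/

import Mathlib

/-! ## The incremental network design problem with minimum spanning trees -/

namespace IndMst

/-- Input data of the problem: a graph with vertex set `Fin n` and edge set `Fin m`, where edge `e`
joins `src e` and `tgt e` (the order of the two end vertices is irrelevant; simple graphs, but also
graphs with parallel edges or loops, are of this form), the set `existing` of edges that are
present at the beginning, and a real weight for every edge. -/
structure Instance (n m : ℕ) where
  src : Fin m → Fin n
  tgt : Fin m → Fin n
  existing : Finset (Fin m)
  weight : Fin m → ℝ

namespace Instance

variable {n m : ℕ} (I : Instance n m)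

/-- The unordered pair of end vertices of an edge. -/
def ends (e : Fin m) : Sym2 (Fin n) := s(I.src e, I.tgt e)

/-- The simple graph underlying the spanning subgraph with edge set `X` (loops are dropped,
parallel edges are identified). -/
def subgraph (X : Finset (Fin m)) : SimpleGraph (Fin n) :=
  SimpleGraph.fromEdgeSet (I.ends '' (X : Set (Fin m)))

/-- The edge set `X` is a spanning tree: it contains no loop and no two parallel edges
(cycles of length one and two), and the simple graph that it forms on all vertices is a tree. -/
def IsSpanningTree (X : Finset (Fin m)) : Prop :=
  (∀ e ∈ X, I.src e ≠ I.tgt e) ∧ Set.InjOn I.ends (X : Set (Fin m)) ∧ (I.subgraph X).IsTree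

/-- Standing assumption of the problem: the existing edges connect all vertices. -/
def ExistingConnected : Prop := (I.subgraph I.existing).Connected

/-- The time horizon `T`, which is the number of potential edges. -/
def horizon : ℕ := (Finset.univ \ I.existing).card

/-- The weight of an edge set. -/
noncomputable def setWeight (X : Finset (Fin m)) : ℝ := ∑ e ∈ X, I.weight e

/-- `X 0, …, X T` is a feasible solution: all sets are spanning trees, `X 0` uses existing edges
only, and `X i` contains at most one edge that is neither existing nor in `X 1 ∪ … ∪ X (i - 1)`.
The values `X i` for `i > T` are irrelevant. -/
def IsFeasible (X : ℕ → Finset (Fin m)) : Prop :=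
  (∀ i ≤ I.horizon, I.IsSpanningTree (X i)) ∧
  X 0 ⊆ I.existing ∧
  ∀ i, 1 ≤ i → i ≤ I.horizon →
    (X i ∩ (Finset.univ \ (I.existing ∪ (Finset.Ico 1 i).biUnion X))).card ≤ 1

/-- The objective `w(X 0) + … + w(X T)`. -/
noncomputable def totalWeight (X : ℕ → Finset (Fin m)) : ℝ :=
  ∑ i ∈ Finset.range (I.horizon + 1), I.setWeight (X i)

/-- `X 0, …, X T` is an optimal solution. -/
def IsOptimal (X : ℕ → Finset (Fin m)) : Prop :=
  I.IsFeasible X ∧ ∀ Y : ℕ → Finset (Fin m), I.IsFeasible Y → I.totalWeight X ≤ I.totalWeight Y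

end Instance

/-- The sequence of edge sets described by an initial set `X₀` and a list `(e₁, f₁), …, (eₖ, fₖ)` of
exchanges: its `i`-th member arises from `X₀` by performing the first `i` exchanges (all of them if
`i > k`), where the exchange `(e, f)` removes `e` and inserts `f`. -/
def exchangeSeq {m : ℕ} (X₀ : Finset (Fin m)) (L : List (Fin m × Fin m)) (i : ℕ) :
    Finset (Fin m) :=
  (L.take i).foldl (fun X p => insert p.2 (X.erase p.1)) X₀

end IndMst

/-! ## Random access machines with words and real numbers -/

namespace RAM

/-- The memory: arrays of words (natural numbers) and arrays of real numbers. The entry with index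
`i` of the word array number `a` is `word a i`. A scalar variable is the entry `0` of an array. -/
structure State where
  word : ℕ → ℕ → ℕ
  real : ℕ → ℕ → ℝ

/-- Word expressions: constants, memory access with a computed index, and arithmetic (with
truncated subtraction and rounding down in division; division by zero gives zero). The number of
the array that is accessed is fixed in the program. -/
inductive WExp where
  | const (k : ℕ)
  | get (a : ℕ) (i : WExp)
  | add (u v : WExp)
  | sub (u v : WExp)
  | mul (u v : WExp)
  | div (u v : WExp)

/-- Real expressions: memory access, addition and subtraction only. -/
inductive RExp where
  | get (a : ℕ) (i : WExp)
  | add (x y : RExp)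
  | sub (x y : RExp)

/-- Tests: comparisons of words, comparisons of real numbers, and Boolean combinations. -/
inductive Test where
  | lt (u v : WExp)
  | eq (u v : WExp)
  | le (x y : RExp)
  | not (b : Test)
  | and (b c : Test)

/-- Programs: assignments to a word or to a real memory cell with computed index, composition,
branching and loops. -/
inductive Program where
  | skip
  | setWord (a : ℕ) (i : WExp) (u : WExp)
  | setReal (a : ℕ) (i : WExp) (x : RExp)
  | seq (p q : Program)
  | ite (b : Test) (p q : Program)
  | loop (b : Test) (p : Program)

/-- The value of a word expression. -/
def WExp.val (s : State) : WExp → ℕ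
  | .const k => k
  | .get a i => s.word a (i.val s)
  | .add u v => u.val s + v.val s
  | .sub u v => u.val s - v.val s
  | .mul u v => u.val s * v.val s
  | .div u v => u.val s / v.val s

/-- The number of elementary operations needed to evaluate a word expression. -/
def WExp.cost : WExp → ℕ
  | .const _ => 1
  | .get _ i => i.cost + 1
  | .add u v => u.cost + v.cost + 1
  | .sub u v => u.cost + v.cost + 1
  | .mul u v => u.cost + v.cost + 1
  | .div u v => u.cost + v.cost + 1

/-- The value of a real expression. -/
noncomputable def RExp.val (s : State) : RExp → ℝ
  | .get a i => s.real a (i.val s)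
  | .add x y => x.val s + y.val s
  | .sub x y => x.val s - y.val s

/-- The number of elementary operations needed to evaluate a real expression. -/
def RExp.cost : RExp → ℕ
  | .get _ i => i.cost + 1
  | .add x y => x.cost + y.cost + 1
  | .sub x y => x.cost + y.cost + 1

/-- The truth value of a test. -/
def Test.holds (s : State) : Test → Prop
  | .lt u v => u.val s < v.val s
  | .eq u v => u.val s = v.val s
  | .le x y => x.val s ≤ y.val s
  | .not b => ¬ b.holds s
  | .and b c => b.holds s ∧ c.holds s

/-- The number of elementary operations needed to evaluate a test. -/
def Test.cost : Test → ℕ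
  | .lt u v => u.cost + v.cost + 1
  | .eq u v => u.cost + v.cost + 1
  | .le x y => x.cost + y.cost + 1
  | .not b => b.cost + 1
  | .and b c => b.cost + c.cost + 1

/-- Store the word `v` in entry `i` of the word array `a`. -/
def State.putWord (s : State) (a i v : ℕ) : State :=
  { s with word := Function.update s.word a (Function.update (s.word a) i v) }

/-- Store the real number `x` in entry `i` of the real array `a`. -/
noncomputable def State.putReal (s : State) (a i : ℕ) (x : ℝ) : State :=
  { s with real := Function.update s.real a (Function.update (s.real a) i x) }

/-- `Exec W p s t s'`: on a machine whose words hold the numbers `0, …, W`, the program `p`, started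
in the memory state `s`, terminates in the memory state `s'` after exactly `t` elementary operations.
There is no such execution if the program tries to store a number larger than `W` in a word. -/
inductive Exec (W : ℕ) : Program → State → ℕ → State → Prop where
  | skip (s : State) : Exec W .skip s 1 s
  | setWord (a : ℕ) (i u : WExp) (s : State) (h : u.val s ≤ W) :
      Exec W (.setWord a i u) s (i.cost + u.cost + 1) (s.putWord a (i.val s) (u.val s))
  | setReal (a : ℕ) (i : WExp) (x : RExp) (s : State) :
      Exec W (.setReal a i x) s (i.cost + x.cost + 1) (s.putReal a (i.val s) (x.val s))
  | seq {p q : Program} {s s' s'' : State} {t t' : ℕ}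
      (hp : Exec W p s t s') (hq : Exec W q s' t' s'') :
      Exec W (.seq p q) s (t + t') s''
  | ite_true {b : Test} {p : Program} (q : Program) {s s' : State} {t : ℕ}
      (hb : b.holds s) (hp : Exec W p s t s') :
      Exec W (.ite b p q) s (b.cost + t) s'
  | ite_false {b : Test} (p : Program) {q : Program} {s s' : State} {t : ℕ}
      (hb : ¬ b.holds s) (hq : Exec W q s t s') :
      Exec W (.ite b p q) s (b.cost + t) s'
  | loop_done {b : Test} (p : Program) {s : State} (hb : ¬ b.holds s) :
      Exec W (.loop b p) s b.cost s
  | loop_step {b : Test} {p : Program} {s s' s'' : State} {t t' : ℕ}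
      (hb : b.holds s) (hp : Exec W p s t s') (hl : Exec W (.loop b p) s' t' s'') :
      Exec W (.loop b p) s (b.cost + t + t') s''

end RAM

/-! ## Input and output conventions -/

namespace IndMst

/-- The initial memory for an instance: word array `0` holds `n` and `m`, word arrays `1` and `2` hold
the end vertices of the edges, word array `3` the indicator function of the set of existing edges,
and real array `0` the weights. All other cells hold zero. -/
noncomputable def Instance.initialState {n m : ℕ} (I : Instance n m) : RAM.State where
  word a i :=
    if a = 0 then (if i = 0 then n else if i = 1 then m else 0)
    else if h : i < m then
      (if a = 1 then (I.src ⟨i, h⟩ : ℕ)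
      else if a = 2 then (I.tgt ⟨i, h⟩ : ℕ)
      else if a = 3 then (if (⟨i, h⟩ : Fin m) ∈ I.existing then 1 else 0)
      else 0)
    else 0
  real a i := if h : i < m then (if a = 0 then I.weight ⟨i, h⟩ else 0) else 0

/-- The final memory contains the edge set `X₀` (indicator function in word array `4`) and the list
`L` of pairs of edges (length in entry `0` of word array `5`, first components in word array `6`,
second components in word array `7`). -/
def HasOutput {m : ℕ} (s : RAM.State) (X₀ : Finset (Fin m)) (L : List (Fin m × Fin m)) : Prop :=
  (∀ e : Fin m, s.word 4 e = if e ∈ X₀ then 1 else 0) ∧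
  s.word 5 0 = L.length ∧
  ∀ (i : ℕ) (h : i < L.length), s.word 6 i = (L[i].1 : ℕ) ∧ s.word 7 i = (L[i].2 : ℕ)

end IndMst

namespace RAM

/-! ### Evaluation of loop-free programs -/

/-! Reduction to single time steps. A feasible solution contains at most i new edges at time i
(`Instance.card_new_le`), so it suffices that each X_i has minimum weight among all spanning trees
with at most i new edges; then every summand of the objective is minimal by itself. The certificate
is Lagrangian: let every new edge cost lam ≥ 0 more. If X_i is a minimum spanning tree for the
penalized weights and either has exactly i new edges or lam = 0, then w(X_i) ≤ w(Y) for every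
spanning tree Y with at most i new edges.

All penalties at once. Order the edges by class (new before existing), then weight, then number.
Start with a minimum spanning tree X₀ of the existing edges and insert new edges in increasing
order; each new edge r expels the largest edge d of its cycle. Then r is the largest new edge of
that cycle and d, unless d = r, its largest existing edge. Both facts survive in every order that
agrees with the given one inside each class, in particular in the orders by penalized weight. Hence
r replaces d in the tree for penalty lam exactly when w(r) + lam < w(d), independently of the other
pairs (`SwapChain.snoc`, `setWeight_swapped_le`). As lam decreases from infinity to 0, the exchanges
of positive gain w(d) - w(r) take place in the order of decreasing gain, and performing them in this
order is optimal (`isOptimal_exchangeSeq`). Inserting only the edges of a minimum spanning forest of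
the new edges is enough.

The algorithm. Spanning forests are stored as in single-linkage clustering (SLINK): every vertex x
points to a larger number P x, with an edge K x as label, so that the pointers with labels below a
threshold define the same components as the edges below it. The pointers need not be edges, but the
labels form a minimum spanning forest (`Represents.spanned`). Adding a vertex takes one pass over
the smaller vertices (`PassInv.step`), and inserting an edge takes one ascent along the pointers
(`InsertInv.climb`, `InsertInv.exchange`); both cost O(n). There are at most n insertions, and both
the next new edge and the next exchange of largest gain are found by linear search. The total is
O(n² + m), which is within the claimed bound because m ≤ 2 max(n², m log m). -/

@[simp] theorem State.putWord_word (s : State) (a i v b j : ℕ) :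
    (s.putWord a i v).word b j = if b = a ∧ j = i then v else s.word b j := by
  by_cases hb : b = a
  · subst hb
    by_cases hj : j = i
    · subst hj; simp [State.putWord]
    · simp [State.putWord, hj]
  · simp [State.putWord, hb]

theorem State.putWord_word_of_ne (s : State) {a i v b : ℕ} (h : b ≠ a) :
    (s.putWord a i v).word b = s.word b := by
  simp [State.putWord, h]

@[simp] theorem State.putWord_real (s : State) (a i v : ℕ) :
    (s.putWord a i v).real = s.real := rfl

@[simp] theorem State.putReal_real (s : State) (a i : ℕ) (x : ℝ) (b j : ℕ) :
    (s.putReal a i x).real b j = if b = a ∧ j = i then x else s.real b j := by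
  by_cases hb : b = a
  · subst hb
    by_cases hj : j = i
    · subst hj; simp [State.putReal]
    · simp [State.putReal, hj]
  · simp [State.putReal, hb]

theorem State.putReal_real_of_ne (s : State) {a i b : ℕ} {x : ℝ} (h : b ≠ a) :
    (s.putReal a i x).real b = s.real b := by
  simp [State.putReal, h]

@[simp] theorem State.putReal_word (s : State) (a i : ℕ) (x : ℝ) :
    (s.putReal a i x).word = s.word := rfl

open Classical in
/-- The final state of a loop-free program. -/
noncomputable def Program.eval : Program → State → State
  | .skip, s => s
  | .setWord a i u, s => s.putWord a (i.val s) (u.val s)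
  | .setReal a i x, s => s.putReal a (i.val s) (x.val s)
  | .seq p q, s => q.eval (p.eval s)
  | .ite b p q, s => if b.holds s then p.eval s else q.eval s
  | .loop _ _, s => s

/-- A loop-free program stores only numbers that fit into a word. -/
def Program.Fits (W : ℕ) : Program → State → Prop
  | .skip, _ => True
  | .setWord _ _ u, s => u.val s ≤ W
  | .setReal _ _ _, _ => True
  | .seq p q, s => p.Fits W s ∧ q.Fits W (p.eval s)
  | .ite b p q, s => (b.holds s → p.Fits W s) ∧ (¬ b.holds s → q.Fits W s)
  | .loop _ _, _ => False

/-- A bound for the running time of a loop-free program. -/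
def Program.maxCost : Program → ℕ
  | .skip => 1
  | .setWord _ i u => i.cost + u.cost + 1
  | .setReal _ i x => i.cost + x.cost + 1
  | .seq p q => p.maxCost + q.maxCost
  | .ite b p q => b.cost + (p.maxCost + q.maxCost)
  | .loop _ _ => 0

/-! ### Total correctness with a time bound -/

/-- The program stops within `T` steps in a state satisfying `Q`. -/
def Runs (W : ℕ) (p : Program) (s : State) (T : ℕ) (Q : State → Prop) : Prop :=
  ∃ t s', Exec W p s t s' ∧ t ≤ T ∧ Q s'

theorem Runs.mono {W : ℕ} {p : Program} {s : State} {T T' : ℕ} {Q Q' : State → Prop}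
    (h : Runs W p s T Q) (hT : T ≤ T') (hQ : ∀ s', Q s' → Q' s') : Runs W p s T' Q' := by
  obtain ⟨t, s', he, ht, hq⟩ := h
  exact ⟨t, s', he, ht.trans hT, hQ _ hq⟩

theorem Runs.seq {W : ℕ} {p q : Program} {s : State} {T T' : ℕ} {Q Q' : State → Prop}
    (hp : Runs W p s T Q) (hq : ∀ s', Q s' → Runs W q s' T' Q') :
    Runs W (.seq p q) s (T + T') Q' := by
  obtain ⟨t, s', he, ht, hs⟩ := hp
  obtain ⟨t', s'', he', ht', hs'⟩ := hq s' hs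
  exact ⟨t + t', s'', .seq he he', by omega, hs'⟩

theorem Runs.ite {W : ℕ} {b : Test} {p q : Program} {s : State} {T : ℕ} {Q : State → Prop}
    (hp : b.holds s → Runs W p s T Q) (hq : ¬ b.holds s → Runs W q s T Q) :
    Runs W (.ite b p q) s (b.cost + T) Q := by
  by_cases hb : b.holds s
  · obtain ⟨t, s', he, ht, hs⟩ := hp hb
    exact ⟨_, s', .ite_true q hb he, by omega, hs⟩
  · obtain ⟨t, s', he, ht, hs⟩ := hq hb
    exact ⟨_, s', .ite_false p hb he, by omega, hs⟩

/-- Without loops the execution is a simulation of `eval`. Correctness of straight-line code thus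
becomes a computation by `simp`, and its time bound a comparison of numerals. Both branches of a
conditional are charged, so the bound does not depend on the state. -/
theorem Runs.of_fits {W : ℕ} (p : Program) : ∀ {s : State} {Q : State → Prop}, p.Fits W s →
    Q (p.eval s) → Runs W p s p.maxCost Q := by
  induction p with
  | skip => intro s Q _ hQ; exact ⟨_, _, .skip s, le_rfl, hQ⟩
  | setWord a i u => intro s Q h hQ; exact ⟨_, _, .setWord a i u s h, le_rfl, hQ⟩
  | setReal a i x => intro s Q h hQ; exact ⟨_, _, .setReal a i x s, le_rfl, hQ⟩
  | seq p q ihp ihq =>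
    intro s Q h hQ
    refine (ihp (Q := fun s' => s' = p.eval s) h.1 rfl).seq ?_
    rintro _ rfl
    exact ihq h.2 hQ
  | ite b p q ihp ihq =>
    intro s Q h hQ
    refine Runs.ite (fun hb => ?_) (fun hb => ?_)
    · simp only [Program.eval, hb, if_true] at hQ
      exact (ihp (h.1 hb) hQ).mono (by omega) (fun _ h => h)
    · simp only [Program.eval, hb, if_false] at hQ
      exact (ihq (h.2 hb) hQ).mono (by omega) (fun _ h => h)
  | loop b p _ => intro s Q h; exact h.elim

/-- A loop with an invariant indexed by a bound for the number of remaining iterations. -/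
theorem Runs.loop {W : ℕ} {b : Test} {p : Program} {B : ℕ} (Inv : ℕ → State → Prop)
    (step : ∀ k s, Inv k s → b.holds s →
      ∃ j, k = j + 1 ∧ Runs W p s B (fun s' => Inv j s')) :
    ∀ k s, Inv k s → Runs W (.loop b p) s (b.cost + k * (b.cost + B))
      (fun s' => ¬ b.holds s' ∧ ∃ j, Inv j s') := by
  intro k
  induction k with
  | zero =>
    intro s hs
    by_cases hb : b.holds s
    · obtain ⟨j, hj, _⟩ := step 0 s hs hb
      omega
    · exact ⟨_, s, .loop_done p hb, by omega, hb, _, hs⟩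
  | succ k ih =>
    intro s hs
    by_cases hb : b.holds s
    · obtain ⟨j, hj, t, s', he, ht, hs'⟩ := step (k + 1) s hs hb
      obtain rfl : j = k := by omega
      obtain ⟨t', s'', he', ht', hs''⟩ := ih s' hs'
      refine ⟨_, s'', .loop_step hb he he', ?_, hs''⟩
      rw [Nat.succ_mul]; omega
    · exact ⟨_, s, .loop_done p hb, by omega, hb, _, hs⟩

/-- The loop in which the scalar variable `i` runs through the numbers less than `N`. -/
def forTo (i : ℕ) (N : WExp) (p : Program) : Program :=
  .seq (.setWord i (.const 0) (.const 0))
    (.loop (.lt (.get i (.const 0)) N)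
      (.seq p (.setWord i (.const 0) (.add (.get i (.const 0)) (.const 1)))))

/-- The bound `N` is evaluated anew in every round, so the invariant has to fix its value. A test
costs `N.cost + 3`, an increment 6 and the initialization 3; the summand 12 absorbs all of them, the
final test included. -/
theorem Runs.forTo {W i k B : ℕ} {N : WExp} {p : Program} {s : State} (Inv : ℕ → State → Prop)
    (hk : k ≤ W) (h0 : Inv 0 (s.putWord i 0 0))
    (hN : ∀ j s, Inv j s → N.val s = k)
    (step : ∀ j, j < k → ∀ s, s.word i 0 = j → Inv j s →
      Runs W p s B (fun s' => s'.word i 0 = j ∧ Inv (j + 1) (s'.putWord i 0 (j + 1)))) :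
    Runs W (RAM.forTo i N p) s ((k + 1) * (B + N.cost + 12)) (Inv k) := by
  have hloop := Runs.loop (W := W) (b := .lt (.get i (.const 0)) N)
    (p := .seq p (.setWord i (.const 0) (.add (.get i (.const 0)) (.const 1)))) (B := B + 6)
    (fun r s' => ∃ j, r + j = k ∧ s'.word i 0 = j ∧ Inv j s') (by
      rintro r s' ⟨j, hr, hj, hI⟩ hb
      simp only [Test.holds, WExp.val, hN j s' hI, hj] at hb
      refine ⟨k - (j + 1), by omega, ?_⟩
      refine (step j hb s' hj hI).seq (T' := 6) ?_
      rintro s'' ⟨h1, h2⟩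
      refine (Runs.of_fits _ ?_ ?_).mono (T := 6) ?_ (fun _ h => h)
      · simp only [Program.Fits, WExp.val, h1]; omega
      · simp only [Program.eval, WExp.val, h1]
        exact ⟨j + 1, by omega, by simp, h2⟩
      · exact le_rfl)
  have hinit : Runs W (.setWord i (.const 0) (.const 0)) s 3
      (fun s' => s' = s.putWord i 0 0) := by
    refine (Runs.of_fits _ ?_ ?_).mono (T := 3) ?_ (fun _ h => h)
    · simp [Program.Fits, WExp.val]
    · simp [Program.eval, WExp.val]
    · exact le_rfl
  refine (hinit.seq (T' := (N.cost + 3) + k * ((N.cost + 3) + (B + 6))) ?_).mono ?_ (fun _ h => h)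
    (Q := Inv k)
  · rintro _ rfl
    refine (hloop k _ ⟨0, by simp, by simp, h0⟩).mono ?_ ?_
    · simp only [Test.cost, WExp.cost]
      rw [show 1 + 1 + N.cost + 1 = N.cost + 3 by omega]
    · rintro s' ⟨hb, r, j, hr, hj, hI⟩
      simp only [Test.holds, WExp.val, hN j s' hI, hj] at hb
      obtain rfl : j = k := by omega
      exact hI
  · nlinarith [Nat.zero_le (k * 3)]

/-- The states agree except possibly on the listed word arrays. -/
def SameExcept (l : List ℕ) (s s' : State) : Prop :=
  (∀ a ∉ l, s'.word a = s.word a) ∧ s'.real = s.real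

end RAM

namespace IndMst

/-! ### Connectivity by sets of edges -/

section Connectivity

variable {V E : Type*} {s t : E → V}

/-- The relation of being connected by edges of `S`. -/
def conn (s t : E → V) (S : Set E) : Setoid V :=
  Relation.EqvGen.setoid (fun u v => ∃ e ∈ S, s e = u ∧ t e = v)

theorem conn_edge {S : Set E} {e : E} (h : e ∈ S) : conn s t S (s e) (t e) :=
  Relation.EqvGen.rel _ _ ⟨e, h, rfl, rfl⟩

/-- This is the universal property of the generated equivalence relation. Most later connectivity
arguments are instances of it: to replace a set of edges by another one, it suffices to reconnect
the ends of each single edge. -/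
theorem conn_le {S : Set E} {R : Setoid V} (h : ∀ e ∈ S, R (s e) (t e)) {u v : V}
    (huv : conn s t S u v) : R u v := by
  induction huv with
  | rel x y h' => obtain ⟨e, he, rfl, rfl⟩ := h'; exact h e he
  | refl x => exact R.refl x
  | symm x y _ ih => exact R.symm ih
  | trans x y z _ _ ih ih' => exact R.trans ih ih'

theorem conn_mono {S S' : Set E} (h : S ⊆ S') {u v : V} (huv : conn s t S u v) :
    conn s t S' u v :=
  conn_le (fun _ he => conn_edge (h he)) huv

/-- A path needs the additional edge at most once, in one of two directions. -/
theorem conn_insert {S : Set E} {r : E} {u v : V} (h : conn s t (insert r S) u v) :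
    conn s t S u v ∨ (conn s t S u (s r) ∧ conn s t S (t r) v) ∨
      (conn s t S u (t r) ∧ conn s t S (s r) v) := by
  have tr : ∀ {x y z}, conn s t S x y → conn s t S y z → conn s t S x z :=
    fun h h' => Setoid.trans' _ h h'
  have sy : ∀ {x y}, conn s t S x y → conn s t S y x := fun h => Setoid.symm' _ h
  have rf : ∀ x, conn s t S x x := fun x => Setoid.refl' _ x
  induction h with
  | rel x y h' =>
    obtain ⟨e, he | he, rfl, rfl⟩ := h'
    · subst he; exact Or.inr (Or.inl ⟨rf _, rf _⟩)
    · exact Or.inl (conn_edge he)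
  | refl x => exact Or.inl (rf x)
  | symm x y _ ih =>
    rcases ih with h | ⟨h, h'⟩ | ⟨h, h'⟩
    · exact Or.inl (sy h)
    · exact Or.inr (Or.inr ⟨sy h', sy h⟩)
    · exact Or.inr (Or.inl ⟨sy h', sy h⟩)
  | trans x y z _ _ ih ih' =>
    rcases ih with h | ⟨h, h'⟩ | ⟨h, h'⟩ <;> rcases ih' with k | ⟨k, k'⟩ | ⟨k, k'⟩
    · exact Or.inl (tr h k)
    · exact Or.inr (Or.inl ⟨tr h k, k'⟩)
    · exact Or.inr (Or.inr ⟨tr h k, k'⟩)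
    · exact Or.inr (Or.inl ⟨h, tr h' k⟩)
    · exact Or.inr (Or.inl ⟨h, k'⟩)
    · exact Or.inl (tr h k')
    · exact Or.inr (Or.inr ⟨h, tr h' k⟩)
    · exact Or.inl (tr h k')
    · exact Or.inr (Or.inr ⟨h, k'⟩)

/-- The exchange property of cycles. -/
theorem conn_exchange {S : Set E} {r g : E} (h : conn s t (insert r S) (s g) (t g))
    (h' : ¬ conn s t S (s g) (t g)) : conn s t (insert g S) (s r) (t r) := by
  have up : ∀ {u v}, conn s t S u v → conn s t (insert g S) u v :=
    fun h => conn_mono (Set.subset_insert _ _) h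
  have tr : ∀ {x y z}, conn s t (insert g S) x y → conn s t (insert g S) y z →
    conn s t (insert g S) x z := fun h h' => Setoid.trans' _ h h'
  have sy : ∀ {x y}, conn s t (insert g S) x y → conn s t (insert g S) y x :=
    fun h => Setoid.symm' _ h
  have hg : conn s t (insert g S) (s g) (t g) := conn_edge (Set.mem_insert _ _)
  rcases conn_insert h with h | ⟨h, k⟩ | ⟨h, k⟩
  · exact (h' h).elim
  · exact tr (tr (sy (up h)) hg) (sy (up k))
  · exact tr (tr (up k) (sy hg)) (up h)

/-- The set connects the ends of all edges. -/
def Spans (s t : E → V) (S : Set E) : Prop := ∀ e, conn s t S (s e) (t e)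

theorem Spans.of_conn {S S' : Set E} (h : Spans s t S)
    (h' : ∀ e ∈ S, conn s t S' (s e) (t e)) : Spans s t S' :=
  fun e => conn_le h' (h e)

/-- Every edge of `A` is connected by edges of `X` that are not larger. -/
def Spanned {β : Type*} [LE β] (s t : E → V) (f : E → β) (A X : Set E) : Prop :=
  ∀ e ∈ A, conn s t {x | x ∈ X ∧ f x ≤ f e} (s e) (t e)

theorem Spanned.spans {β : Type*} [LE β] {f : E → β} {A X : Set E} (h : Spanned s t f A X)
    (hA : Spans s t A) : Spans s t X :=
  hA.of_conn fun e he => conn_mono (fun _ hx => hx.1) (h e he)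

variable [DecidableEq E] {N : ℕ}

/-- A spanning set of the least possible cardinality `N` is minimal under inclusion, so it contains
no cycle. In this way trees are handled by counting alone. -/
theorem not_conn_erase (hN : ∀ S : Finset E, Spans s t (S : Set E) → N ≤ S.card) {T : Finset E}
    (hT : Spans s t (T : Set E)) (hc : T.card = N) {g : E} (hg : g ∈ T) :
    ¬ conn s t ((T.erase g : Finset E) : Set E) (s g) (t g) := by
  intro h
  have : Spans s t ((T.erase g : Finset E) : Set E) := by
    refine hT.of_conn fun e he => ?_
    by_cases heg : e = g
    · subst heg; exact h
    · exact conn_edge (by simpa [heg] using he)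
  have h1 := hN _ this
  have h2 := Finset.card_erase_lt_of_mem hg
  omega

/-- A tree satisfying the cycle condition has minimum weight. -/
theorem sum_le_of_spanned (hN : ∀ S : Finset E, Spans s t (S : Set E) → N ≤ S.card)
    {f : E → ℝ} {X : Finset E} (hc : X.card = N)
    (hf : Spanned s t f Set.univ X) :
    ∀ (k : ℕ) (Y : Finset E), (Y \ X).card = k → Spans s t (Y : Set E) → Y.card = N →
      ∑ e ∈ X, f e ≤ ∑ e ∈ Y, f e := by
  intro k
  induction k with
  | zero =>
    intro Y hk _ hY
    have hsub : Y ⊆ X := by simpa [Finset.sdiff_eq_empty_iff_subset] using hk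
    rw [Finset.eq_of_subset_of_card_le hsub (by omega)]
  | succ k ih =>
    intro Y hk hYs hY
    obtain ⟨y, hy⟩ : (Y \ X).Nonempty := by rw [← Finset.card_pos]; omega
    rw [Finset.mem_sdiff] at hy
    have hny := not_conn_erase hN hYs hY hy.1
    -- Removing y splits Y into two sides. The path in X between the ends of y, all of whose edges
    -- cost at most `f y`, crosses between them at some x. Exchanging y for x keeps a tree, does not
    -- increase the weight, and brings Y closer to X.
    obtain ⟨x, hx, hxc⟩ : ∃ x, (x ∈ X ∧ f x ≤ f y) ∧
        ¬ conn s t ((Y.erase y : Finset E) : Set E) (s x) (t x) := by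
      by_contra! hcon
      exact hny (conn_le (fun e he => hcon e he) (hf y trivial))
    have hxY : x ∉ Y.erase y := fun h => hxc (conn_edge (by exact_mod_cast h))
    have hxy : x ≠ y := fun h => hy.2 (h ▸ hx.1)
    have hxY' : x ∉ Y := fun h => hxY (Finset.mem_erase.2 ⟨hxy, h⟩)
    have hins : insert y (Y.erase y) = Y := Finset.insert_erase hy.1
    have hy' : conn s t ((insert x (Y.erase y) : Finset E) : Set E) (s y) (t y) := by
      rw [Finset.coe_insert]
      refine conn_exchange ?_ hxc
      rw [← Finset.coe_insert, hins]
      exact hYs x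
    have hcard : (insert x (Y.erase y)).card = N := by
      rw [Finset.card_insert_of_notMem hxY, Finset.card_erase_of_mem hy.1]
      have := Finset.card_pos.2 ⟨y, hy.1⟩
      omega
    refine (ih (insert x (Y.erase y)) ?_ ?_ hcard).trans ?_
    · have : insert x (Y.erase y) \ X = (Y \ X).erase y := by
        ext z
        simp only [Finset.mem_sdiff, Finset.mem_insert, Finset.mem_erase]
        constructor
        · rintro ⟨rfl | h, h'⟩
          · exact (h' hx.1).elim
          · exact ⟨h.1, h.2, h'⟩
        · rintro ⟨h, h', h''⟩
          exact ⟨Or.inr ⟨h, h'⟩, h''⟩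
      rw [this, Finset.card_erase_of_mem (Finset.mem_sdiff.2 hy)]
      omega
    · refine hYs.of_conn fun e he => ?_
      by_cases hey : e = y
      · subst hey; exact hy'
      · exact conn_edge (by simpa [hey] using Or.inr he)
    · rw [Finset.sum_insert hxY, ← Finset.add_sum_erase _ _ hy.1]
      linarith [hx.2]

end Connectivity

/-! ### Exchanging edges of one class for edges of another class -/

section Swaps

variable {V E β γ : Type*} [DecidableEq E] [LinearOrder β] [LinearOrder γ]

/-- The set obtained from `X₀` by those exchanges `(r, d)` for which `r` comes before `d`. -/
def swapped (σ : E → γ) (X₀ : Finset E) (prs : List (E × E)) : Finset E :=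
  (X₀ \ ((prs.filter fun p => σ p.1 < σ p.2).map Prod.snd).toFinset) ∪
    ((prs.filter fun p => σ p.1 < σ p.2).map Prod.fst).toFinset

theorem mem_swapped {σ : E → γ} {X₀ : Finset E} {prs : List (E × E)} {e : E} :
    e ∈ swapped σ X₀ prs ↔ (e ∈ X₀ ∧ ∀ p ∈ prs, σ p.1 < σ p.2 → p.2 ≠ e) ∨
      ∃ p ∈ prs, σ p.1 < σ p.2 ∧ p.1 = e := by
  simp only [swapped, Finset.mem_union, Finset.mem_sdiff, List.mem_toFinset, List.mem_map,
    List.mem_filter, decide_eq_true_eq, not_exists, not_and]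
  constructor
  · rintro (⟨h, h'⟩ | ⟨p, ⟨h1, h2⟩, h3⟩)
    · exact Or.inl ⟨h, fun p hp hs => h' p ⟨hp, hs⟩⟩
    · exact Or.inr ⟨p, h1, h2, h3⟩
  · rintro (⟨h, h'⟩ | ⟨p, h1, h2, h3⟩)
    · exact Or.inl ⟨h, fun p hp => h' p hp.1 hp.2⟩
    · exact Or.inr ⟨p, ⟨h1, h2⟩, h3⟩

/-- The two orders agree on `G` and on its complement. -/
structure Compatible (G : Finset E) (κ : E → β) (σ : E → γ) : Prop where
  inj : Function.Injective σ
  inside : ∀ a ∈ G, ∀ b ∈ G, κ a < κ b → σ a < σ b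
  outside : ∀ a ∉ G, ∀ b ∉ G, κ a < κ b → σ a < σ b

/-- The edges that have been considered after the exchanges `prs`. -/
def seen (G : Finset E) (prs : List (E × E)) : Set E :=
  {e | e ∈ G ∨ ∃ p ∈ prs, p.1 = e}

/-- The exchanges `prs` lead from the tree `X₀ ⊆ G` to the tree `T`, where the edges outside `G` are
inserted in increasing order, and each of them replaces the largest edge of its cycle. -/
structure SwapChain (s t : E → V) (N : ℕ) (G : Finset E) (κ : E → β) (X₀ : Finset E)
    (prs : List (E × E)) (T : Finset E) : Prop where
  card : T.card = N
  spanned : Spanned s t κ (seen G prs) T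
  fst_notMem : ∀ p ∈ prs, p.1 ∉ G
  snd_mem : ∀ p ∈ prs, p.2 = p.1 ∨ p.2 ∈ X₀
  sub : ∀ x ∈ T, x ∈ seen G prs
  keep : ∀ x ∈ T, x ∈ G → x ∈ X₀ ∧ ∀ p ∈ prs, p.2 ≠ x
  sorted : (prs.map Prod.fst).Pairwise (fun a b => κ a < κ b)
  card_swapped : ∀ σ : E → ℝ ×ₗ ℕ ×ₗ β, Compatible G κ σ → (swapped σ X₀ prs).card = N
  spanned_swapped : ∀ σ : E → ℝ ×ₗ ℕ ×ₗ β, Compatible G κ σ →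
    Spanned s t σ (seen G prs) (swapped σ X₀ prs : Set E)

/-- Before the first exchange only edges of `G` matter, and on `G` every compatible order is the
order given by `κ`. -/
theorem SwapChain.nil {s t : E → V} {N : ℕ} {G : Finset E} {κ : E → β} {X₀ : Finset E}
    (hκ : Function.Injective κ) (hX : X₀ ⊆ G) (hc : X₀.card = N) (hs : Spanned s t κ G X₀) :
    SwapChain s t N G κ X₀ [] X₀ where
  card := hc
  spanned := by simpa [seen] using hs
  fst_notMem := by simp
  snd_mem := by simp
  sub := fun x hx => Or.inl (hX hx)
  keep := fun x hx _ => ⟨hx, by simp⟩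
  sorted := by simp
  card_swapped := fun σ _ => by simpa [swapped] using hc
  spanned_swapped := by
    intro σ hσ e he
    have he' : e ∈ G := by simpa [seen] using he
    refine conn_mono ?_ (hs e he')
    rintro x ⟨hx, hxe⟩
    refine ⟨by simpa [swapped] using hx, ?_⟩
    rcases hxe.lt_or_eq with h | h
    · exact (hσ.inside x (hX hx) e he' h).le
    · rw [hκ h]

theorem swapped_append {σ : E → γ} {X₀ : Finset E} {prs : List (E × E)} {r d : E}
    (h : ¬ σ r < σ d) : swapped σ X₀ (prs ++ [(r, d)]) = swapped σ X₀ prs := by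
  simp [swapped, List.filter_append, h]

/-- On the cycle that `r` closes in `T`, `r` is the largest new edge and `d`, if different from `r`,
the largest existing one. A compatible order `σ` preserves both maxima, so the comparison of `σ r`
with `σ d` alone decides which edge is expelled in the order `σ`. The tree for `σ` differs from `T`,
but each edge of `T` is bridged in it by edges that are not larger, so the argument carries over
from cycles to connectivity below thresholds. -/
theorem SwapChain.snoc {s t : E → V} {N : ℕ} {G : Finset E} {κ : E → β} {X₀ : Finset E}
    (hN : ∀ S : Finset E, Spans s t (S : Set E) → N ≤ S.card) (hG : Spans s t (G : Set E))
    (hκ : Function.Injective κ) (hX₀ : X₀ ⊆ G) (hGκ : ∀ a ∉ G, ∀ b ∈ G, κ a < κ b)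
    {prs : List (E × E)} {T T' : Finset E} (h : SwapChain s t N G κ X₀ prs T) {r d : E}
    (hr : r ∉ G) (hlast : ∀ p ∈ prs, κ p.1 < κ r) (hT'c : T'.card = N)
    (hins : insert d T' = insert r T) (hrd : κ r ≤ κ d)
    (hT' : Spanned s t κ (seen G (prs ++ [(r, d)])) T') :
    SwapChain s t N G κ X₀ (prs ++ [(r, d)]) T' := by
  have hrseen : r ∉ seen G prs := by
    rintro (h' | ⟨p, hp, rfl⟩)
    · exact hr h'
    · exact lt_irrefl _ (hlast p hp)
  have hrT : r ∉ T := fun h' => hrseen (h.sub r h')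
  -- Otherwise `T'` would equal `insert r T`, which has one edge too many.
  have hd : d ∉ T' := by
    intro h'
    rw [Finset.insert_eq_of_mem h'] at hins
    have := congrArg Finset.card hins
    rw [Finset.card_insert_of_notMem hrT, h.card, hT'c] at this
    omega
  have hseen : ∀ e, e ∈ seen G (prs ++ [(r, d)]) ↔ e ∈ seen G prs ∨ e = r := by
    intro e
    simp only [seen, Set.mem_ofPred_eq, List.mem_append, List.mem_singleton]
    constructor
    · rintro (h | ⟨p, hp | rfl, rfl⟩)
      · exact Or.inl (Or.inl h)
      · exact Or.inl (Or.inr ⟨p, hp, rfl⟩)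
      · exact Or.inr rfl
    · rintro ((h | ⟨p, hp, rfl⟩) | rfl)
      · exact Or.inl h
      · exact Or.inr ⟨p, Or.inl hp, rfl⟩
      · exact Or.inr ⟨_, Or.inr rfl, rfl⟩
  have hmemT' : ∀ x, x ∈ T' ↔ (x = r ∨ x ∈ T) ∧ x ≠ d := by
    intro x
    have : x ∈ insert d T' ↔ x ∈ insert r T := by rw [hins]
    simp only [Finset.mem_insert] at this
    constructor
    · intro hx
      exact ⟨this.1 (Or.inr hx), fun h' => hd (h' ▸ hx)⟩
    · rintro ⟨hx, hxd⟩
      exact (this.2 hx).resolve_left hxd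
  have hdT : d = r ∨ d ∈ T := by
    have : d ∈ insert r T := hins ▸ Finset.mem_insert_self _ _
    simpa using this
  have hTs : Spans s t (T : Set E) := h.spanned.spans fun e => conn_mono (fun x hx => Or.inl hx) (hG e)
  have hT's : Spans s t (T' : Set E) := hT'.spans fun e => conn_mono (fun x hx => Or.inl hx) (hG e)
  -- All earlier new edges are smaller than `r`, so an expelled edge larger than `r` is an existing
  -- one. Being still in `T`, it belongs to `X₀` and was not expelled before.
  have hdX : d ≠ r → d ∈ T ∧ d ∈ G ∧ d ∈ X₀ ∧ (∀ p ∈ prs, p.2 ≠ d) ∧ κ r < κ d := by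
    intro hne
    have hT := hdT.resolve_left hne
    have hlt : κ r < κ d := lt_of_le_of_ne hrd fun h' => hne (hκ h').symm
    have hdG : d ∈ G := by
      rcases h.sub d hT with h' | ⟨p, hp, rfl⟩
      · exact h'
      · exact absurd (hlast p hp) hlt.not_gt
    exact ⟨hT, hdG, (h.keep d hT hdG).1, (h.keep d hT hdG).2, hlt⟩
  -- the edges that are relevant to the new cycle
  have hbelow : conn s t {x | x ∈ T ∧ κ x ≤ κ d} (s r) (t r) := by
    rcases eq_or_ne d r with rfl | hne
    · refine conn_mono ?_ (hT' d ((hseen d).2 (Or.inr rfl)))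
      rintro x ⟨hx, hxd⟩
      rw [Finset.mem_coe, hmemT'] at hx
      exact ⟨hx.1.resolve_left hx.2, hxd⟩
    · obtain ⟨hT, hdG, hd0, -, hlt⟩ := hdX hne
      have h1 := hT' d ((hseen d).2 (Or.inl (Or.inl hdG)))
      have h2 : conn s t (insert r {x | x ∈ T.erase d ∧ κ x ≤ κ d}) (s d) (t d) := by
        refine conn_mono ?_ h1
        rintro x ⟨hx, hxd⟩
        rw [Finset.mem_coe, hmemT'] at hx
        rcases hx.1 with rfl | hxT
        · exact Or.inl rfl
        · exact Or.inr ⟨Finset.mem_erase.2 ⟨hx.2, hxT⟩, hxd⟩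
      refine conn_mono ?_ (conn_exchange h2 fun h3 =>
        not_conn_erase hN hTs h.card hT (conn_mono (fun x hx => hx.1) h3))
      rintro x (rfl | ⟨hx, hxd⟩)
      · exact ⟨hT, le_rfl⟩
      · exact ⟨(Finset.mem_erase.1 hx).2, hxd⟩
  -- Edges below `d` are bridged by edges of `T` other than `d`. If they connected the ends of `r`,
  -- then `T` without `d` would connect the ends of all edges of `T'`, hence span with only `N - 1`
  -- edges.
  have hnot : d ≠ r → ¬ conn s t {x | x ∈ seen G prs ∧ κ x < κ d} (s r) (t r) := by
    intro hne hcon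
    obtain ⟨hT, hdG, hd0, -, hlt⟩ := hdX hne
    have h1 : conn s t ((T.erase d : Finset E) : Set E) (s r) (t r) := by
      refine conn_le (fun e he => ?_) hcon
      refine conn_mono ?_ (h.spanned e he.1)
      rintro x ⟨hx, hxe⟩
      have : x ≠ d := by rintro rfl; exact absurd he.2 hxe.not_gt
      simpa [this] using hx
    have h2 : Spans s t ((T.erase d : Finset E) : Set E) := by
      refine hT's.of_conn fun e he => ?_
      rw [Finset.mem_coe, hmemT'] at he
      rcases he.1 with rfl | heT
      · exact h1
      · exact conn_edge (by simpa [he.2] using heT)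
    have := hN _ h2
    have h3 := Finset.card_erase_lt_of_mem hT
    rw [h.card] at h3
    omega
  -- comparison of the two orders
  have hσle : ∀ σ : E → ℝ ×ₗ ℕ ×ₗ β, Compatible G κ σ → ∀ b, σ r ≤ b → σ d ≤ b →
      ∀ x ∈ T, κ x ≤ κ d → σ x ≤ b := by
    intro σ hσ b hb1 hb2 x hx hxd
    by_cases hxG : x ∈ G
    · rcases eq_or_ne d r with rfl | hne
      · exact absurd (hGκ d hr x hxG) hxd.not_gt
      · obtain ⟨-, hdG, -⟩ := hdX hne
        rcases hxd.lt_or_eq with h' | h'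
        · exact (hσ.inside x hxG d hdG h').le.trans hb2
        · rw [hκ h']; exact hb2
    · rcases h.sub x hx with h' | ⟨p, hp, rfl⟩
      · exact absurd h' hxG
      · exact (hσ.outside _ hxG r hr (hlast p hp)).le.trans hb1
  have hXmem : ∀ σ : E → ℝ ×ₗ ℕ ×ₗ β, σ r < σ d → ∀ x,
      x ∈ swapped σ X₀ (prs ++ [(r, d)]) ↔ x = r ∨ (x ∈ swapped σ X₀ prs ∧ x ≠ d) := by
    intro σ hlt x
    have hne : d ≠ r := fun h' => by simp [h'] at hlt
    obtain ⟨hT, hdG, hd0, hdp, hlt'⟩ := hdX hne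
    simp only [mem_swapped, List.mem_append, List.mem_singleton]
    constructor
    · rintro (⟨hx, hx'⟩ | ⟨p, hp | rfl, hs, rfl⟩)
      · exact Or.inr ⟨Or.inl ⟨hx, fun p hp => hx' p (Or.inl hp)⟩,
          fun h' => hx' (r, d) (Or.inr rfl) hlt h'.symm⟩
      · refine Or.inr ⟨Or.inr ⟨p, hp, hs, rfl⟩, fun h' => h.fst_notMem p hp (h' ▸ hdG)⟩
      · exact Or.inl rfl
    · rintro (rfl | ⟨⟨hx, hx'⟩ | ⟨p, hp, hs, rfl⟩, hxd⟩)
      · exact Or.inr ⟨_, Or.inr rfl, hlt, rfl⟩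
      · refine Or.inl ⟨hx, ?_⟩
        rintro p (hp | rfl) hs
        · exact hx' p hp hs
        · exact hxd.symm
      · exact Or.inr ⟨p, Or.inl hp, hs, rfl⟩
  have hrX : ∀ σ : E → ℝ ×ₗ ℕ ×ₗ β, r ∉ swapped σ X₀ prs := by
    intro σ hx
    rcases mem_swapped.1 hx with ⟨h', -⟩ | ⟨p, hp, -, h'⟩
    · exact hr (hX₀ h')
    · exact lt_irrefl _ (h' ▸ hlast p hp)
  refine ⟨hT'c, hT', ?_, ?_, ?_, ?_, ?_, ?_, ?_⟩
  · intro p hp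
    rcases List.mem_append.1 hp with hp | hp
    · exact h.fst_notMem p hp
    · rw [List.mem_singleton.1 hp]; exact hr
  · intro p hp
    rcases List.mem_append.1 hp with hp | hp
    · exact h.snd_mem p hp
    · rw [List.mem_singleton.1 hp]
      by_cases hne : d = r
      · exact Or.inl hne
      · exact Or.inr (hdX hne).2.2.1
  · intro x hx
    rw [hmemT'] at hx
    rcases hx.1 with hx | hx
    · exact (hseen x).2 (Or.inr hx)
    · exact (hseen x).2 (Or.inl (h.sub x hx))
  · intro x hx hxG
    rw [hmemT'] at hx
    have hxT : x ∈ T := hx.1.resolve_left fun h' => hr (h' ▸ hxG)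
    refine ⟨(h.keep x hxT hxG).1, fun p hp => ?_⟩
    rcases List.mem_append.1 hp with hp | hp
    · exact (h.keep x hxT hxG).2 p hp
    · rw [List.mem_singleton.1 hp]; exact hx.2.symm
  · rw [List.map_append, List.pairwise_append]
    refine ⟨h.sorted, by simp, ?_⟩
    intro a ha b hb
    obtain ⟨p, hp, rfl⟩ := List.mem_map.1 ha
    obtain rfl : b = r := by simpa using hb
    exact hlast p hp
  · intro σ hσ
    by_cases hlt : σ r < σ d
    · have hne : d ≠ r := fun h' => by simp [h'] at hlt
      obtain ⟨hT, hdG, hd0, hdp, hlt'⟩ := hdX hne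
      have hdX' : d ∈ swapped σ X₀ prs :=
        mem_swapped.2 (Or.inl ⟨hd0, fun p hp _ => hdp p hp⟩)
      have : swapped σ X₀ (prs ++ [(r, d)]) = insert r ((swapped σ X₀ prs).erase d) := by
        ext x; rw [hXmem σ hlt]; simp [and_comm]
      rw [this, Finset.card_insert_of_notMem (fun h' => hrX σ (Finset.mem_erase.1 h').2),
        Finset.card_erase_of_mem hdX', h.card_swapped σ hσ]
      have := Finset.card_pos.2 ⟨d, hdX'⟩
      rw [h.card_swapped σ hσ] at this
      omega
    · rw [swapped_append hlt]; exact h.card_swapped σ hσ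
  · intro σ hσ
    have hold := h.spanned_swapped σ hσ
    -- The ends of `r` are connected in the old tree for `σ` as soon as the threshold reaches the
    -- larger one of `σ r` and `σ d`. If `σ d ≤ σ r`, this says that `r` is superfluous.
    have hup : ∀ b, σ r ≤ b → σ d ≤ b →
        conn s t {x | x ∈ swapped σ X₀ prs ∧ σ x ≤ b} (s r) (t r) := by
      intro b hb1 hb2
      refine conn_le (fun x hx => ?_) hbelow
      have hxb := hσle σ hσ b hb1 hb2 x hx.1 hx.2
      exact conn_mono (fun y hy => And.intro hy.1 (hy.2.trans hxb)) (hold x (h.sub x hx.1))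
    by_cases hlt : σ r < σ d
    · have hne : d ≠ r := fun h' => by simp [h'] at hlt
      obtain ⟨hT, hdG, hd0, hdp, hlt'⟩ := hdX hne
      -- Edges of the old tree that lie below `d` for `σ` also lie below `d` for `κ`: existing ones
      -- by compatibility, new ones since they precede `r`. So the cut found for `κ` applies to `σ`
      -- as well.
      have hnot' : ¬ conn s t {x | x ∈ swapped σ X₀ prs ∧ σ x < σ d} (s r) (t r) := by
        intro hcon
        refine hnot hne (conn_mono ?_ hcon)
        rintro x ⟨hx, hxd⟩
        rcases mem_swapped.1 hx with ⟨h', -⟩ | ⟨p, hp, -, rfl⟩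
        · refine ⟨Or.inl (hX₀ h'), ?_⟩
          by_contra hle
          rcases (not_lt.1 hle).lt_or_eq with h1 | h1
          · exact absurd (hσ.inside d hdG x (hX₀ h') h1) hxd.not_gt
          · rw [hκ h1] at hxd; exact lt_irrefl _ hxd
        · exact ⟨Or.inr ⟨p, hp, rfl⟩, (hlast p hp).trans hlt'⟩
      -- The exchange property with the two roles reversed: `r` needs `d` below the threshold `σ d`,
      -- hence `d` is bridged once `r` has taken its place.
      have hdnew : conn s t {x | x ∈ swapped σ X₀ (prs ++ [(r, d)]) ∧ σ x ≤ σ d} (s d) (t d) := by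
        refine conn_mono ?_ (conn_exchange (r := d) (g := r)
          (conn_mono ?_ (hup (σ d) hlt.le le_rfl)) hnot')
        · rintro x (rfl | ⟨hx, hxd⟩)
          · exact ⟨(hXmem σ hlt x).2 (Or.inl rfl), hlt.le⟩
          · exact ⟨(hXmem σ hlt x).2 (Or.inr ⟨hx, fun h' => by simp [h'] at hxd⟩), hxd.le⟩
        · rintro x ⟨hx, hxd⟩
          rcases hxd.lt_or_eq with h' | h'
          · exact Or.inr ⟨hx, h'⟩
          · exact Or.inl (hσ.inj h')
      intro e he
      rcases (hseen e).1 he with he | rfl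
      · refine conn_le (fun x hx => ?_) (hold e he)
        by_cases hxd : x = d
        · subst hxd
          exact conn_mono (fun y hy => And.intro hy.1 (hy.2.trans hx.2)) hdnew
        · exact conn_edge ⟨(hXmem σ hlt x).2 (Or.inr ⟨hx.1, hxd⟩), hx.2⟩
      · exact conn_edge ⟨(hXmem σ hlt e).2 (Or.inl rfl), le_rfl⟩
    · rw [swapped_append hlt]
      intro e he
      rcases (hseen e).1 he with he | rfl
      · exact hold e he
      · exact hup _ le_rfl (not_lt.1 hlt)

end Swaps

end IndMst

namespace IndMst

/-! ### Spanning trees as sets of edges -/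

namespace Instance

variable {n m : ℕ} (I : Instance n m)

/-- The first end vertex of an edge as a number. -/
def srcN (e : Fin m) : ℕ := I.src e

/-- The second end vertex of an edge as a number. -/
def tgtN (e : Fin m) : ℕ := I.tgt e

/-- Connectivity lives on natural numbers, because the machine stores numbers and a pointer may
leave the vertex range. Numbers from `n` on are isolated, so nothing changes between vertices. -/
theorem reachable_iff {X : Set (Fin m)} {G : SimpleGraph (Fin n)}
    (hG : G = SimpleGraph.fromEdgeSet (I.ends '' X)) (u v : Fin n) :
    G.Reachable u v ↔ conn I.srcN I.tgtN X (u : ℕ) (v : ℕ) := by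
  constructor
  · rintro ⟨p⟩
    induction p with
    | nil => exact Setoid.refl' _ _
    | cons h _ ih =>
      refine Setoid.trans' _ ?_ ih
      rw [hG, SimpleGraph.fromEdgeSet_adj] at h
      obtain ⟨⟨e, he, hee⟩, -⟩ := h
      have := conn_edge (s := I.srcN) (t := I.tgtN) he
      rcases Sym2.eq_iff.1 hee with ⟨h1, h2⟩ | ⟨h1, h2⟩
      · simpa [srcN, tgtN, h1, h2] using this
      · have := Setoid.symm' _ this
        simpa [srcN, tgtN, h1, h2] using this
  · intro h
    have key : ∀ {a b : ℕ}, conn I.srcN I.tgtN X a b →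
        a = b ∨ ∃ (ha : a < n) (hb : b < n), G.Reachable ⟨a, ha⟩ ⟨b, hb⟩ := by
      intro a b hab
      induction hab with
      | rel x y h' =>
        obtain ⟨e, he, rfl, rfl⟩ := h'
        refine Or.inr ⟨(I.src e).2, (I.tgt e).2, ?_⟩
        by_cases hl : I.src e = I.tgt e
        · simp [srcN, tgtN, hl]
        · refine SimpleGraph.Adj.reachable ?_
          rw [hG, SimpleGraph.fromEdgeSet_adj]
          exact ⟨⟨e, he, rfl⟩, hl⟩
      | refl x => exact Or.inl rfl
      | symm x y _ ih =>
        rcases ih with rfl | ⟨ha, hb, h⟩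
        · exact Or.inl rfl
        · exact Or.inr ⟨hb, ha, h.symm⟩
      | trans x y z _ _ ih ih' =>
        rcases ih with rfl | ⟨ha, hb, h⟩
        · exact ih'
        · rcases ih' with rfl | ⟨ha', hb', h'⟩
          · exact Or.inr ⟨ha, hb, h⟩
          · exact Or.inr ⟨ha, hb', h.trans h'⟩
    rcases key h with h | ⟨_, _, h⟩
    · rw [Fin.ext h]
    · exact h

variable {I}

theorem connected_of_spans (hI : I.ExistingConnected) {X : Finset (Fin m)}
    (h : Spans I.srcN I.tgtN (X : Set (Fin m))) : (I.subgraph X).Connected := by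
  have := hI.nonempty
  refine ⟨fun u v => ?_⟩
  have h1 := (I.reachable_iff (G := I.subgraph I.existing) rfl u v).1 (hI.preconnected u v)
  refine (I.reachable_iff (G := I.subgraph X) rfl u v).2 ?_
  exact conn_le (fun e _ => h e) h1

theorem spans_of_connected {X : Finset (Fin m)} (h : (I.subgraph X).Connected) :
    Spans I.srcN I.tgtN (X : Set (Fin m)) := by
  intro e
  exact (I.reachable_iff (G := I.subgraph X) rfl _ _).1 (h.preconnected (I.src e) (I.tgt e))

theorem edgeSet_subset (X : Finset (Fin m)) :
    (I.subgraph X).edgeSet ⊆ I.ends '' ((X.filter fun e => I.src e ≠ I.tgt e : Finset _) : Set _) := by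
  classical
  intro z hz
  rw [subgraph, SimpleGraph.edgeSet_fromEdgeSet] at hz
  obtain ⟨⟨e, he, rfl⟩, h2⟩ := hz
  refine ⟨e, ?_, rfl⟩
  simp only [Finset.coe_filter, Set.mem_ofPred_eq]
  exact ⟨he, fun h => h2 (by simp [ends, h])⟩

theorem card_of_connected {X : Finset (Fin m)} (h : (I.subgraph X).Connected) :
    n ≤ (I.ends '' ((X.filter fun e => I.src e ≠ I.tgt e : Finset _) : Set _)).ncard + 1 := by
  have h1 := h.card_vert_le_card_edgeSet_add_one
  rw [Nat.card_eq_fintype_card, Fintype.card_fin, Nat.card_coe_set_eq] at h1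
  exact h1.trans (Nat.add_le_add_right
    (Set.ncard_le_ncard (edgeSet_subset X) ((Finset.finite_toSet _).image _)) 1)

theorem le_card_of_spans (hI : I.ExistingConnected) (X : Finset (Fin m))
    (h : Spans I.srcN I.tgtN (X : Set (Fin m))) : n - 1 ≤ X.card := by
  have h1 := card_of_connected (connected_of_spans hI h)
  have h2 := Set.ncard_image_le (f := I.ends)
    (Finset.finite_toSet (X.filter fun e => I.src e ≠ I.tgt e))
  rw [Set.ncard_coe_finset] at h2
  have h3 := Finset.card_filter_le X (fun e => I.src e ≠ I.tgt e)
  omega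

/-- The underlying simple graph of a connected edge set has at least n - 1 edges. If only n - 1
edges are available, none is lost as a loop or as a parallel edge; so the count enforces the other
conditions. -/
theorem isSpanningTree_iff (hI : I.ExistingConnected) (X : Finset (Fin m)) :
    I.IsSpanningTree X ↔ Spans I.srcN I.tgtN (X : Set (Fin m)) ∧ X.card = n - 1 := by
  have := hI.nonempty
  have hn : 0 < n := Fin.pos_iff_nonempty.2 this
  constructor
  · rintro ⟨h1, h2, h3⟩
    refine ⟨spans_of_connected h3.connected, ?_⟩
    have h4 := (SimpleGraph.isTree_iff_connected_and_card.1 h3).2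
    have h5 : (I.subgraph X).edgeSet = I.ends '' (X : Set (Fin m)) := by
      rw [subgraph, SimpleGraph.edgeSet_fromEdgeSet]
      refine sdiff_eq_left.2 (Set.disjoint_left.2 ?_)
      rintro _ ⟨e, he, rfl⟩ hd
      exact h1 e he (by simpa [ends] using hd)
    rw [Nat.card_eq_fintype_card (α := Fin n), Fintype.card_fin, Nat.card_coe_set_eq, h5,
      Set.InjOn.ncard_image h2, Set.ncard_coe_finset] at h4
    omega
  · rintro ⟨h1, h2⟩
    have hc := connected_of_spans hI h1
    have h3 := card_of_connected hc
    have h4 := Set.ncard_image_le (f := I.ends)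
      (Finset.finite_toSet (X.filter fun e => I.src e ≠ I.tgt e))
    rw [Set.ncard_coe_finset] at h4
    have h5 := Finset.card_filter_le X (fun e => I.src e ≠ I.tgt e)
    have h6 : X.filter (fun e => I.src e ≠ I.tgt e) = X :=
      Finset.eq_of_subset_of_card_le (Finset.filter_subset _ _) (by omega)
    have h7 : ∀ e ∈ X, I.src e ≠ I.tgt e := Finset.filter_eq_self.1 h6
    rw [h6] at h3 h4
    have h8 : Set.InjOn I.ends (X : Set (Fin m)) := by
      refine (Set.ncard_image_iff (Finset.finite_toSet X)).1 ?_
      rw [Set.ncard_coe_finset]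
      omega
    refine ⟨h7, h8, SimpleGraph.isTree_iff_connected_and_card.2 ⟨hc, ?_⟩⟩
    have h9 : (I.subgraph X).edgeSet = I.ends '' (X : Set (Fin m)) := by
      rw [subgraph, SimpleGraph.edgeSet_fromEdgeSet]
      refine sdiff_eq_left.2 (Set.disjoint_left.2 ?_)
      rintro _ ⟨e, he, rfl⟩ hd
      exact h7 e he (by simpa [ends] using hd)
    rw [Nat.card_eq_fintype_card (α := Fin n), Fintype.card_fin, Nat.card_coe_set_eq, h9,
      Set.InjOn.ncard_image h8, Set.ncard_coe_finset]
    omega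

/-- Up to time `i` a feasible solution uses at most `i` new edges. -/
theorem card_new_le {Y : ℕ → Finset (Fin m)} (hY : I.IsFeasible Y) :
    ∀ i ≤ I.horizon, ((Y i).filter (· ∉ I.existing)).card ≤ i := by
  have key : ∀ i ≤ I.horizon,
      (((Finset.Ico 1 (i + 1)).biUnion Y).filter (· ∉ I.existing)).card ≤ i := by
    intro i
    induction i with
    | zero => intro _; simp
    | succ i ih =>
      intro hi
      have h1 := hY.2.2 (i + 1) (by omega) hi
      have hsub : ((Finset.Ico 1 (i + 1 + 1)).biUnion Y).filter (· ∉ I.existing) ⊆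
          ((Finset.Ico 1 (i + 1)).biUnion Y).filter (· ∉ I.existing) ∪
          (Y (i + 1) ∩ (Finset.univ \ (I.existing ∪ (Finset.Ico 1 (i + 1)).biUnion Y))) := by
        intro x
        simp only [Finset.mem_filter, Finset.mem_biUnion, Finset.mem_union, Finset.mem_inter,
          Finset.mem_sdiff, Finset.mem_univ, true_and, Finset.mem_Ico]
        rintro ⟨⟨j, hj, hx⟩, hxn⟩
        by_cases hold : ∃ a, (1 ≤ a ∧ a < i + 1) ∧ x ∈ Y a
        · exact Or.inl ⟨hold, hxn⟩
        · have : j = i + 1 := by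
            by_contra hne
            exact hold ⟨j, ⟨hj.1, by omega⟩, hx⟩
          subst this
          exact Or.inr ⟨hx, fun h => h.elim hxn hold⟩
      have h2 := (Finset.card_le_card hsub).trans (Finset.card_union_le _ _)
      have h3 := ih (by omega)
      omega
  intro i hi
  rcases Nat.eq_zero_or_pos i with rfl | hpos
  · have : (Y 0).filter (· ∉ I.existing) = ∅ := by
      refine Finset.filter_eq_empty_iff.2 fun x hx => ?_
      simpa using hY.2.1 hx
    simp [this]
  · refine (Finset.card_le_card ?_).trans (key i hi)
    refine Finset.filter_subset_filter _ ?_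
    exact Finset.subset_biUnion_of_mem Y (Finset.mem_Ico.2 ⟨hpos, by omega⟩)

end Instance

/-- No inserted edge is ever removed, so the order of the exchanges performed so far is irrelevant.
Pairs are (inserted, removed) inside the proof but (removed, inserted) in the output, hence
`Prod.swap`. -/
theorem exchangeSeq_eq {m : ℕ} (X₀ : Finset (Fin m)) (L : List (Fin m × Fin m))
    (h : ∀ p ∈ L, ∀ q ∈ L, p.1 ≠ q.2) (i : ℕ) :
    exchangeSeq X₀ (L.map Prod.swap) i =
      (X₀ \ ((L.take i).map Prod.snd).toFinset) ∪ ((L.take i).map Prod.fst).toFinset := by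
  rw [exchangeSeq, ← List.map_take]
  have h' : ∀ p ∈ L.take i, ∀ q ∈ L.take i, p.1 ≠ q.2 :=
    fun p hp q hq => h p (List.mem_of_mem_take hp) q (List.mem_of_mem_take hq)
  generalize L.take i = l at h'
  clear h
  induction l using List.reverseRecOn with
  | nil => simp
  | append_singleton l p ih =>
    rw [List.map_append, List.foldl_append, ih (fun p hp q hq => h' p (by simp [hp]) q (by simp [hq]))]
    ext x
    have hp : ∀ q ∈ l, q.1 ≠ p.2 := fun q hq => h' q (by simp [hq]) p (by simp)
    simp only [List.map_cons, List.map_nil, List.foldl_cons, List.foldl_nil, Prod.fst_swap,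
      Prod.snd_swap, Finset.mem_insert, Finset.mem_erase, Finset.mem_union, Finset.mem_sdiff,
      List.mem_toFinset, List.mem_map, List.map_append, List.mem_append, List.mem_singleton]
    constructor
    · rintro (rfl | ⟨hx, ⟨h1, h2⟩ | ⟨q, hq, rfl⟩⟩)
      · exact Or.inr (Or.inr rfl)
      · refine Or.inl ⟨h1, ?_⟩
        rintro (h | h)
        · exact h2 h
        · exact hx h
      · exact Or.inr (Or.inl ⟨q, hq, rfl⟩)
    · rintro (⟨h1, h2⟩ | ⟨q, hq, rfl⟩ | rfl)
      · exact Or.inr ⟨fun h => h2 (Or.inr h), Or.inl ⟨h1, fun h => h2 (Or.inl h)⟩⟩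
      · exact Or.inr ⟨hp q hq, Or.inr ⟨q, hq, rfl⟩⟩
      · exact Or.inl rfl

/-! ### Optimality -/

section Optimality

variable {n m : ℕ} {I : Instance n m} {β : Type*} [LinearOrder β] {κ : Fin m → β}
  {X₀ T : Finset (Fin m)} {prs : List (Fin m × Fin m)}

/-- The decrease of the weight by an exchange `(r, d)`. -/
noncomputable def gain (I : Instance n m) (p : Fin m × Fin m) : ℝ :=
  I.weight p.2 - I.weight p.1

open Classical in
/-- The order by weight when new edges cost `lam` more than in the input; new edges of this modified
weight come before existing ones if and only if they belong to `θ`. -/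
noncomputable def penaltyOrder (I : Instance n m) (κ : Fin m → β) (lam : ℝ) (θ : Fin m → Prop)
    (e : Fin m) : ℝ ×ₗ ℕ ×ₗ β :=
  toLex (I.weight e + (if e ∈ I.existing then 0 else lam),
    toLex ((if e ∈ I.existing then 1 else if θ e then 0 else 2), κ e))

/-- A penalty shifts all new edges equally and so respects each class. The tie-breaking set `θ` must
be closed downwards, since otherwise it could reverse two new edges of equal weight. -/
theorem compatible_penaltyOrder (hκ : Function.Injective κ)
    (hw : ∀ a b, (a ∈ I.existing ↔ b ∈ I.existing) → κ a < κ b → I.weight a ≤ I.weight b)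
    (lam : ℝ) {θ : Fin m → Prop} (hθ : ∀ a b, κ a < κ b → θ b → θ a) :
    Compatible I.existing κ (penaltyOrder I κ lam θ) where
  inj := by
    intro a b hab
    have h1 := congrArg (fun z => (ofLex (ofLex z).2).2) hab
    exact hκ h1
  inside := by
    intro a ha b hb hab
    rw [penaltyOrder, penaltyOrder, Prod.Lex.toLex_lt_toLex]
    simp only [ha, hb, if_true, add_zero]
    rcases (hw a b (by simp [ha, hb]) hab).lt_or_eq with h | h
    · exact Or.inl h
    · exact Or.inr ⟨h, Prod.Lex.toLex_lt_toLex.2 (Or.inr ⟨rfl, hab⟩)⟩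
  outside := by
    intro a ha b hb hab
    rw [penaltyOrder, penaltyOrder, Prod.Lex.toLex_lt_toLex]
    simp only [ha, hb, if_false]
    rcases (hw a b (by simp [ha, hb]) hab).lt_or_eq with h | h
    · exact Or.inl (by linarith)
    · refine Or.inr ⟨by rw [h], Prod.Lex.toLex_lt_toLex.2 ?_⟩
      by_cases h2 : θ b
      · simp [h2, hθ a b hab h2, hab]
      · by_cases h3 : θ a <;> simp [h2, h3, hab]

/-- For a genuine exchange this is a rearrangement of w(r) + lam < w(d), with `θ` deciding ties. A
trivial pair has gain 0 and must never count as performed; the condition on `lam` and `θ` guarantees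
this. -/
theorem penaltyOrder_lt_iff {lam : ℝ} {θ : Fin m → Prop}
    (h : 0 < lam ∨ lam = 0 ∧ ∀ e, ¬ θ e) (hX₀ : X₀ ⊆ I.existing) {p : Fin m × Fin m}
    (hp : p.1 ∉ I.existing) (hp' : p.2 = p.1 ∨ p.2 ∈ X₀) :
    penaltyOrder I κ lam θ p.1 < penaltyOrder I κ lam θ p.2 ↔
      lam < gain I p ∨ lam = gain I p ∧ θ p.1 := by
  rcases hp' with hp' | hp'
  · rw [hp', gain, hp', sub_self]
    constructor
    · intro h; exact (lt_irrefl _ h).elim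
    · rintro (h1 | ⟨h1, h2⟩)
      · rcases h with h | h
        · linarith
        · linarith [h.1]
      · rcases h with h | h
        · linarith
        · exact (h.2 _ h2).elim
  · have hp2 := hX₀ hp'
    rw [penaltyOrder, penaltyOrder, Prod.Lex.toLex_lt_toLex, gain]
    simp only [hp, hp2, if_true, if_false, add_zero]
    refine or_congr ?_ (and_congr ?_ ?_)
    · constructor <;> intro h <;> linarith
    · constructor <;> intro h <;> linarith
    · rw [Prod.Lex.toLex_lt_toLex]
      by_cases h1 : θ p.1 <;> simp [h1]

theorem sum_penalty (I : Instance n m) (lam : ℝ) (Y : Finset (Fin m)) :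
    ∑ e ∈ Y, (I.weight e + (if e ∈ I.existing then 0 else lam)) =
      I.setWeight Y + (Y.filter (· ∉ I.existing)).card * lam := by
  rw [Finset.sum_add_distrib, Instance.setWeight, Finset.card_filter, Nat.cast_sum,
    Finset.sum_mul]
  congr 1
  refine Finset.sum_congr rfl fun e _ => ?_
  by_cases h : e ∈ I.existing <;> simp [h]

/-- All existing edges and all inserted new edges are bridged by the chain, and `hcov` bridges the
remaining new edges by smaller inserted ones. Thus the cycle condition holds for every edge in the
penalty order, hence for the penalized weights. -/
theorem setWeight_swapped_le (hI : I.ExistingConnected) (hκ : Function.Injective κ)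
    (hw : ∀ a b, (a ∈ I.existing ↔ b ∈ I.existing) → κ a < κ b → I.weight a ≤ I.weight b)
    (h : SwapChain I.srcN I.tgtN (n - 1) I.existing κ X₀ prs T)
    (hcov : ∀ e ∉ I.existing, conn I.srcN I.tgtN {x | (∃ p ∈ prs, p.1 = x) ∧ κ x ≤ κ e}
      (I.srcN e) (I.tgtN e))
    (lam : ℝ) {θ : Fin m → Prop} (hθ : ∀ a b, κ a < κ b → θ b → θ a) :
    I.IsSpanningTree (swapped (penaltyOrder I κ lam θ) X₀ prs) ∧
    ∀ Y, I.IsSpanningTree Y →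
      I.setWeight (swapped (penaltyOrder I κ lam θ) X₀ prs) +
        ((swapped (penaltyOrder I κ lam θ) X₀ prs).filter (· ∉ I.existing)).card * lam ≤
      I.setWeight Y + (Y.filter (· ∉ I.existing)).card * lam := by
  set σ := penaltyOrder I κ lam θ with hσdef
  have hσ : Compatible I.existing κ σ := compatible_penaltyOrder hκ hw lam hθ
  have hsp := h.spanned_swapped σ hσ
  have hc := h.card_swapped σ hσ
  have hall : Spanned I.srcN I.tgtN σ Set.univ (swapped σ X₀ prs : Set (Fin m)) := by
    intro e _
    by_cases he : e ∈ I.existing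
    · exact hsp e (Or.inl he)
    · refine conn_le (fun x hx => ?_) (hcov e he)
      obtain ⟨⟨p, hp, rfl⟩, hle⟩ := hx
      refine conn_mono ?_ (hsp p.1 (Or.inr ⟨p, hp, rfl⟩))
      rintro y ⟨hy, hyx⟩
      refine ⟨hy, hyx.trans ?_⟩
      rcases hle.lt_or_eq with h1 | h1
      · exact (hσ.outside _ (h.fst_notMem p hp) e he h1).le
      · rw [hκ h1]
  have htree : I.IsSpanningTree (swapped σ X₀ prs) := by
    rw [Instance.isSpanningTree_iff hI]
    exact ⟨fun e => conn_mono (fun x hx => hx.1) (hall e trivial), hc⟩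
  refine ⟨htree, fun Y hY => ?_⟩
  rw [Instance.isSpanningTree_iff hI] at hY
  rw [← sum_penalty, ← sum_penalty]
  refine sum_le_of_spanned (fun S hS => Instance.le_card_of_spans hI S hS) hc ?_ _ Y rfl hY.1 hY.2
  intro e he
  refine conn_mono ?_ (hall e he)
  rintro x ⟨hx, hxe⟩
  exact ⟨hx, Prod.Lex.monotone_fst _ _ hxe⟩

/-- Performing the profitable exchanges in the order of decreasing gain is optimal. -/
theorem isOptimal_exchangeSeq (hI : I.ExistingConnected) (hκ : Function.Injective κ)
    (hw : ∀ a b, (a ∈ I.existing ↔ b ∈ I.existing) → κ a < κ b → I.weight a ≤ I.weight b)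
    (hX₀ : X₀ ⊆ I.existing)
    (h : SwapChain I.srcN I.tgtN (n - 1) I.existing κ X₀ prs T)
    (hcov : ∀ e ∉ I.existing, conn I.srcN I.tgtN {x | (∃ p ∈ prs, p.1 = x) ∧ κ x ≤ κ e}
      (I.srcN e) (I.tgtN e))
    (L : List (Fin m × Fin m)) (hL : ∀ p, p ∈ L ↔ p ∈ prs ∧ 0 < gain I p)
    (hLs : L.Pairwise fun p q => gain I q < gain I p ∨ gain I p = gain I q ∧ κ p.1 < κ q.1) :
    L.length ≤ I.horizon ∧ I.IsOptimal (exchangeSeq X₀ (L.map Prod.swap)) := by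
  have hLp : ∀ p ∈ L, p ∈ prs := fun p hp => ((hL p).1 hp).1
  have hLg : ∀ p ∈ L, p.2 ∈ X₀ := by
    intro p hp
    refine (h.snd_mem p (hLp p hp)).resolve_left fun h1 => ?_
    have := ((hL p).1 hp).2
    rw [gain, h1, sub_self] at this
    exact lt_irrefl _ this
  have hLr : ∀ p ∈ L, p.1 ∉ I.existing := fun p hp => h.fst_notMem p (hLp p hp)
  have hinj : ∀ p ∈ prs, ∀ q ∈ prs, p.1 = q.1 → p = q := by
    have hnd : (prs.map Prod.fst).Nodup := h.sorted.imp fun hab hne => by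
      rw [hne] at hab; exact lt_irrefl _ hab
    intro p hp q hq hpq
    exact List.inj_on_of_nodup_map hnd hp hq hpq
  have hnodup : (L.map Prod.fst).Nodup := by
    rw [List.Nodup, List.pairwise_map]
    refine hLs.imp_of_mem ?_
    intro p q hp hq hpq heq
    rw [hinj p (hLp p hp) q (hLp q hq) heq] at hpq
    rcases hpq with h1 | h1
    · exact lt_irrefl _ h1
    · exact lt_irrefl _ h1.2
  have hseq : ∀ i, exchangeSeq X₀ (L.map Prod.swap) i =
      (X₀ \ ((L.take i).map Prod.snd).toFinset) ∪ ((L.take i).map Prod.fst).toFinset :=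
    exchangeSeq_eq X₀ L fun p hp q hq hpq => hLr p hp (hpq ▸ hX₀ (hLg q hq))
  have hred : ∀ i, ((exchangeSeq X₀ (L.map Prod.swap) i).filter (· ∉ I.existing)).card =
      min i L.length := by
    intro i
    have h1 : (exchangeSeq X₀ (L.map Prod.swap) i).filter (· ∉ I.existing) =
        ((L.take i).map Prod.fst).toFinset := by
      ext x
      rw [hseq]
      simp only [Finset.mem_filter, Finset.mem_union, Finset.mem_sdiff, List.mem_toFinset,
        List.mem_map]
      constructor
      · rintro ⟨⟨hx, -⟩ | hx, hxe⟩
        · exact (hxe (hX₀ hx)).elim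
        · exact hx
      · rintro ⟨p, hp, rfl⟩
        exact ⟨Or.inr ⟨p, hp, rfl⟩, hLr p (List.mem_of_mem_take hp)⟩
    rw [h1, List.toFinset_card_of_nodup, List.length_map, List.length_take]
    rw [List.map_take]
    exact hnodup.sublist (List.take_sublist _ _)
  have hlen : L.length ≤ I.horizon := by
    have h1 : (L.map Prod.fst).toFinset ⊆ Finset.univ \ I.existing := by
      intro x hx
      obtain ⟨p, hp, rfl⟩ := List.mem_map.1 (List.mem_toFinset.1 hx)
      simpa using hLr p hp
    have h2 := Finset.card_le_card h1
    rwa [List.toFinset_card_of_nodup hnodup, List.length_map] at h2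
  -- every member of the sequence is optimal for a suitable penalty
  have hpen : ∀ i, ∃ (lam : ℝ) (θ : Fin m → Prop), (∀ a b, κ a < κ b → θ b → θ a) ∧ 0 ≤ lam ∧
      (L.length ≤ i → lam = 0) ∧
      exchangeSeq X₀ (L.map Prod.swap) i = swapped (penaltyOrder I κ lam θ) X₀ prs := by
    intro i
    suffices hs : ∃ (lam : ℝ) (θ : Fin m → Prop), (∀ a b, κ a < κ b → θ b → θ a) ∧
        (0 < lam ∨ lam = 0 ∧ ∀ e, ¬ θ e) ∧ (L.length ≤ i → lam = 0) ∧
        ∀ p ∈ prs, p ∈ L.take i ↔ (lam < gain I p ∨ lam = gain I p ∧ θ p.1) by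
      obtain ⟨lam, θ, h1, h2, h3, h4⟩ := hs
      refine ⟨lam, θ, h1, ?_, h3, ?_⟩
      · rcases h2 with h2 | h2
        · exact h2.le
        · exact h2.1.ge
      · have h5 : ∀ p, p ∈ L.take i ↔
            p ∈ prs ∧ penaltyOrder I κ lam θ p.1 < penaltyOrder I κ lam θ p.2 := by
          intro p
          constructor
          · intro hp
            have hp' := hLp p (List.mem_of_mem_take hp)
            exact ⟨hp', (penaltyOrder_lt_iff h2 hX₀ (h.fst_notMem p hp') (h.snd_mem p hp')).2
              ((h4 p hp').1 hp)⟩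
          · rintro ⟨hp', hlt⟩
            exact (h4 p hp').2
              ((penaltyOrder_lt_iff h2 hX₀ (h.fst_notMem p hp') (h.snd_mem p hp')).1 hlt)
        ext x
        rw [hseq, mem_swapped]
        simp only [Finset.mem_union, Finset.mem_sdiff, List.mem_toFinset, List.mem_map, not_exists,
          not_and, h5]
        constructor
        · rintro (⟨h6, h7⟩ | ⟨p, ⟨h6, h7⟩, h8⟩)
          · exact Or.inl ⟨h6, fun p hp hlt => h7 p ⟨hp, hlt⟩⟩
          · exact Or.inr ⟨p, h6, h7, h8⟩
        · rintro (⟨h6, h7⟩ | ⟨p, h6, h7, h8⟩)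
          · exact Or.inl ⟨h6, fun p hp => h7 p hp.1 hp.2⟩
          · exact Or.inr ⟨p, ⟨h6, h7⟩, h8⟩
    by_cases hi : L.length ≤ i
    -- After all profitable exchanges the tree is a minimum spanning tree for the original weights,
    -- with penalty 0.
    · refine ⟨0, fun _ => False, by simp, Or.inr ⟨rfl, by simp⟩, fun _ => rfl, fun p hp => ?_⟩
      rw [List.take_of_length_le hi, hL]
      simp [hp]
    rw [not_le] at hi
    rcases Nat.eq_zero_or_pos i with rfl | hpos
    -- At time 0 the penalty exceeds every gain, so no exchange is performed.
    · obtain ⟨lam, hlam0, hlam⟩ : ∃ lam : ℝ, 0 < lam ∧ ∀ p ∈ prs, gain I p < lam := by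
        clear * -
        induction prs with
        | nil => exact ⟨1, one_pos, by simp⟩
        | cons p l ih =>
          obtain ⟨lam, h0, h1⟩ := ih
          refine ⟨max lam (gain I p + 1), lt_max_of_lt_left h0, ?_⟩
          intro q hq
          rcases List.mem_cons.1 hq with rfl | hq
          · exact lt_max_of_lt_right (by linarith)
          · exact lt_max_of_lt_left (h1 q hq)
      refine ⟨lam, fun _ => False, by simp, Or.inl hlam0, fun hle => by omega, fun p hp => ?_⟩
      have := hlam p hp
      simp [this.le]
    · have hi1 : i - 1 < L.length := by omega
      set q := L[i - 1] with hq
      have hqL : q ∈ L := List.getElem_mem hi1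
      have hrel := List.pairwise_iff_getElem.1 hLs
      -- The penalty is the gain of the last exchange performed. Several exchanges may have this
      -- gain; `θ` admits exactly those up to `q`.
      refine ⟨gain I q, fun e => κ e ≤ κ q.1, fun a b hab hb => hab.le.trans hb,
        Or.inl ((hL q).1 hqL).2, fun hle => by omega, fun p hp => ?_⟩
      constructor
      · intro hpt
        obtain ⟨j, hj, rfl⟩ := List.mem_take_iff_getElem.1 hpt
        have hj' : j < i ∧ j < L.length := by omega
        rcases (show j < i - 1 ∨ j = i - 1 by omega) with hlt | heq
        · rcases hrel j (i - 1) hj'.2 hi1 hlt with h1 | h1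
          · exact Or.inl h1
          · exact Or.inr ⟨h1.1.symm, h1.2.le⟩
        · subst heq
          exact Or.inr ⟨rfl, le_rfl⟩
      · intro hpg
        have hq0 := ((hL q).1 hqL).2
        have hpL : p ∈ L := by
          rw [hL]
          refine ⟨hp, ?_⟩
          rcases hpg with h1 | h1
          · linarith
          · linarith [h1.1]
        obtain ⟨j, hj, rfl⟩ := List.mem_iff_getElem.1 hpL
        rw [List.mem_take_iff_getElem]
        by_cases hji : j < i
        · exact ⟨j, by omega, rfl⟩
        · exfalso
          rcases hrel (i - 1) j hi1 hj (by omega) with h1 | h1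
          · rcases hpg with h2 | h2
            · exact lt_asymm h1 h2
            · exact h1.ne' h2.1
          · rcases hpg with h2 | h2
            · exact h2.ne h1.1
            · exact h1.2.not_ge h2.2
  have htree : ∀ i, I.IsSpanningTree (exchangeSeq X₀ (L.map Prod.swap) i) := by
    intro i
    obtain ⟨lam, θ, h1, -, -, h4⟩ := hpen i
    rw [h4]
    exact (setWeight_swapped_le hI hκ hw h hcov lam h1).1
  refine ⟨hlen, ⟨fun i _ => htree i, ?_, ?_⟩, ?_⟩
  · simpa [exchangeSeq] using hX₀
  · intro i h1 hi
    have hsub : exchangeSeq X₀ (L.map Prod.swap) i ∩ (Finset.univ \ (I.existing ∪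
        (Finset.Ico 1 i).biUnion (exchangeSeq X₀ (L.map Prod.swap)))) ⊆
        ((L[i - 1]?).map Prod.fst).toFinset := by
      intro x
      simp only [Finset.mem_inter, Finset.mem_sdiff, Finset.mem_univ, true_and, Finset.mem_union,
        Finset.mem_biUnion, Finset.mem_Ico, not_or, not_exists, not_and]
      rintro ⟨hx, hxe, hold⟩
      rw [hseq, Finset.mem_union] at hx
      have hx' := hx.resolve_left fun h2 => hxe (hX₀ (Finset.mem_sdiff.1 h2).1)
      rw [List.mem_toFinset, List.mem_map] at hx'
      obtain ⟨p, hp, rfl⟩ := hx'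
      obtain ⟨j, hj, rfl⟩ := List.mem_take_iff_getElem.1 hp
      have hj' : j < i ∧ j < L.length := by omega
      rcases (show j < i - 1 ∨ j = i - 1 by omega) with hlt | heq
      · exfalso
        refine hold (i - 1) ⟨by omega, by omega⟩ ?_
        rw [hseq, Finset.mem_union, List.mem_toFinset, List.mem_map]
        exact Or.inr ⟨_, List.mem_take_iff_getElem.2 ⟨j, by omega, rfl⟩, rfl⟩
      · subst heq
        simp [hj'.2]
    refine (Finset.card_le_card hsub).trans ?_
    rw [Option.card_toFinset]
    cases L[i - 1]? <;> simp
  · intro Y hY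
    refine Finset.sum_le_sum fun i hi => ?_
    have hi' : i ≤ I.horizon := by simpa [Nat.lt_succ_iff] using hi
    obtain ⟨lam, θ, h1, h2, h3, h4⟩ := hpen i
    -- Both sides carry penalties. If i exceeds the number of exchanges, the penalty is zero;
    -- otherwise the left side has i new edges and the right side at most i, so the penalties drop
    -- out.
    have h5 := (setWeight_swapped_le hI hκ hw h hcov lam h1).2 (Y i) (hY.1 i hi')
    rw [← h4, hred] at h5
    have h6 := Instance.card_new_le hY i hi'
    rcases le_total L.length i with h7 | h7
    · rw [h3 h7] at h5
      linarith
    · rw [min_eq_left h7] at h5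
      have h8 : (((Y i).filter (· ∉ I.existing)).card : ℝ) ≤ i := by exact_mod_cast h6
      have h9 := mul_le_mul_of_nonneg_right h8 h2
      linarith

end Optimality

end IndMst

namespace IndMst

open RAM

namespace Instance

variable {n m : ℕ} (I : Instance n m)

/-! ### The order of the edges -/

/-- The first end vertex of the edge number `e`. -/
def srcV (e : ℕ) : ℕ := if h : e < m then I.src ⟨e, h⟩ else 0

/-- The second end vertex of the edge number `e`. -/
def tgtV (e : ℕ) : ℕ := if h : e < m then I.tgt ⟨e, h⟩ else 0

/-- The class of the edge number `e`: new edges, existing edges and numbers that do not belong to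
an edge. -/
def col (e : ℕ) : ℕ := if h : e < m then (if (⟨e, h⟩ : Fin m) ∈ I.existing then 1 else 0) else 2

/-- The weight of the edge number `e`. -/
noncomputable def wt (e : ℕ) : ℝ := if h : e < m then I.weight ⟨e, h⟩ else 0

/-- Edges are ordered by class, weight and number. -/
noncomputable def key (e : ℕ) : ℕ ×ₗ ℝ ×ₗ ℕ := toLex (I.col e, toLex (I.wt e, e))

theorem key_injective : Function.Injective I.key := fun _ _ h =>
  congrArg (fun z => (ofLex (ofLex z).2).2) h

theorem key_lt_iff {a b : ℕ} : I.key a < I.key b ↔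
    I.col a < I.col b ∨ (I.col a = I.col b ∧ (I.wt a < I.wt b ∨ (I.wt a = I.wt b ∧ a < b))) := by
  rw [key, key, Prod.Lex.toLex_lt_toLex]
  simp only [Prod.Lex.toLex_lt_toLex]

theorem col_of_lt {e : ℕ} (h : e < m) : I.col e < 2 := by
  simp only [col, h, dif_pos]; split_ifs <;> norm_num

/-- Class 2 makes the number `m` a sentinel above all edges. Missing edges then need no separate
treatment in comparisons. -/
theorem key_lt_dummy {e : ℕ} (h : e < m) : I.key e < I.key m := by
  rw [key_lt_iff]
  refine Or.inl ?_
  have : I.col m = 2 := by simp [col]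
  rw [this]; exact I.col_of_lt h

theorem not_dummy_le {c : ℕ} (h : c < m) : ¬ I.key m ≤ I.key c := (I.key_lt_dummy h).not_ge

theorem srcV_lt {e : ℕ} (h : e < m) : I.srcV e < n := by
  simp only [srcV, h, dif_pos]; exact Fin.is_lt _

theorem tgtV_lt {e : ℕ} (h : e < m) : I.tgtV e < n := by
  simp only [tgtV, h, dif_pos]; exact Fin.is_lt _

theorem srcV_coe (e : Fin m) : I.srcV e = I.srcN e := by simp [srcV, srcN]

theorem tgtV_coe (e : Fin m) : I.tgtV e = I.tgtN e := by simp [tgtV, tgtN]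

/-- The part of the memory that the program does not change. -/
structure Input (s : State) : Prop where
  numV : s.word 0 0 = n
  numE : s.word 0 1 = m
  src : ∀ e < m, s.word 1 e = I.srcV e
  tgt : ∀ e < m, s.word 2 e = I.tgtV e
  col : ∀ e ≤ m, s.word 3 e = I.col e
  wt : ∀ e, s.real 0 e = I.wt e

end Instance

end IndMst

namespace RAM

/-! ### Frames and comparisons -/

theorem SameExcept.refl (l : List ℕ) (s : State) : SameExcept l s s := ⟨fun _ _ => rfl, rfl⟩

theorem SameExcept.trans {l : List ℕ} {s s' s'' : State} (h : SameExcept l s s')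
    (h' : SameExcept l s' s'') : SameExcept l s s'' :=
  ⟨fun a ha => (h'.1 a ha).trans (h.1 a ha), h'.2.trans h.2⟩

theorem SameExcept.mono {l l' : List ℕ} {s s' : State} (h : SameExcept l s s') (hl : l ⊆ l') :
    SameExcept l' s s' :=
  ⟨fun a ha => h.1 a fun h' => ha (hl h'), h.2⟩

theorem SameExcept.putWord {l : List ℕ} {s s' : State} (h : SameExcept l s s') {a i v : ℕ}
    (ha : a ∈ l) : SameExcept l s (s'.putWord a i v) :=
  ⟨fun b hb => (s'.putWord_word_of_ne fun h' => hb (by rw [h']; exact ha)).trans (h.1 b hb), h.2⟩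

/-- A scalar variable. -/
def sc (a : ℕ) : WExp := .get a (.const 0)

@[simp] theorem sc_val (s : State) (a : ℕ) : (sc a).val s = s.word a 0 := rfl

/-- The number of vertices. -/
def nE : WExp := .get 0 (.const 0)

/-- The number of edges. -/
def mE : WExp := .get 0 (.const 1)

/-- The disjunction of two tests. -/
def orT (b c : Test) : Test := .not (.and (.not b) (.not c))

theorem orT_holds (s : State) (b c : Test) : (orT b c).holds s ↔ b.holds s ∨ c.holds s := by
  simp only [orT, Test.holds]; tauto

/-- Comparison of two edges. -/
def lessT (a b : WExp) : Test :=
  orT (.lt (.get 3 a) (.get 3 b)) (.and (.eq (.get 3 a) (.get 3 b))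
    (orT (.not (.le (.get 0 b) (.get 0 a))) (.and (.le (.get 0 a) (.get 0 b)) (.lt a b))))

/-- Indices up to `m` inclusive are allowed, because entry `m` of array 3 holds the class of the
sentinel. -/
theorem lessT_holds {n m : ℕ} {I : IndMst.Instance n m} {s : State} (h : I.Input s) {a b : WExp}
    (ha : a.val s ≤ m) (hb : b.val s ≤ m) :
    (lessT a b).holds s ↔ I.key (a.val s) < I.key (b.val s) := by
  simp only [lessT, orT_holds, Test.holds, WExp.val, RExp.val, h.col _ ha, h.col _ hb, h.wt,
    IndMst.Instance.key_lt_iff, not_le]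
  refine or_congr Iff.rfl (and_congr Iff.rfl ?_)
  constructor
  · rintro (h1 | ⟨h1, h2⟩)
    · exact Or.inl h1
    · exact h1.lt_or_eq.imp id fun h3 => ⟨h3, h2⟩
  · rintro (h1 | ⟨h1, h2⟩)
    · exact Or.inl h1
    · exact Or.inr ⟨h1.le, h2⟩

end RAM

namespace IndMst

open RAM

namespace Instance

variable {n m : ℕ} {I : Instance n m}

theorem Input.of_same {s s' : State} (h : I.Input s) {l : List ℕ} (hs : SameExcept l s s')
    (h0 : 0 ∉ l := by decide) (h1 : 1 ∉ l := by decide) (h2 : 2 ∉ l := by decide)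
    (h3 : 3 ∉ l := by decide) : I.Input s' where
  numV := by rw [hs.1 0 h0]; exact h.numV
  numE := by rw [hs.1 0 h0]; exact h.numE
  src := by rw [hs.1 1 h1]; exact h.src
  tgt := by rw [hs.1 2 h2]; exact h.tgt
  col := by rw [hs.1 3 h3]; exact h.col
  wt := by rw [hs.2]; exact h.wt

/-! ### Pointer representations of minimum spanning forests -/

/-- `K` holds the number of an edge of class `cc`, or the number `m` that stands for no edge. -/
def Valid (I : Instance n m) (cc e : ℕ) : Prop := e = m ∨ (e < m ∧ I.col e = cc)

theorem Valid.le {cc e : ℕ} (h : I.Valid cc e) : e ≤ m := by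
  rcases h with h | h
  · exact h.le
  · exact h.1.le

/-- The pointers `x → P x` for `x < N`, labelled by the edges `K x`, define at every threshold the
same components as the edges in `A`. -/
def Represents (I : Instance n m) (N : ℕ) (A : ℕ → Prop) (P K : ℕ → ℕ) : Prop :=
  ∀ c < m, ∀ R : Setoid ℕ, (∀ x < N, I.key (K x) ≤ I.key c → R x (P x)) ↔
    (∀ e < m, A e → I.key e ≤ I.key c → R (I.srcV e) (I.tgtV e))

/-- Induction on the number of smaller edges. If an edge `e` is not itself a label, every pointer
active at its threshold has a label strictly below `e`. The representation at that smaller threshold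
and the induction hypothesis connect the two ends of this pointer by labels; the representation at
`e` then connects the ends of `e`. Nothing is assumed about the ends of the label edges, which in
general are not `x` and `P x`. -/
theorem Represents.spanned {N : ℕ} {A : ℕ → Prop} {P K : ℕ → ℕ} (h : I.Represents N A P K)
    {B : Set (Fin m)} (hB : ∀ e ∈ B, A e) :
    Spanned I.srcN I.tgtN (fun e : Fin m => I.key e) B {e : Fin m | ∃ x < N, K x = e} := by
  suffices hs : ∀ e : Fin m, A e →
      conn I.srcN I.tgtN {x : Fin m | (∃ y < N, K y = x) ∧ I.key x ≤ I.key e}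
        (I.srcN e) (I.tgtN e) from fun e he => hs e (hB e he)
  intro e
  induction hN : (Finset.univ.filter fun f : Fin m => I.key f < I.key e).card using
    Nat.strong_induction_on generalizing e with
  | _ N' ih =>
  intro he
  set R := conn I.srcN I.tgtN {x : Fin m | (∃ y < N, K y = x) ∧ I.key x ≤ I.key e} with hR
  by_cases heK : ∃ y < N, K y = e
  · exact conn_edge ⟨heK, le_rfl⟩
  have hlow : ∀ f : Fin m, A f → I.key f < I.key e → R (I.srcN f) (I.tgtN f) := by
    intro f hf hfe
    have hcard : (Finset.univ.filter fun g : Fin m => I.key g < I.key f).card < N' := by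
      rw [← hN]
      refine Finset.card_lt_card ⟨fun g hg => ?_, fun hsub => ?_⟩
      · simp only [Finset.mem_filter, Finset.mem_univ, true_and] at hg ⊢
        exact hg.trans hfe
      · have := hsub (Finset.mem_filter.2 ⟨Finset.mem_univ f, hfe⟩)
        simp at this
    exact conn_mono (fun x hx => And.intro hx.1 (hx.2.trans hfe.le)) (ih _ hcard f rfl hf)
  have h1 : ∀ x < N, I.key (K x) ≤ I.key e → R x (P x) := by
    intro x hx hxe
    have hKm : K x < m := by
      by_contra hge
      have hc2 : I.col (K x) = 2 := by simp [Instance.col, hge]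
      refine hxe.not_gt (I.key_lt_iff.2 (Or.inl ?_))
      rw [hc2]; exact I.col_of_lt e.2
    have hlt : I.key (K x) < I.key e := lt_of_le_of_ne hxe fun h' => heK ⟨x, hx, I.key_injective h'⟩
    refine (h (K x) hKm R).2 ?_ x hx le_rfl
    intro f hf hAf hfK
    have := hlow ⟨f, hf⟩ hAf (hfK.trans_lt hlt)
    rwa [← I.srcV_coe, ← I.tgtV_coe] at this
  have := (h e e.2 R).1 h1 e e.2 he le_rfl
  rwa [I.srcV_coe, I.tgtV_coe] at this

/-- The situation while vertex `z` is added to a pointer representation of the edges of class `cc`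
between smaller vertices, where the vertices less than `k` have been processed. -/
structure PassInv (I : Instance n m) (cc z k : ℕ) (P K C : ℕ → ℕ) : Prop where
  validK : ∀ x < n, I.Valid cc (K x)
  validC : ∀ x < z, I.Valid cc (C x)
  lt : ∀ x < n, x < P x
  le : ∀ x < z, P x ≤ z
  rest : ∀ x < n, z ≤ x → P x = x + 1 ∧ K x = m
  thr : ∀ c < m, ∀ R : Setoid ℕ, ((∀ x < z, I.key (K x) ≤ I.key c → R x (P x)) ∧
      (∀ x, k ≤ x → x < z → I.key (C x) ≤ I.key c → R x z)) ↔
    (∀ e < m, (I.col e = cc ∧ I.srcV e < z + 1 ∧ I.tgtV e < z + 1) → I.key e ≤ I.key c →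
      R (I.srcV e) (I.tgtV e))

/-- Vertex `k` has two links, to `P k` with label `K k` and to `z` with label `C k`. Keep the
smaller one as its pointer. Once the larger label is below the threshold, so is the smaller one, and
then the larger link may equally well join `P k` and `z`; it becomes a candidate for `P k`. Since `k
< P k`, that candidate is still to be processed, unless `P k = z` and it is a superfluous loop. -/
theorem PassInv.step {cc z k : ℕ} {P K C P' K' C' : ℕ → ℕ} (h : I.PassInv cc z k P K C)
    (hk : k < z) (hz : z < n) (c₁ : ℕ)
    (hPK : (I.key (C k) < I.key (K k) ∧ (∀ x, P' x = if x = k then z else P x) ∧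
        (∀ x, K' x = if x = k then C k else K x) ∧ c₁ = K k) ∨
      (¬ I.key (C k) < I.key (K k) ∧ (∀ x, P' x = P x) ∧ (∀ x, K' x = K x) ∧ c₁ = C k))
    (hC' : ∀ x, x < z → x ≠ k →
      C' x = if x = P k ∧ I.key c₁ < I.key (C (P k)) then c₁ else C x)
    (hC'k : C' k = c₁) :
    I.PassInv cc z (k + 1) P' K' C' := by
  have hkn : k < n := hk.trans hz
  have hc₁ : I.Valid cc c₁ := by
    rcases hPK with ⟨-, -, -, h1⟩ | ⟨-, -, -, h1⟩
    · rw [h1]; exact h.validK k hkn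
    · rw [h1]; exact h.validC k hk
  refine ⟨?_, ?_, ?_, ?_, ?_, ?_⟩
  · intro x hx
    rcases hPK with ⟨-, -, h1, -⟩ | ⟨-, -, h1, -⟩
    · rw [h1]; split_ifs
      · exact h.validC k hk
      · exact h.validK x hx
    · rw [h1]; exact h.validK x hx
  · intro x hx
    by_cases hxk : x = k
    · rw [hxk, hC'k]; exact hc₁
    · rw [hC' x hx hxk]; split_ifs
      · exact hc₁
      · exact h.validC x hx
  · intro x hx
    rcases hPK with ⟨-, h1, -, -⟩ | ⟨-, h1, -, -⟩
    · rw [h1]; split_ifs with hxk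
      · omega
      · exact h.lt x hx
    · rw [h1]; exact h.lt x hx
  · intro x hx
    rcases hPK with ⟨-, h1, -, -⟩ | ⟨-, h1, -, -⟩
    · rw [h1]; split_ifs with hxk
      · exact le_rfl
      · exact h.le x hx
    · rw [h1]; exact h.le x hx
  · intro x hx hzx
    have hxk : x ≠ k := by omega
    rcases hPK with ⟨-, h1, h2, -⟩ | ⟨-, h1, h2, -⟩
    · rw [h1, h2, if_neg hxk, if_neg hxk]; exact h.rest x hx hzx
    · rw [h1, h2]; exact h.rest x hx hzx
  · intro c hc R
    rw [← h.thr c hc R]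
    have hq : k < P k := h.lt k hkn
    have hqz : P k ≤ z := h.le k hk
    have sy : ∀ {x y}, R x y → R y x := fun h => R.symm h
    have tr : ∀ {x y w}, R x y → R y w → R x w := fun h h' => R.trans h h'
    -- both sides say the same about the edges at `k` and the candidate edge of its parent
    have hcand : ∀ x, k < x → x < z → (x ≠ P k → C' x = C x) :=
      fun x h1 h2 h3 => by rw [hC' x h2 (by omega), if_neg (fun h' => h3 h'.1)]
    -- Keeping only the smaller one of two candidates between `P k` and `z` is harmless: it is below
    -- a threshold iff one of them is.
    have hcandq : P k < z → (I.key (C' (P k)) ≤ I.key c ↔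
        I.key c₁ ≤ I.key c ∨ I.key (C (P k)) ≤ I.key c) := by
      intro hlt
      rw [hC' _ hlt (by omega)]
      by_cases h1 : I.key c₁ < I.key (C (P k))
      · rw [if_pos ⟨rfl, h1⟩]
        exact ⟨Or.inl, fun h2 => h2.elim id fun h3 => h1.le.trans h3⟩
      · rw [if_neg (fun h' => h1 h'.2)]
        exact ⟨Or.inr, fun h2 => h2.elim (fun h3 => (not_lt.1 h1).trans h3) id⟩
    rcases hPK with ⟨hlt, hP', hK', rfl⟩ | ⟨hle, hP', hK', rfl⟩
    · constructor
      · rintro ⟨h1, h2⟩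
        have hkz : I.key (C k) ≤ I.key c → R k z := by
          have := h1 k hk; rw [hP', hK', if_pos rfl, if_pos rfl] at this; exact this
        have hqz' : I.key (K k) ≤ I.key c → R (P k) z := by
          intro h3
          rcases hqz.lt_or_eq with h4 | h4
          · exact h2 _ hq h4 ((hcandq h4).2 (Or.inl h3))
          · rw [h4]
        refine ⟨fun x hx hxc => ?_, fun x hkx hx hxc => ?_⟩
        · by_cases hxk : x = k
          · subst hxk; exact tr (hkz (hlt.le.trans hxc)) (sy (hqz' hxc))
          · have := h1 x hx; rw [hP', hK', if_neg hxk, if_neg hxk] at this; exact this hxc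
        · rcases hkx.eq_or_lt with rfl | hkx
          · exact hkz hxc
          · by_cases hxq : x = P k
            · subst hxq; exact h2 _ hq hx ((hcandq hx).2 (Or.inr hxc))
            · exact h2 x hkx hx (by rw [hcand x hkx hx hxq]; exact hxc)
      · rintro ⟨h1, h2⟩
        refine ⟨fun x hx hxc => ?_, fun x hkx hx hxc => ?_⟩
        · rw [hK'] at hxc
          rw [hP']
          split_ifs at hxc ⊢ with hxk
          · subst hxk; exact h2 x le_rfl hx hxc
          · exact h1 x hx hxc
        · by_cases hxq : x = P k
          · subst hxq
            rcases (hcandq hx).1 hxc with h3 | h3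
            · exact tr (sy (h1 k hk h3)) (h2 k le_rfl hk (hlt.le.trans h3))
            · exact h2 _ hq.le hx h3
          · rw [hcand x hkx hx hxq] at hxc; exact h2 x (by omega) hx hxc
    · rw [not_lt] at hle
      constructor
      · rintro ⟨h1, h2⟩
        have hkq : I.key (K k) ≤ I.key c → R k (P k) := by
          have := h1 k hk; rw [hP', hK'] at this; exact this
        have hqz' : I.key (C k) ≤ I.key c → R (P k) z := by
          intro h3
          rcases hqz.lt_or_eq with h4 | h4
          · exact h2 _ hq h4 ((hcandq h4).2 (Or.inl h3))
          · rw [h4]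
        refine ⟨fun x hx hxc => ?_, fun x hkx hx hxc => ?_⟩
        · have := h1 x hx; rw [hP', hK'] at this; exact this hxc
        · rcases hkx.eq_or_lt with rfl | hkx
          · exact tr (hkq (hle.trans hxc)) (hqz' hxc)
          · by_cases hxq : x = P k
            · subst hxq; exact h2 _ hq hx ((hcandq hx).2 (Or.inr hxc))
            · exact h2 x hkx hx (by rw [hcand x hkx hx hxq]; exact hxc)
      · rintro ⟨h1, h2⟩
        refine ⟨fun x hx hxc => ?_, fun x hkx hx hxc => ?_⟩
        · rw [hK'] at hxc; rw [hP']; exact h1 x hx hxc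
        · by_cases hxq : x = P k
          · subst hxq
            rcases (hcandq hx).1 hxc with h3 | h3
            · exact tr (sy (h1 k hk (hle.trans h3))) (h2 k le_rfl hk h3)
            · exact h2 _ hq.le hx h3
          · rw [hcand x hkx hx hxq] at hxc; exact h2 x (by omega) hx hxc

/-- A pointer representation of the edges of class `cc` between the vertices less than `z`. -/
structure PtrInv (I : Instance n m) (cc z : ℕ) (P K : ℕ → ℕ) : Prop where
  validK : ∀ x < n, I.Valid cc (K x)
  lt : ∀ x < n, x < P x
  lt' : ∀ x, x + 1 < z → P x < z
  rest : ∀ x < n, z ≤ x + 1 → P x = x + 1 ∧ K x = m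
  rep : I.Represents z (fun e => I.col e = cc ∧ I.srcV e < z ∧ I.tgtV e < z) P K

/-- The entries of the matrix are the smallest edges of class `cc` between two vertices. -/
structure MatInv (I : Instance n m) (cc j : ℕ) (M : ℕ → ℕ) : Prop where
  valid : ∀ u < n, ∀ v < n, I.Valid cc (M (u * n + v))
  ends : ∀ u < n, ∀ v < n, M (u * n + v) < m →
    (I.srcV (M (u * n + v)) = u ∧ I.tgtV (M (u * n + v)) = v) ∨
    (I.srcV (M (u * n + v)) = v ∧ I.tgtV (M (u * n + v)) = u)
  le : ∀ e < j, e < m → I.col e = cc → I.key (M (I.srcV e * n + I.tgtV e)) ≤ I.key e ∧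
    I.key (M (I.tgtV e * n + I.srcV e)) ≤ I.key e

/-- Edges between vertices up to `z` are old ones, loops at `z`, or edges at `z`. Of parallel edges
at `z` only the smallest can influence components, and the matrix column contains it. -/
theorem PtrInv.start {cc z : ℕ} {P K C M : ℕ → ℕ} (h : I.PtrInv cc z P K) (hM : I.MatInv cc m M)
    (hz : z < n) (hC : ∀ x < z, C x = M (x * n + z)) : I.PassInv cc z 0 P K C where
  validK := h.validK
  validC := fun x hx => by rw [hC x hx]; exact hM.valid x (hx.trans hz) z hz
  lt := h.lt
  le := fun x hx => by
    rcases (show x + 1 < z ∨ z = x + 1 by omega) with h1 | h1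
    · exact (h.lt' x h1).le
    · rw [(h.rest x (hx.trans hz) h1.le).1, h1]
  rest := fun x hx hzx => h.rest x hx (by omega)
  thr := by
    intro c hc R
    rw [h.rep c hc R]
    constructor
    · rintro ⟨h1, h2⟩ e he ⟨hcol, hs, ht⟩ hec
      rcases (show I.srcV e < z ∨ I.srcV e = z by omega) with hs' | hs' <;>
        rcases (show I.tgtV e < z ∨ I.tgtV e = z by omega) with ht' | ht'
      · exact h1 e he ⟨hcol, hs', ht'⟩ hec
      · rw [ht']
        refine h2 _ (Nat.zero_le _) hs' ?_
        rw [hC _ hs', ← ht']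
        exact (hM.le e he he hcol).1.trans hec
      · rw [hs']
        refine R.symm (h2 _ (Nat.zero_le _) ht' ?_)
        rw [hC _ ht', ← hs']
        exact (hM.le e he he hcol).2.trans hec
      · rw [hs', ht']
    · intro h1
      refine ⟨fun e he hA hec => h1 e he ⟨hA.1, hA.2.1.trans (Nat.lt_succ_self z),
        hA.2.2.trans (Nat.lt_succ_self z)⟩ hec, fun x _ hx hxc => ?_⟩
      rw [hC x hx] at hxc
      have hxn := hx.trans hz
      rcases hM.valid x hxn z hz with h2 | ⟨h2, h3⟩
      · rw [h2] at hxc; exact (I.not_dummy_le hc hxc).elim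
      · rcases hM.ends x hxn z hz h2 with ⟨h4, h5⟩ | ⟨h4, h5⟩
        · have := h1 _ h2 ⟨h3, by omega, by omega⟩ hxc
          rwa [h4, h5] at this
        · have := h1 _ h2 ⟨h3, by omega, by omega⟩ hxc
          rw [h4, h5] at this
          exact R.symm this

/-- When no candidates are left, only pointers remain. Vertex `z` is now the root: it points to `z +
1` with the sentinel as label. For `z = n - 1` this target is no vertex. -/
theorem PassInv.finish {cc z : ℕ} {P K C : ℕ → ℕ} (h : I.PassInv cc z z P K C) (hz : z < n) :
    I.PtrInv cc (z + 1) P K where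
  validK := h.validK
  lt := h.lt
  lt' := fun x hx => by have := h.le x (by omega); omega
  rest := fun x hx hzx => h.rest x hx (by omega)
  rep := by
    intro c hc R
    rw [← h.thr c hc R]
    constructor
    · intro h1
      exact ⟨fun x hx => h1 x (by omega), fun x h2 h3 => by omega⟩
    · rintro ⟨h1, -⟩ x hx hxc
      rcases (show x < z ∨ x = z by omega) with h2 | rfl
      · exact h1 x h2 hxc
      · rw [(h.rest x hz le_rfl).2] at hxc
        exact (I.not_dummy_le hc hxc).elim

theorem PtrInv.init {cc : ℕ} {P K : ℕ → ℕ} (h : ∀ x < n, P x = x + 1 ∧ K x = m) :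
    I.PtrInv cc 0 P K where
  validK := fun x hx => Or.inl (h x hx).2
  lt := fun x hx => by rw [(h x hx).1]; omega
  lt' := fun x hx => by omega
  rest := fun x hx _ => h x hx
  rep := fun c _ R => ⟨fun _ e _ hA => by omega, fun _ x hx => by omega⟩

theorem index_injective {u v u' v' : ℕ} (hv : v < n) (hv' : v' < n)
    (h : u * n + v = u' * n + v') : u = u' ∧ v = v' := by
  have h1 : v = v' := by
    have := congrArg (· % n) h
    simpa [Nat.add_mod, Nat.mod_eq_of_lt hv, Nat.mod_eq_of_lt hv'] using this
  subst h1
  have h2 : u * n = u' * n := by omega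
  exact ⟨Nat.eq_of_mul_eq_mul_right (by omega) h2, rfl⟩

theorem index_lt {u v : ℕ} (hu : u < n) (hv : v < n) : u * n + v < n * n :=
  calc u * n + v < u * n + n := by omega
    _ = (u + 1) * n := by ring
    _ ≤ n * n := Nat.mul_le_mul_right n hu

theorem MatInv.init {cc : ℕ} {M : ℕ → ℕ} (h : ∀ i < n * n, M i = m) : I.MatInv cc 0 M := by
  have h' : ∀ u < n, ∀ v < n, M (u * n + v) = m := by
    intro u hu v hv
    exact h _ (index_lt hu hv)
  exact ⟨fun u hu v hv => Or.inl (h' u hu v hv),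
    fun u hu v hv hlt => by rw [h' u hu v hv] at hlt; omega, fun e he => by omega⟩

/-- Replacing an entry of the matrix by a smaller edge. -/
theorem MatInv.relax {cc j e u v : ℕ} {M M' : ℕ → ℕ} (h : I.MatInv cc j M) (hu : u < n) (hv : v < n)
    (he : e < m) (hcol : I.col e = cc)
    (hends : (I.srcV e = u ∧ I.tgtV e = v) ∨ (I.srcV e = v ∧ I.tgtV e = u))
    (hM' : ∀ i, M' i = if i = u * n + v ∧ I.key e < I.key (M (u * n + v)) then e else M i) :
    I.MatInv cc j M' ∧ I.key (M' (u * n + v)) ≤ I.key e ∧ ∀ i, I.key (M' i) ≤ I.key (M i) := by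
  have hle : ∀ i, I.key (M' i) ≤ I.key (M i) := by
    intro i
    rw [hM']; split_ifs with hi
    · rw [hi.1]; exact hi.2.le
    · exact le_rfl
  refine ⟨⟨?_, ?_, ?_⟩, ?_, hle⟩
  · intro a ha b hb
    rw [hM']; split_ifs
    · exact Or.inr ⟨he, hcol⟩
    · exact h.valid a ha b hb
  · intro a ha b hb
    rw [hM']; split_ifs with hi
    · obtain ⟨rfl, rfl⟩ := index_injective hb hv hi.1
      exact fun _ => hends
    · exact h.ends a ha b hb
  · intro f hf hfm hcf
    exact ⟨(hle _).trans (h.le f hf hfm hcf).1, (hle _).trans (h.le f hf hfm hcf).2⟩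
  · rw [hM']
    by_cases hi : I.key e < I.key (M (u * n + v))
    · simp [hi]
    · rw [if_neg (fun h' => hi h'.2)]; exact not_lt.1 hi

end Instance

end IndMst

namespace RAM

/-! ### The program for minimum spanning forests -/

/-- Store the edge in the scalar variable 14 in an entry of the matrix if it is smaller. -/
def relax (idx : WExp) : Program :=
  .ite (lessT (sc 14) (.get 10 idx)) (.setWord 10 idx (sc 14)) .skip

/-- The first end vertex of the edge in the scalar variable 14. -/
def srcE : WExp := .get 1 (sc 14)

/-- The second end vertex of the edge in the scalar variable 14. -/
def tgtE : WExp := .get 2 (sc 14)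

/-- Mark all entries of the matrix as empty. -/
def clearMatrix : Program := forTo 14 (.mul nE nE) (.setWord 10 (sc 14) mE)

/-- Enter the edge in the scalar variable 14 into the matrix if it belongs to class `cc`. -/
def enterEdge (cc : ℕ) : Program :=
  .ite (.eq (.get 3 (sc 14)) (.const cc))
    (.seq (relax (.add (.mul srcE nE) tgtE)) (relax (.add (.mul tgtE nE) srcE))) .skip

/-- Enter the edges of class `cc` into the matrix. -/
def fillMatrix (cc : ℕ) : Program := forTo 14 mE (enterEdge cc)

/-- Initialize the pointers. -/
def initPointers : Program :=
  forTo 14 nE (.seq (.setWord 11 (sc 14) (.add (sc 14) (.const 1))) (.setWord 12 (sc 14) mE))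

/-- Read the edges from smaller vertices to the vertex in the scalar variable 14. -/
def readColumn : Program :=
  forTo 15 (sc 14) (.setWord 13 (sc 15) (.get 10 (.add (.mul (sc 15) nE) (sc 14))))

/-- Let the pointer of a vertex have the smaller one of two labels. -/
def usePointer : Program :=
  .ite (lessT (.get 13 (sc 15)) (.get 12 (sc 15)))
    (.seq (.setWord 17 (.const 0) (.get 12 (sc 15)))
      (.seq (.setWord 12 (sc 15) (.get 13 (sc 15)))
        (.seq (.setWord 13 (sc 15) (sc 17)) (.setWord 11 (sc 15) (sc 14))))) .skip

/-- Hand the remaining label over to the former parent. -/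
def passOn : Program :=
  .ite (lessT (.get 13 (sc 15)) (.get 13 (sc 16)))
    (.setWord 13 (sc 16) (.get 13 (sc 15))) .skip

/-- Process one vertex when a new vertex is added. -/
def processVertex : Program :=
  .seq (.setWord 16 (.const 0) (.get 11 (sc 15))) (.seq usePointer passOn)

/-- Add one vertex to the pointer representation. -/
def addVertex : Program := .seq readColumn (forTo 15 (sc 14) processVertex)

/-- Compute a pointer representation of a minimum spanning forest of the edges of class `cc`. -/
def forest (cc : ℕ) : Program :=
  .seq clearMatrix (.seq (fillMatrix cc) (.seq initPointers (forTo 14 nE addVertex)))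

end RAM

namespace RAM

theorem Runs.straight {W T : ℕ} {p : Program} {s : State} {Q : State → Prop} (hT : p.maxCost ≤ T)
    (hp : p.Fits W s) (hQ : Q (p.eval s)) : Runs W p s T Q :=
  (Runs.of_fits p hp hQ).mono hT fun _ h => h

end RAM

/-! ### Correctness and running time of the forest program -/

namespace IndMst

open RAM

namespace Instance

variable {n m : ℕ} {I : Instance n m} {W : ℕ}

theorem runs_relax {s : State} (hI : I.Input s) (hW : m ≤ W) {idx : WExp} {e k : ℕ}
    (he : s.word 14 0 = e) (hem : e < m) (hk : idx.val s = k) (hM : s.word 10 k ≤ m) :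
    Runs W (relax idx) s (relax idx).maxCost (fun s' => SameExcept [10] s s' ∧
      ∀ i, s'.word 10 i =
        if i = k ∧ I.key e < I.key (s.word 10 k) then e else s.word 10 i) := by
  have hless := lessT_holds hI (a := sc 14) (b := .get 10 idx) (by simp [he, hem.le])
    (by simpa [WExp.val, hk] using hM)
  simp only [sc_val, WExp.val, he, hk] at hless
  refine Runs.of_fits _ ?_ ?_
  · refine ⟨fun _ => ?_, fun _ => trivial⟩
    simp only [Program.Fits, sc_val, he]; omega
  · simp only [relax, Program.eval]
    by_cases h : I.key e < I.key (s.word 10 k)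
    · rw [if_pos (hless.2 h)]
      refine ⟨(SameExcept.refl _ s).putWord (by simp), fun i => ?_⟩
      simp [he, hk, h]
    · rw [if_neg (fun h' => h (hless.1 h'))]
      exact ⟨SameExcept.refl _ s, fun i => by simp [h]⟩

theorem runs_clearMatrix {s : State} (hI : I.Input s) (hW : n * n ≤ W) (hW' : m ≤ W) :
    Runs W clearMatrix s ((n * n + 1) * (3 + 100)) (fun s' => SameExcept [10, 14] s s' ∧
      ∀ i < n * n, s'.word 10 i = m) := by
  refine (Runs.forTo (k := n * n) (B := 10) (fun j s' => SameExcept [10, 14] s s' ∧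
    ∀ i < j, s'.word 10 i = m) hW ?_ ?_ ?_).mono ?_ (fun _ h => h)
  · exact ⟨(SameExcept.refl _ s).putWord (by simp), by simp⟩
  · rintro j s' ⟨h, -⟩
    have := hI.of_same h
    simp [WExp.val, nE, this.numV]
  · rintro j hj s' hj' ⟨h, h'⟩
    have hI' := hI.of_same h
    refine Runs.straight (by decide) ?_ ?_
    · simp [Program.Fits, mE, WExp.val, hI'.numE, hW']
    · simp only [Program.eval, sc_val, hj']
      refine ⟨by simp [hj'], (h.putWord (by simp)).putWord (by simp), fun i hi => ?_⟩
      simp only [State.putWord_word, mE, WExp.val, hI'.numE]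
      rcases (show i < j ∨ i = j by omega) with h1 | h1
      · simp [h' i h1]
      · simp [h1]
  · exact Nat.mul_le_mul_left _ (by simp [WExp.cost, nE])

/-- Each edge is entered in both orientations, so a column can be read without regard to the order
of its end vertices. -/
theorem runs_fillMatrix {s : State} {cc : ℕ} (hI : I.Input s) (hW : m ≤ W)
    (hM : ∀ i < n * n, s.word 10 i = m) :
    Runs W (fillMatrix cc) s ((m + 1) * 1000) (fun s' => SameExcept [10, 14] s s' ∧
      I.MatInv cc m (s'.word 10)) := by
  refine (Runs.forTo (k := m) (B := 500) (fun j s' => SameExcept [10, 14] s s' ∧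
    I.MatInv cc j (s'.word 10)) hW ?_ ?_ ?_).mono ?_ (fun _ h => h)
  · refine ⟨(SameExcept.refl _ s).putWord (by simp), MatInv.init fun i hi => ?_⟩
    simpa using hM i hi
  · rintro j s' ⟨h, -⟩
    simp [WExp.val, mE, (hI.of_same h).numE]
  · rintro j hj s' hj' ⟨h, hMat⟩
    have hI' := hI.of_same h
    have hcol : (Test.eq (.get 3 (sc 14)) (.const cc)).holds s' ↔ I.col j = cc := by
      simp [Test.holds, WExp.val, hj', hI'.col j hj.le]
    have hfin : ∀ s'' : State, SameExcept [10] s' s'' → I.MatInv cc (j + 1) (s''.word 10) →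
        s''.word 14 0 = j ∧ SameExcept [10, 14] s (s''.putWord 14 0 (j + 1)) ∧
        I.MatInv cc (j + 1) ((s''.putWord 14 0 (j + 1)).word 10) := by
      intro s'' hs hM''
      refine ⟨by rw [hs.1 14 (by simp), hj'], (h.trans (hs.mono (by simp))).putWord (by simp), ?_⟩
      rw [State.putWord_word_of_ne _ (by norm_num)]
      exact hM''
    have hlast : ∀ M : ℕ → ℕ, I.MatInv cc j M → (I.col j = cc →
        I.key (M (I.srcV j * n + I.tgtV j)) ≤ I.key j ∧
        I.key (M (I.tgtV j * n + I.srcV j)) ≤ I.key j) → I.MatInv cc (j + 1) M := by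
      intro M h1 h2
      refine ⟨h1.valid, h1.ends, fun e he hem hc => ?_⟩
      rcases (show e < j ∨ e = j by omega) with h3 | rfl
      · exact h1.le e h3 hem hc
      · exact h2 hc
    have hmain : Runs W (enterEdge cc) s' 500 (fun s'' => SameExcept [10] s' s'' ∧
        I.MatInv cc (j + 1) (s''.word 10)) := by
      refine (Runs.ite (T := 400) (fun hb => ?_) (fun hb => ?_)).mono (T' := 500) ?_ (fun _ h => h)
      · rw [hcol] at hb
        have hu := I.srcV_lt hj
        have hv := I.tgtV_lt hj
        refine ((runs_relax hI' hW hj' hj (k := I.srcV j * n + I.tgtV j) ?_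
          (hMat.valid _ hu _ hv).le).seq (T' := 200) (Q' := fun s'' => SameExcept [10] s' s'' ∧
          I.MatInv cc (j + 1) (s''.word 10)) ?_).mono (by decide) (fun _ h => h)
        · simp [WExp.val, srcE, tgtE, nE, hj', hI'.src j hj, hI'.tgt j hj, hI'.numV]
        · rintro s₁ ⟨hs₁, hM₁⟩
          have hI₁ := hI'.of_same hs₁
          obtain ⟨hMat₁, hle₁, -⟩ := hMat.relax hu hv hj hb (Or.inl ⟨rfl, rfl⟩) hM₁
          have hj₁ : s₁.word 14 0 = j := by rw [hs₁.1 14 (by simp), hj']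
          refine (runs_relax hI₁ hW hj₁ hj (k := I.tgtV j * n + I.srcV j) ?_
            (hMat₁.valid _ hv _ hu).le).mono (by decide) ?_
          · simp [WExp.val, srcE, tgtE, nE, hj₁, hI₁.src j hj, hI₁.tgt j hj, hI₁.numV]
          · rintro s₂ ⟨hs₂, hM₂⟩
            obtain ⟨hMat₂, hle₂, hmono⟩ := hMat₁.relax hv hu hj hb (Or.inr ⟨rfl, rfl⟩) hM₂
            exact ⟨hs₁.trans hs₂, hlast _ hMat₂ fun _ => ⟨(hmono _).trans hle₁, hle₂⟩⟩
      · refine Runs.straight (by decide) trivial ⟨SameExcept.refl _ _, ?_⟩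
        exact hlast _ hMat fun h => absurd (hcol.2 h) hb
      · simp [Test.cost, WExp.cost, sc]
    exact hmain.mono le_rfl fun s'' hs => hfin s'' hs.1 hs.2
  · exact Nat.mul_le_mul_left _ (by simp [WExp.cost, mE])

theorem runs_initPointers {s : State} (hI : I.Input s) (hW : n + m + 1 ≤ W) :
    Runs W initPointers s ((n + 1) * 100) (fun s' => SameExcept [11, 12, 14] s s' ∧
      ∀ x < n, s'.word 11 x = x + 1 ∧ s'.word 12 x = m) := by
  refine (Runs.forTo (k := n) (B := 50) (fun j s' => SameExcept [11, 12, 14] s s' ∧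
    ∀ x < j, s'.word 11 x = x + 1 ∧ s'.word 12 x = m) (by omega) ?_ ?_ ?_).mono ?_ (fun _ h => h)
  · exact ⟨(SameExcept.refl _ s).putWord (by simp), by simp⟩
  · rintro j s' ⟨h, -⟩
    simp [WExp.val, nE, (hI.of_same h).numV]
  · rintro j hj s' hj' ⟨h, h'⟩
    have hI' := hI.of_same h
    refine Runs.straight (by decide) ?_ ?_
    · simp [Program.Fits, Program.eval, mE, WExp.val, hI'.numE, hj']
      omega
    · simp only [Program.eval, sc_val, hj', WExp.val, mE, hI'.numE, State.putWord_word]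
      refine ⟨by simp, (((h.putWord ?_).putWord ?_).putWord ?_), fun x hx => ?_⟩
      · simp
      · simp
      · simp
      · rcases (show x < j ∨ x = j by omega) with h1 | h1
        · simp [h' x h1, h1.ne]
        · simp [h1]
  · exact Nat.mul_le_mul_left _ (by simp [WExp.cost, nE])

theorem runs_readColumn {s : State} {z : ℕ} (hI : I.Input s) (hW : n + m + 1 ≤ W) (hz : z < n)
    (hs : s.word 14 0 = z) {cc : ℕ} (hM : I.MatInv cc m (s.word 10)) :
    Runs W readColumn s ((n + 1) * 100) (fun s' => SameExcept [13, 15] s s' ∧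
      ∀ x < z, s'.word 13 x = s.word 10 (x * n + z)) := by
  refine (Runs.forTo (k := z) (B := 50) (fun j s' => SameExcept [13, 15] s s' ∧
    ∀ x < j, s'.word 13 x = s.word 10 (x * n + z)) (by omega) ?_ ?_ ?_).mono ?_ (fun _ h => h)
  · exact ⟨(SameExcept.refl _ s).putWord (by simp), by simp⟩
  · rintro j s' ⟨h, -⟩
    simp [h.1 14, hs]
  · rintro j hj s' hj' ⟨h, h'⟩
    have hI' := hI.of_same h
    have h14 : s'.word 14 0 = z := by rw [h.1 14 (by simp), hs]
    have hval := (hM.valid j (hj.trans hz) z hz).le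
    refine Runs.straight (by decide) ?_ ?_
    · simp [Program.Fits, nE, WExp.val, hI'.numV, hj', h14, h.1 10]
      omega
    · simp only [Program.eval, sc_val, hj', WExp.val, nE, hI'.numV, h14, h.1 10 (by simp)]
      refine ⟨by simp [hj'], (h.putWord (by simp)).putWord (by simp), fun x hx => ?_⟩
      rcases (show x < j ∨ x = j by omega) with h1 | h1
      · simp [h' x h1, h1.ne]
      · simp [h1]
  · refine Nat.mul_le_mul (by omega) (by simp [WExp.cost, sc])

/-- The former parent is saved in variable 16 before the pointer is overwritten. If it equals `z`,
the second comparison reads, and possibly changes, an entry outside the range of the invariant; its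
outcome does not matter. -/
theorem runs_processVertex {s : State} {cc z k : ℕ} (hI : I.Input s) (hW : n + m + 1 ≤ W)
    (hz : z < n) (hk : k < z) (h14 : s.word 14 0 = z) (h15 : s.word 15 0 = k)
    (h : I.PassInv cc z k (s.word 11) (s.word 12) (s.word 13)) :
    Runs W processVertex s 300 (fun s' => SameExcept [11, 12, 13, 16, 17] s s' ∧
      I.PassInv cc z (k + 1) (s'.word 11) (s'.word 12) (s'.word 13)) := by
  have hkn := hk.trans hz
  have hP := h.lt k hkn
  have hPz := h.le k hk
  have hKk := (h.validK k hkn).le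
  have hCk := (h.validC k hk).le
  set q := s.word 11 k with hq
  have hfirst : Runs W (.setWord 16 (.const 0) (.get 11 (sc 15))) s 10
      (fun s' => s' = s.putWord 16 0 q) := by
    refine Runs.straight (by decide) ?_ ?_
    · simp [Program.Fits, WExp.val, h15]; omega
    · simp [Program.eval, WExp.val, h15, hq]
  refine (hfirst.seq (T' := 290) ?_).mono (by norm_num) (fun _ h => h)
  rintro _ rfl
  have hS : SameExcept [11, 12, 13, 16, 17] s (s.putWord 16 0 q) :=
    (SameExcept.refl _ s).putWord (by simp)
  have hless := lessT_holds (hI.of_same hS) (a := .get 13 (sc 15)) (b := .get 12 (sc 15))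
    (by simpa [WExp.val, h15] using hCk) (by simpa [WExp.val, h15] using hKk)
  simp only [WExp.val, sc_val, State.putWord_word, h15] at hless
  simp only [show ¬ (13 = 16) by norm_num, show ¬ (12 = 16) by norm_num,
    show ¬ (15 = 16) by norm_num, false_and, if_false] at hless
  -- the state after the pointer has been updated
  refine ((Runs.straight (p := usePointer) (T := 150) (Q := fun s' =>
    SameExcept [11, 12, 13, 16, 17] s s' ∧ s'.word 16 0 = q ∧
    ((I.key (s.word 13 k) < I.key (s.word 12 k) ∧
        (∀ x, s'.word 11 x = if x = k then z else s.word 11 x) ∧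
        (∀ x, s'.word 12 x = if x = k then s.word 13 k else s.word 12 x) ∧
        s'.word 13 k = s.word 12 k) ∨
      (¬ I.key (s.word 13 k) < I.key (s.word 12 k) ∧ (∀ x, s'.word 11 x = s.word 11 x) ∧
        (∀ x, s'.word 12 x = s.word 12 x) ∧ s'.word 13 k = s.word 13 k)) ∧
    ∀ x, x ≠ k → s'.word 13 x = s.word 13 x) (by decide) ?_ ?_).seq (T' := 140) ?_).mono
    (by norm_num) (fun _ h => h)
  · refine ⟨fun _ => ?_, fun _ => trivial⟩
    simp [Program.Fits, Program.eval, WExp.val, h15, h14]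
    omega
  · by_cases hlt : I.key (s.word 13 k) < I.key (s.word 12 k)
    · simp only [usePointer, Program.eval, if_pos (hless.2 hlt)]
      refine ⟨?_, ?_, Or.inl ⟨hlt, fun x => ?_, fun x => ?_, ?_⟩, fun x hx => ?_⟩
      · exact (((hS.putWord (by simp)).putWord (by simp)).putWord (by simp)).putWord (by simp)
      · simp
      · simp [WExp.val, h15, h14]
      · simp [WExp.val, h15]
      · simp [WExp.val, h15]
      · simp [WExp.val, h15, hx]
    · simp only [usePointer, Program.eval, if_neg (fun h' => hlt (hless.1 h'))]
      exact ⟨hS, by simp, Or.inr ⟨hlt, by simp, by simp, by simp⟩, by simp⟩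
  rintro s₁ ⟨hS₁, h16, hPK, hC⟩
  have hI₁ := hI.of_same hS₁
  have h15₁ : s₁.word 15 0 = k := by rw [hS₁.1 15 (by simp), h15]
  have hc₁ : s₁.word 13 k ≤ m := by
    rcases hPK with ⟨-, -, -, h1⟩ | ⟨-, -, -, h1⟩ <;> rw [h1] <;> assumption
  have hqk : q ≠ k := hP.ne'
  have hless₁ : q < z → ((lessT (.get 13 (sc 15)) (.get 13 (sc 16))).holds s₁ ↔
      I.key (s₁.word 13 k) < I.key (s.word 13 q)) := by
    intro hqz
    have := lessT_holds hI₁ (a := .get 13 (sc 15)) (b := .get 13 (sc 16))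
      (by simpa [WExp.val, h15₁] using hc₁)
      (by simpa [WExp.val, h16, hC q hqk] using (h.validC q hqz).le)
    simpa [WExp.val, h15₁, h16, hC q hqk] using this
  have hstep : ∀ C' : ℕ → ℕ, (∀ x, x < z → x ≠ k → C' x =
      if x = q ∧ I.key (s₁.word 13 k) < I.key (s.word 13 q) then s₁.word 13 k else s.word 13 x) →
      C' k = s₁.word 13 k → I.PassInv cc z (k + 1) (s₁.word 11) (s₁.word 12) C' := by
    intro C' h1 h2
    exact h.step hk hz (s₁.word 13 k) hPK h1 h2
  refine Runs.straight (by decide) ?_ ?_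
  · refine ⟨fun _ => ?_, fun _ => trivial⟩
    simp [Program.Fits, WExp.val, h15₁]; omega
  · by_cases hb : (lessT (.get 13 (sc 15)) (.get 13 (sc 16))).holds s₁
    · simp only [passOn, Program.eval, if_pos hb]
      refine ⟨hS₁.putWord (by simp), ?_⟩
      rw [State.putWord_word_of_ne _ (by norm_num), State.putWord_word_of_ne _ (by norm_num)]
      refine hstep _ (fun x hx hxk => ?_) ?_
      · by_cases hxq : x = q
        · subst hxq
          simp [WExp.val, h15₁, h16, (hless₁ hx).1 hb]
        · simp [h16, hxq, hC x hxk]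
      · simp [h16, hqk.symm]
    · simp only [passOn, Program.eval, if_neg hb]
      refine ⟨hS₁, hstep _ (fun x hx hxk => ?_) rfl⟩
      rw [hC x hxk, if_neg]
      rintro ⟨rfl, h1⟩
      exact hb ((hless₁ hx).2 h1)

theorem runs_addVertex {s : State} {cc z : ℕ} (hI : I.Input s) (hW : n + m + 1 ≤ W)
    (hz : z < n) (h14 : s.word 14 0 = z) (hM : I.MatInv cc m (s.word 10))
    (h : I.PtrInv cc z (s.word 11) (s.word 12)) :
    Runs W addVertex s ((n + 1) * 500) (fun s' => SameExcept [11, 12, 13, 15, 16, 17] s s' ∧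
      I.PtrInv cc (z + 1) (s'.word 11) (s'.word 12)) := by
  refine ((runs_readColumn hI hW hz h14 hM).seq (T' := (n + 1) * 400) ?_).mono (by omega)
    (fun _ h => h)
  rintro s₁ ⟨hS₁, hC⟩
  refine (Runs.forTo (k := z) (B := 300) (fun j s' => SameExcept [11, 12, 13, 15, 16, 17] s s' ∧
    I.PassInv cc z j (s'.word 11) (s'.word 12) (s'.word 13)) (by omega) ?_ ?_ ?_).mono ?_ ?_
  · refine ⟨(hS₁.mono (by simp)).putWord (by simp), ?_⟩
    rw [State.putWord_word_of_ne _ (by norm_num), State.putWord_word_of_ne _ (by norm_num),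
      State.putWord_word_of_ne _ (by norm_num), hS₁.1 11 (by simp), hS₁.1 12 (by simp)]
    exact h.start hM hz hC
  · rintro j s' ⟨hS, -⟩
    simp [hS.1 14, h14]
  · rintro j hj s' hj' ⟨hS, hP⟩
    have h14' : s'.word 14 0 = z := by rw [hS.1 14 (by simp), h14]
    refine (runs_processVertex (hI.of_same hS) hW hz hj h14' hj' hP).mono le_rfl ?_
    rintro s'' ⟨hS', hP'⟩
    refine ⟨by rw [hS'.1 15 (by simp), hj'], (hS.trans (hS'.mono (by simp))).putWord (by simp), ?_⟩
    rw [State.putWord_word_of_ne _ (by norm_num), State.putWord_word_of_ne _ (by norm_num),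
      State.putWord_word_of_ne _ (by norm_num)]
    exact hP'
  · exact Nat.mul_le_mul (by omega) (by simp [WExp.cost, sc])
  · rintro s' ⟨hS, hP⟩
    exact ⟨hS, hP.finish hz⟩

/-- Clearing the matrix costs O(n²), filling it O(m), and each of the n passes O(n). -/
theorem runs_forest {s : State} (cc : ℕ) (hI : I.Input s) (hW : n + m + 1 ≤ W)
    (hW' : n * n ≤ W) :
    Runs W (forest cc) s (5000 * (n * n + m + 1))
      (fun s' => SameExcept [10, 11, 12, 13, 14, 15, 16, 17] s s' ∧
        I.PtrInv cc n (s'.word 11) (s'.word 12)) := by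
  have hWm : m ≤ W := by omega
  refine ((runs_clearMatrix hI hW' hWm).seq (T' := (m + 1) * 1000 + ((n + 1) * 100 +
    (n + 1) * ((n + 1) * 500 + 50))) ?_).mono ?_ (fun _ h => h)
  swap
  · nlinarith [Nat.le_mul_self n]
  rintro s₁ ⟨hS₁, hM₁⟩
  refine (runs_fillMatrix (hI.of_same hS₁) hWm hM₁).seq ?_
  rintro s₂ ⟨hS₂, hM₂⟩
  have hS₂' : SameExcept [10, 11, 12, 13, 14, 15, 16, 17] s s₂ := (hS₁.trans hS₂).mono (by simp)
  refine (runs_initPointers (hI.of_same hS₂') hW).seq ?_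
  rintro s₃ ⟨hS₃, hP₃⟩
  have hS₃' : SameExcept [10, 11, 12, 13, 14, 15, 16, 17] s s₃ := hS₂'.trans (hS₃.mono (by simp))
  refine (Runs.forTo (k := n) (B := (n + 1) * 500) (fun j s' =>
    SameExcept [10, 11, 12, 13, 14, 15, 16, 17] s s' ∧ I.MatInv cc m (s'.word 10) ∧
    I.PtrInv cc j (s'.word 11) (s'.word 12)) (by omega) ?_ ?_ ?_).mono ?_ ?_
  · refine ⟨hS₃'.putWord (by simp), ?_, ?_⟩
    · rw [State.putWord_word_of_ne _ (by norm_num), hS₃.1 10 (by simp)]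
      exact hM₂
    · rw [State.putWord_word_of_ne _ (by norm_num), State.putWord_word_of_ne _ (by norm_num)]
      exact PtrInv.init hP₃
  · rintro j s' ⟨h, -⟩
    simp [WExp.val, nE, (hI.of_same h).numV]
  · rintro j hj s' hj' ⟨h, hM, hP⟩
    refine (runs_addVertex (hI.of_same h) hW hj hj' hM hP).mono le_rfl ?_
    rintro s'' ⟨hS', hP'⟩
    refine ⟨by rw [hS'.1 14 (by simp), hj'], (h.trans (hS'.mono (by simp))).putWord (by simp),
      ?_, ?_⟩
    · rw [State.putWord_word_of_ne _ (by norm_num), hS'.1 10 (by simp)]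
      exact hM
    · rw [State.putWord_word_of_ne _ (by norm_num), State.putWord_word_of_ne _ (by norm_num)]
      exact hP'
  · exact Nat.mul_le_mul_left _ (by simp [WExp.cost, nE])
  · exact fun s' h => ⟨h.1, h.2.2⟩

end Instance

end IndMst

namespace RAM

/-! ### The program for the exchanges -/

/-- Find the smallest edge of the array 20 that is larger than the edge in the scalar variable 21
(if there is one in that variable). -/
def nextNew : Program :=
  .seq (.setWord 22 (.const 0) mE)
    (forTo 15 nE
      (.ite (.and (orT (.eq (sc 21) mE) (lessT (sc 21) (.get 20 (sc 15))))
          (lessT (.get 20 (sc 15)) (sc 22)))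
        (.setWord 22 (.const 0) (.get 20 (sc 15))) .skip))

/-- Let the scalar variable 24 be smaller than the scalar variable 25. -/
def orderEnds : Program :=
  .ite (.lt (sc 25) (sc 24))
    (.seq (.setWord 26 (.const 0) (sc 24))
      (.seq (.setWord 24 (.const 0) (sc 25)) (.setWord 25 (.const 0) (sc 26)))) .skip

/-- Move the edge in the scalar variable 23 upwards or exchange it with a pointer. -/
def moveEdge : Program :=
  .ite (lessT (.get 12 (sc 24)) (sc 23)) (.setWord 24 (.const 0) (.get 11 (sc 24)))
    (.seq (.setWord 26 (.const 0) (.get 12 (sc 24)))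
      (.seq (.setWord 12 (sc 24) (sc 23))
        (.seq (.setWord 23 (.const 0) (sc 26))
          (.seq (.setWord 26 (.const 0) (.get 11 (sc 24)))
            (.seq (.setWord 11 (sc 24) (sc 25)) (.setWord 24 (.const 0) (sc 26)))))))

/-- Insert an edge into the pointer representation; it is replaced by the edge that drops out. -/
def insertEdge : Program := .loop (.not (.eq (sc 24) (sc 25))) (.seq orderEnds moveEdge)

/-- Prepare the insertion of the edge in the scalar variable 22. -/
def prepare : Program :=
  .seq (.setWord 21 (.const 0) (sc 22)) (.seq (.setWord 23 (.const 0) (sc 22))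
    (.seq (.setWord 24 (.const 0) (.get 1 (sc 22))) (.setWord 25 (.const 0) (.get 2 (sc 22)))))

/-- Write down an exchange and its gain. -/
def record : Program :=
  .seq (.setWord 27 (sc 29) (sc 22)) (.seq (.setWord 28 (sc 29) (sc 23))
    (.seq (.setReal 1 (sc 29) (.sub (.get 0 (sc 23)) (.get 0 (sc 22))))
      (.setWord 29 (.const 0) (.add (sc 29) (.const 1)))))

/-- Process the next new edge. -/
def nextExchange : Program :=
  .seq nextNew (.ite (.lt (sc 22) mE) (.seq prepare (.seq insertEdge record)) .skip)

/-- Compute all exchanges. -/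
def exchanges : Program :=
  .seq (.setWord 29 (.const 0) (.const 0))
    (.seq (.setWord 21 (.const 0) mE) (forTo 14 nE nextExchange))

end RAM

namespace IndMst

open RAM

namespace Instance

variable {n m : ℕ} {I : Instance n m} {W : ℕ}

/-! ### Spanning trees as sets of pointer labels -/

theorem col_eq_one {e : ℕ} : I.col e = 1 ↔ ∃ h : e < m, (⟨e, h⟩ : Fin m) ∈ I.existing := by
  unfold col
  by_cases h : e < m
  · by_cases h' : (⟨e, h⟩ : Fin m) ∈ I.existing <;> simp [h, h']
  · simp [h]

theorem col_eq_zero {e : ℕ} : I.col e = 0 ↔ ∃ h : e < m, (⟨e, h⟩ : Fin m) ∉ I.existing := by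
  unfold col
  by_cases h : e < m
  · by_cases h' : (⟨e, h⟩ : Fin m) ∈ I.existing <;> simp [h, h']
  · simp [h]

/-- The edges that occur among the labels of the vertices less than `N`. -/
noncomputable def keySet (_ : Instance n m) (N : ℕ) (K : ℕ → ℕ) : Finset (Fin m) :=
  open Classical in Finset.univ.filter fun e : Fin m => ∃ x < N, K x = e

theorem mem_keySet {N : ℕ} {K : ℕ → ℕ} {e : Fin m} : e ∈ I.keySet N K ↔ ∃ x < N, K x = e := by
  simp [keySet]

theorem coe_keySet {N : ℕ} {K : ℕ → ℕ} :
    (I.keySet N K : Set (Fin m)) = {e : Fin m | ∃ x < N, K x = e} := by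
  ext e; simp [mem_keySet]

theorem card_keySet_le_of_subset {N : ℕ} {K : ℕ → ℕ} (S : Finset ℕ)
    (hS : ∀ x < N, K x < m → x ∈ S) : (I.keySet N K).card ≤ S.card := by
  have h1 : (I.keySet N K).map Fin.valEmbedding ⊆ S.image K := by
    intro y hy
    obtain ⟨e, he, rfl⟩ := Finset.mem_map.1 hy
    obtain ⟨x, hx, hxe⟩ := mem_keySet.1 he
    refine Finset.mem_image.2 ⟨x, hS x hx ?_, hxe⟩
    rw [hxe]; exact e.2
  have h2 := (Finset.card_le_card h1).trans Finset.card_image_le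
  rwa [Finset.card_map] at h2

theorem card_keySet_le (N : ℕ) (K : ℕ → ℕ) : (I.keySet N K).card ≤ N := by
  have := card_keySet_le_of_subset (I := I) (N := N) (K := K) (Finset.range N)
    (fun x hx _ => Finset.mem_range.2 hx)
  simpa using this

theorem spans_existing (hI : I.ExistingConnected) :
    Spans I.srcN I.tgtN (I.existing : Set (Fin m)) := spans_of_connected hI

/-- n - 1 pointers carry at most n - 1 different edges, and fewer cannot span. -/
theorem card_keySet_eq (hI : I.ExistingConnected) {N : ℕ} (hN : N = n - 1) {K : ℕ → ℕ}
    (h : Spans I.srcN I.tgtN (I.keySet N K : Set (Fin m))) : (I.keySet N K).card = n - 1 :=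
  le_antisymm ((card_keySet_le N K).trans hN.le) (le_card_of_spans hI _ h)

/-- The properties of a pointer representation of a spanning tree. -/
def TreePtr (_ : Instance n m) (P K : ℕ → ℕ) : Prop :=
  ∀ x < n - 1, x < P x ∧ P x < n ∧ K x < m

/-- The root `n - 1` carries the sentinel and can be left out. As the existing edges connect all
vertices, the labels of the other n - 1 vertices form a minimum spanning tree of them, with which
the chain of exchanges starts. -/
theorem PtrInv.tree (hI : I.ExistingConnected) {P K : ℕ → ℕ} (h : I.PtrInv 1 n P K) :
    I.TreePtr P K ∧ I.keySet (n - 1) K ⊆ I.existing ∧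
    I.Represents (n - 1) (fun e => ∃ h : e < m, (⟨e, h⟩ : Fin m) ∈ seen I.existing []) P K ∧
    SwapChain I.srcN I.tgtN (n - 1) I.existing (fun e : Fin m => I.key e) (I.keySet (n - 1) K) []
      (I.keySet (n - 1) K) := by
  have hrep : I.Represents (n - 1)
      (fun e => ∃ h : e < m, (⟨e, h⟩ : Fin m) ∈ seen I.existing []) P K := by
    intro c hc R
    have h1 := h.rep c hc R
    constructor
    · intro h2 e he ⟨_, hA⟩ hec
      refine h1.1 ?_ e he ⟨col_eq_one.2 ⟨he, by simpa [seen] using hA⟩, I.srcV_lt he, I.tgtV_lt he⟩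
        hec
      intro x hx hxc
      by_cases hx' : x < n - 1
      · exact h2 x hx' hxc
      · rw [(h.rest x hx (by omega)).2] at hxc
        exact (I.not_dummy_le hc hxc).elim
    · intro h2 x hx hxc
      refine h1.2 ?_ x (by omega) hxc
      rintro e he ⟨hcol, -⟩ hec
      obtain ⟨_, h3⟩ := col_eq_one.1 hcol
      exact h2 e he ⟨he, Or.inl h3⟩ hec
  have hsp : Spanned I.srcN I.tgtN (fun e : Fin m => I.key e) (I.existing : Set (Fin m))
      (I.keySet (n - 1) K : Set (Fin m)) := by
    rw [coe_keySet]
    exact hrep.spanned fun e he => ⟨e.2, Or.inl (by exact_mod_cast he)⟩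
  have hcard := card_keySet_eq hI rfl (hsp.spans (spans_existing hI))
  have hsub : I.keySet (n - 1) K ⊆ I.existing := by
    intro e he
    obtain ⟨x, hx, hxe⟩ := mem_keySet.1 he
    rcases h.validK x (by omega) with h1 | ⟨-, h1⟩
    · have := e.2; omega
    · rw [hxe] at h1
      exact (col_eq_one.1 h1).2
  -- A sentinel below the root would leave at most n - 2 edges as labels.
  have hlt : ∀ x < n - 1, K x < m := by
    intro x hx
    by_contra hge
    have h1 := card_keySet_le_of_subset (I := I) (N := n - 1) (K := K)
      ((Finset.range (n - 1)).erase x) (fun y hy hym => Finset.mem_erase.2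
        ⟨fun h' => hge (h' ▸ hym), Finset.mem_range.2 hy⟩)
    rw [hcard, Finset.card_erase_of_mem (Finset.mem_range.2 hx), Finset.card_range] at h1
    omega
  refine ⟨fun x hx => ⟨h.lt x (by omega), h.lt' x (by omega), hlt x hx⟩, hsub, hrep, ?_⟩
  exact SwapChain.nil (fun a b hab => Fin.ext (I.key_injective hab)) hsub hcard hsp

/-! ### Inserting an edge -/

/-- The situation while the edge `r` is inserted, where the edge `e`, moved to the vertices `u` and
`v`, is still to be inserted. -/
structure InsertInv (I : Instance n m) (r : ℕ) (A B : ℕ → Prop) (P K : ℕ → ℕ) (u v e : ℕ) :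
    Prop where
  u_lt : u < n
  v_lt : v < n
  e_lt : e < m
  le : I.key r ≤ I.key e
  ptr : I.TreePtr P K
  thr : ∀ c < m, ∀ R : Setoid ℕ, ((∀ x < n - 1, I.key (K x) ≤ I.key c → R x (P x)) ∧
      (I.key e ≤ I.key c → R u v)) ↔
    (∀ f < m, A f → I.key f ≤ I.key c → R (I.srcV f) (I.tgtV f))
  img : ∀ y, (y = e ∨ ∃ x < n - 1, K x = y) ↔ (y = r ∨ B y)

variable {r u v e : ℕ} {A B : ℕ → Prop} {P K : ℕ → ℕ}

theorem InsertInv.symm (h : I.InsertInv r A B P K u v e) : I.InsertInv r A B P K v u e :=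
  ⟨h.v_lt, h.u_lt, h.e_lt, h.le, h.ptr, fun c hc R => by
    rw [← h.thr c hc R]
    exact and_congr Iff.rfl ⟨fun h' hc => R.symm (h' hc), fun h' hc => R.symm (h' hc)⟩, h.img⟩

/-- Whenever the pending edge is below the threshold, so is the label at `u`; then `u` and `P u` are
already in one component, and the lower end may be moved up. -/
theorem InsertInv.climb (h : I.InsertInv r A B P K u v e) (huv : u < v)
    (hlt : I.key (K u) < I.key e) : I.InsertInv r A B P K (P u) v e := by
  have hv := h.v_lt
  have hu : u < n - 1 := by omega
  refine ⟨(h.ptr u hu).2.1, h.v_lt, h.e_lt, h.le, h.ptr, fun c hc R => ?_, h.img⟩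
  rw [← h.thr c hc R]
  refine and_congr_right fun h1 => ⟨fun h2 h3 => ?_, fun h2 h3 => ?_⟩
  · exact R.trans (h1 u hu (hlt.le.trans h3)) (h2 h3)
  · exact R.trans (R.symm (h1 u hu (hlt.le.trans h3))) (h2 h3)

/-- The same triangle argument as in `PassInv.step`: of the two links from `u`, the one with the
smaller label becomes the pointer, and the other one becomes a pending link between `P u` and `v`.
The pending label never decreases, which later gives that `r` is not larger than the expelled edge.
-/
theorem InsertInv.exchange (h : I.InsertInv r A B P K u v e) (huv : u < v)
    (hle : I.key e ≤ I.key (K u)) {P' K' : ℕ → ℕ} (hP' : ∀ x, P' x = if x = u then v else P x)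
    (hK' : ∀ x, K' x = if x = u then e else K x) : I.InsertInv r A B P' K' (P u) v (K u) := by
  have hv := h.v_lt
  have hu : u < n - 1 := by omega
  refine ⟨(h.ptr u hu).2.1, h.v_lt, (h.ptr u hu).2.2, h.le.trans hle, ?_, fun c hc R => ?_, ?_⟩
  · intro x hx
    rw [hP', hK']
    split_ifs with hxu
    · subst hxu; exact ⟨huv, hv, h.e_lt⟩
    · exact h.ptr x hx
  · rw [← h.thr c hc R]
    constructor
    · rintro ⟨h1, h2⟩
      have h3 : I.key e ≤ I.key c → R u v := by
        have := h1 u hu; rw [hP', hK', if_pos rfl, if_pos rfl] at this; exact this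
      refine ⟨fun x hx hxc => ?_, h3⟩
      by_cases hxu : x = u
      · subst hxu
        exact R.trans (h3 (hle.trans hxc)) (R.symm (h2 hxc))
      · have := h1 x hx; rw [hP', hK', if_neg hxu, if_neg hxu] at this; exact this hxc
    · rintro ⟨h1, h2⟩
      refine ⟨fun x hx hxc => ?_, fun h3 => ?_⟩
      · rw [hK'] at hxc; rw [hP']
        split_ifs at hxc ⊢ with hxu
        · subst hxu; exact h2 hxc
        · exact h1 x hx hxc
      · exact R.trans (R.symm (h1 u hu h3)) (h2 (hle.trans h3))
  · intro y
    rw [← h.img y]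
    constructor
    · rintro (rfl | ⟨x, hx, rfl⟩)
      · exact Or.inr ⟨u, hu, rfl⟩
      · rw [hK']; split_ifs
        · exact Or.inl rfl
        · exact Or.inr ⟨x, hx, rfl⟩
    · rintro (rfl | ⟨x, hx, rfl⟩)
      · exact Or.inr ⟨u, hu, by rw [hK', if_pos rfl]⟩
      · by_cases hxu : x = u
        · subst hxu; exact Or.inl rfl
        · exact Or.inr ⟨x, hx, by rw [hK', if_neg hxu]⟩

theorem runs_orderEnds {s : State} (hW : n ≤ W) (hne : s.word 24 0 ≠ s.word 25 0)
    (h : I.InsertInv r A B (s.word 11) (s.word 12) (s.word 24 0) (s.word 25 0) (s.word 23 0)) :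
    Runs W orderEnds s 50 (fun s' => SameExcept [24, 25, 26] s s' ∧
      s'.word 24 0 < s'.word 25 0 ∧ s'.word 24 0 = min (s.word 24 0) (s.word 25 0) ∧
      I.InsertInv r A B (s.word 11) (s.word 12) (s'.word 24 0) (s'.word 25 0) (s.word 23 0)) := by
  have hu := h.u_lt
  have hv := h.v_lt
  refine Runs.straight (by decide) ?_ ?_
  · refine ⟨fun _ => ?_, fun _ => trivial⟩
    simp [Program.Fits, Program.eval, WExp.val]; omega
  · by_cases hlt : s.word 25 0 < s.word 24 0
    · have hb : (Test.lt (sc 25) (sc 24)).holds s := hlt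
      simp only [orderEnds, Program.eval, if_pos hb]
      refine ⟨(((SameExcept.refl _ s).putWord (by simp)).putWord (by simp)).putWord (by simp), ?_⟩
      simp only [WExp.val, State.putWord_word, sc_val]
      simp only [and_self, if_true, show ¬ (24 = 26) by norm_num, show ¬ (25 = 26) by norm_num,
        show ¬ (24 = 25) by norm_num, show ¬ (26 = 24) by norm_num, false_and, if_false]
      exact ⟨hlt, (min_eq_right hlt.le).symm, h.symm⟩
    · have hb : ¬ (Test.lt (sc 25) (sc 24)).holds s := hlt
      simp only [orderEnds, Program.eval, if_neg hb]
      exact ⟨SameExcept.refl _ s, by omega, by omega, h⟩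

theorem runs_moveEdge {s : State} (hI : I.Input s) (hW : n + m + 1 ≤ W)
    (hlt : s.word 24 0 < s.word 25 0)
    (h : I.InsertInv r A B (s.word 11) (s.word 12) (s.word 24 0) (s.word 25 0) (s.word 23 0)) :
    Runs W moveEdge s 150 (fun s' => SameExcept [11, 12, 23, 24, 25, 26] s s' ∧
      s.word 24 0 < min (s'.word 24 0) (s'.word 25 0) ∧
      I.InsertInv r A B (s'.word 11) (s'.word 12) (s'.word 24 0) (s'.word 25 0)
        (s'.word 23 0)) := by
  have hv := h.v_lt
  have hu : s.word 24 0 < n - 1 := by omega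
  obtain ⟨hP, hPn, hK⟩ := h.ptr _ hu
  have he := h.e_lt
  have hless := lessT_holds hI (a := .get 12 (sc 24)) (b := sc 23) hK.le he.le
  refine Runs.straight (by decide) ?_ ?_
  · refine ⟨fun _ => ?_, fun _ => ?_⟩
    · simp [Program.Fits, WExp.val]; omega
    · simp [Program.Fits, Program.eval, WExp.val]; omega
  · by_cases hb : (lessT (.get 12 (sc 24)) (sc 23)).holds s
    · simp only [moveEdge, Program.eval, if_pos hb]
      refine ⟨(SameExcept.refl _ s).putWord (by simp), ?_, ?_⟩
      · simp [WExp.val, hP, hlt]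
      · rw [State.putWord_word_of_ne _ (by norm_num), State.putWord_word_of_ne _ (by norm_num)]
        simpa [WExp.val] using h.climb hlt (hless.1 hb)
    · simp only [moveEdge, Program.eval, if_neg hb]
      have hle : I.key (s.word 23 0) ≤ I.key (s.word 12 (s.word 24 0)) :=
        not_lt.1 fun h' => hb (hless.2 h')
      refine ⟨(((((((SameExcept.refl _ s).putWord ?_).putWord ?_).putWord ?_).putWord
        ?_).putWord ?_).putWord ?_), ?_, ?_⟩
      iterate 6 simp
      · simp [WExp.val, hP, hlt]
      · have := h.exchange hlt hle (P' := fun x => if x = s.word 24 0 then s.word 25 0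
          else s.word 11 x) (K' := fun x => if x = s.word 24 0 then s.word 23 0
          else s.word 12 x) (fun _ => rfl) (fun _ => rfl)
        convert this using 1
        · funext x; simp [WExp.val]
        · funext x; simp [WExp.val]
        · simp [WExp.val]
        · simp [WExp.val]
        · simp [WExp.val]

/-- Each round replaces the smaller one of the two ends by a larger vertex, so the minimum of the
ends increases and at most n rounds occur. When the ends meet, the pending edge is a loop; it is the
edge that drops out. -/
theorem runs_insertEdge {s : State} (hI : I.Input s) (hW : n + m + 1 ≤ W)
    (h : I.InsertInv r A B (s.word 11) (s.word 12) (s.word 24 0) (s.word 25 0) (s.word 23 0)) :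
    Runs W insertEdge s ((n + 1) * 300) (fun s' => SameExcept [11, 12, 23, 24, 25, 26] s s' ∧
      ∃ u, I.InsertInv r A B (s'.word 11) (s'.word 12) u u (s'.word 23 0)) := by
  have hloop := Runs.loop (W := W) (b := .not (.eq (sc 24) (sc 25))) (p := .seq orderEnds moveEdge)
    (B := 200) (fun k s' => SameExcept [11, 12, 23, 24, 25, 26] s s' ∧
      n ≤ min (s'.word 24 0) (s'.word 25 0) + k ∧
      I.InsertInv r A B (s'.word 11) (s'.word 12) (s'.word 24 0) (s'.word 25 0) (s'.word 23 0)) (by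
    rintro k s' ⟨hS, hk, hinv⟩ hb
    have hne : s'.word 24 0 ≠ s'.word 25 0 := hb
    have h1 := hinv.u_lt
    refine ⟨k - 1, by omega, ?_⟩
    refine ((runs_orderEnds (by omega) hne hinv).seq (T' := 150) ?_)
    rintro s₁ ⟨hS₁, hlt, hmin, hinv₁⟩
    have e11 := hS₁.1 11 (by simp)
    have e12 := hS₁.1 12 (by simp)
    have e23 := hS₁.1 23 (by simp)
    rw [← e11, ← e12, ← e23] at hinv₁
    have hS₁' := hS.trans (hS₁.mono (by simp))
    refine (runs_moveEdge (hI.of_same hS₁') hW hlt hinv₁).mono le_rfl ?_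
    rintro s₂ ⟨hS₂, hmin₂, hinv₂⟩
    exact ⟨hS₁'.trans hS₂, by omega, hinv₂⟩)
  refine (hloop n s ⟨SameExcept.refl _ s, by omega, h⟩).mono ?_ ?_
  · have : (Test.not (.eq (sc 24) (sc 25))).cost = 6 := rfl
    rw [this]; omega
  · rintro s' ⟨hb, k, hS, -, hinv⟩
    have heq : s'.word 24 0 = s'.word 25 0 := by
      by_contra hne; exact hb hne
    rw [← heq] at hinv
    exact ⟨hS, _, hinv⟩

/-! ### The sequence of exchanges -/

/-- The new edges are met in increasing order by repeated linear search instead of sorting. The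
value `m` means "none" both in variable 21 (last edge) and in the result. -/
theorem runs_nextNew {s : State} (hI : I.Input s) (hW : n + m + 1 ≤ W)
    (hK : ∀ x < n, s.word 20 x ≤ m) (hlast : s.word 21 0 ≤ m) :
    Runs W nextNew s ((n + 1) * 300) (fun s' => SameExcept [15, 22] s s' ∧
      (s'.word 22 0 = m ∨ (s'.word 22 0 < m ∧ (∃ x < n, s.word 20 x = s'.word 22 0) ∧
        (s.word 21 0 = m ∨ I.key (s.word 21 0) < I.key (s'.word 22 0)))) ∧
      ∀ x < n, s.word 20 x < m → (s.word 21 0 = m ∨ I.key (s.word 21 0) < I.key (s.word 20 x)) →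
        I.key (s'.word 22 0) ≤ I.key (s.word 20 x)) := by
  have hfirst : Runs W (.setWord 22 (.const 0) mE) s 10 (fun s' => s' = s.putWord 22 0 m) := by
    refine Runs.straight (by decide) ?_ ?_
    · simp [Program.Fits, WExp.val, mE, hI.numE]; omega
    · simp [Program.eval, WExp.val, mE, hI.numE]
  refine (hfirst.seq (T' := (n + 1) * 200) ?_).mono (by omega) (fun _ h => h)
  rintro _ rfl
  refine (Runs.forTo (k := n) (B := 150) (fun j s' => SameExcept [15, 22] s s' ∧
      (s'.word 22 0 = m ∨ (s'.word 22 0 < m ∧ (∃ x < n, s.word 20 x = s'.word 22 0) ∧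
        (s.word 21 0 = m ∨ I.key (s.word 21 0) < I.key (s'.word 22 0)))) ∧
      ∀ x < j, s.word 20 x < m → (s.word 21 0 = m ∨ I.key (s.word 21 0) < I.key (s.word 20 x)) →
        I.key (s'.word 22 0) ≤ I.key (s.word 20 x)) (by omega) ?_ ?_ ?_).mono ?_ (fun _ h => h)
  · exact ⟨((SameExcept.refl _ s).putWord (by simp)).putWord (by simp), by simp, by simp⟩
  · rintro j s' ⟨h, -⟩
    simp [WExp.val, nE, (hI.of_same h).numV]
  · rintro j hj s' hj' ⟨hS, hbest, hmin⟩
    have hI' := hI.of_same hS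
    have e20 := hS.1 20 (by simp)
    have e21 := hS.1 21 (by simp)
    have hbm : s'.word 22 0 ≤ m := by omega
    have hKj := hK j hj
    have hl1 := lessT_holds hI' (a := sc 21) (b := .get 20 (sc 15))
      (by simpa [e21] using hlast) (by simpa [WExp.val, hj', e20] using hKj)
    have hl2 := lessT_holds hI' (a := .get 20 (sc 15)) (b := sc 22)
      (by simpa [WExp.val, hj', e20] using hKj) (by simpa using hbm)
    simp only [WExp.val, sc_val, hj', e20, e21] at hl1 hl2
    have hb : (Test.and (orT (.eq (sc 21) mE) (lessT (sc 21) (.get 20 (sc 15))))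
        (lessT (.get 20 (sc 15)) (sc 22))).holds s' ↔
        (s.word 21 0 = m ∨ I.key (s.word 21 0) < I.key (s.word 20 j)) ∧
          I.key (s.word 20 j) < I.key (s'.word 22 0) := by
      rw [← hl1, ← hl2]
      simp only [Test.holds, orT_holds, sc_val, mE, WExp.val, hI'.numE, e21]
    refine Runs.straight (by decide) ?_ ?_
    · refine ⟨fun _ => ?_, fun _ => trivial⟩
      simp [Program.Fits, WExp.val, hj', e20]; omega
    · by_cases hc : (s.word 21 0 = m ∨ I.key (s.word 21 0) < I.key (s.word 20 j)) ∧
          I.key (s.word 20 j) < I.key (s'.word 22 0)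
      · simp only [Program.eval, if_pos (hb.2 hc)]
        have hjm : s.word 20 j < m := by
          rcases hKj.lt_or_eq with h1 | h1
          · exact h1
          · exfalso
            rw [h1] at hc
            rcases hbm.lt_or_eq with h2 | h2
            · exact lt_asymm hc.2 (I.key_lt_dummy h2)
            · rw [h2] at hc; exact lt_irrefl _ hc.2
        refine ⟨by simp [hj'], (hS.putWord (by simp)).putWord (by simp), Or.inr ?_, ?_⟩
        · simp only [State.putWord_word, WExp.val, sc_val, hj', e20]
          simp only [show ¬ (22 = 15) by norm_num, false_and, if_false, and_self, if_true]
          exact ⟨hjm, ⟨j, hj, rfl⟩, hc.1⟩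
        · intro x hx hxm hxl
          simp only [State.putWord_word, WExp.val, sc_val, hj', e20]
          simp only [show ¬ (22 = 15) by norm_num, false_and, if_false, and_self, if_true]
          rcases (show x < j ∨ x = j by omega) with h1 | rfl
          · exact hc.2.le.trans (hmin x h1 hxm hxl)
          · exact le_rfl
      · simp only [Program.eval, if_neg (fun h' => hc (hb.1 h'))]
        refine ⟨hj', hS.putWord (by simp), by simpa using hbest, ?_⟩
        intro x hx hxm hxl
        simp only [State.putWord_word]
        simp only [show ¬ (22 = 15) by norm_num, false_and, if_false]
        rcases (show x < j ∨ x = j by omega) with h1 | rfl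
        · exact hmin x h1 hxm hxl
        · exact not_lt.1 fun h' => hc ⟨hxl, h'⟩
  · exact Nat.mul_le_mul_left _ (by simp [WExp.cost, nE])

/-- The memory after the exchanges `prs` have been found; `K₂` are the labels of a minimum spanning
forest of the new edges. -/
structure SwapState (I : Instance n m) (X₀ : Finset (Fin m)) (K₂ : ℕ → ℕ)
    (prs : List (Fin m × Fin m)) (s : State) : Prop where
  input : I.Input s
  chain : SwapChain I.srcN I.tgtN (n - 1) I.existing (fun e : Fin m => I.key e) X₀ prs
    (I.keySet (n - 1) (s.word 12))
  ptr : I.TreePtr (s.word 11) (s.word 12)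
  rep : I.Represents (n - 1) (fun e => ∃ h : e < m, (⟨e, h⟩ : Fin m) ∈ seen I.existing prs)
    (s.word 11) (s.word 12)
  labels : s.word 20 = K₂
  len : s.word 29 0 = prs.length
  out : ∀ (i : ℕ) (h : i < prs.length), s.word 27 i = prs[i].1 ∧ s.word 28 i = prs[i].2 ∧
    s.real 1 i = gain I prs[i]
  last : (prs = [] ∧ s.word 21 0 = m) ∨
    ∃ p ∈ prs, s.word 21 0 = p.1 ∧ ∀ p' ∈ prs, I.key p'.1 ≤ I.key p.1
  mem : ∀ p ∈ prs, ∃ x < n, K₂ x = p.1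
  rest : ∀ x < n, K₂ x < m → (∃ p ∈ prs, (p.1 : ℕ) = K₂ x) ∨ s.word 21 0 = m ∨
    I.key (s.word 21 0) < I.key (K₂ x)

theorem SwapState.of_same {X₀ : Finset (Fin m)} {K₂ : ℕ → ℕ} {prs : List (Fin m × Fin m)}
    {s s' : State} (h : I.SwapState X₀ K₂ prs s) {l : List ℕ} (hS : SameExcept l s s')
    (hl : ∀ a ∈ [0, 1, 2, 3, 11, 12, 20, 21, 27, 28, 29], a ∉ l := by decide) :
    I.SwapState X₀ K₂ prs s' := by
  have e := fun a ha => hS.1 a (hl a ha)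
  have e11 := e 11 (by simp)
  have e12 := e 12 (by simp)
  have e20 := e 20 (by simp)
  have e21 := e 21 (by simp)
  have e27 := e 27 (by simp)
  have e28 := e 28 (by simp)
  have e29 := e 29 (by simp)
  refine ⟨h.input.of_same hS (hl 0 (by simp)) (hl 1 (by simp)) (hl 2 (by simp)) (hl 3 (by simp)),
    ?_, ?_, ?_, ?_, ?_, ?_, ?_, h.mem, ?_⟩
  · rw [e12]; exact h.chain
  · rw [e11, e12]; exact h.ptr
  · rw [e11, e12]; exact h.rep
  · rw [e20]; exact h.labels
  · rw [e29]; exact h.len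
  · rw [e27, e28, hS.2]; exact h.out
  · rw [e21]; exact h.last
  · rw [e21]; exact h.rest

theorem key_injective_coe : Function.Injective (fun e : Fin m => I.key e) :=
  fun _ _ hab => Fin.ext (I.key_injective hab)

theorem key_lt_of_notMem (a : Fin m) (ha : a ∉ I.existing) (b : Fin m) (hb : b ∈ I.existing) :
    I.key a < I.key b := by
  rw [key_lt_iff, (col_eq_zero (I := I)).2 ⟨a.2, ha⟩, (col_eq_one (I := I)).2 ⟨b.2, hb⟩]
  exact Or.inl one_pos

theorem SwapState.fst_nodup {X₀ : Finset (Fin m)} {K₂ : ℕ → ℕ} {prs : List (Fin m × Fin m)}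
    {s : State} (h : I.SwapState X₀ K₂ prs s) : (prs.map Prod.fst).Nodup :=
  h.chain.sorted.imp fun hab hne => by rw [hne] at hab; exact lt_irrefl _ hab

theorem SwapState.length_le {X₀ : Finset (Fin m)} {K₂ : ℕ → ℕ} {prs : List (Fin m × Fin m)}
    {s : State} (h : I.SwapState X₀ K₂ prs s) : prs.length ≤ m := by
  have := h.fst_nodup.length_le_card
  simpa using this

/-- If `n` exchanges have been found, there are no further ones. -/
theorem SwapState.exhausted {X₀ : Finset (Fin m)} {K₂ : ℕ → ℕ} {prs : List (Fin m × Fin m)}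
    {s : State} (h : I.SwapState X₀ K₂ prs s) (hn : n ≤ prs.length) (x : ℕ) (hx : x < n) :
    ∃ p ∈ prs, (p.1 : ℕ) = K₂ x := by
  have hnd : (prs.map fun p => (p.1 : ℕ)).Nodup := by
    have := h.fst_nodup.map Fin.val_injective
    rwa [List.map_map] at this
  have hsub : (prs.map fun p => (p.1 : ℕ)).toFinset ⊆ (Finset.range n).image K₂ := by
    intro y hy
    obtain ⟨p, hp, rfl⟩ := List.mem_map.1 (List.mem_toFinset.1 hy)
    obtain ⟨x, hx, hxp⟩ := h.mem p hp
    exact Finset.mem_image.2 ⟨x, Finset.mem_range.2 hx, hxp⟩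
  have heq := Finset.eq_of_subset_of_card_le hsub (by
    rw [List.toFinset_card_of_nodup hnd, List.length_map]
    exact Finset.card_image_le.trans (by simpa using hn))
  have : K₂ x ∈ (prs.map fun p => (p.1 : ℕ)).toFinset := by
    rw [heq]; exact Finset.mem_image.2 ⟨x, Finset.mem_range.2 hx, rfl⟩
  obtain ⟨p, hp, hpx⟩ := List.mem_map.1 (List.mem_toFinset.1 this)
  exact ⟨p, hp, hpx⟩

end Instance

end IndMst

/-! ### The rounds of the exchange computation -/

namespace IndMst

open RAM

namespace Instance

variable {n m : ℕ} {I : Instance n m} {W : ℕ} {X₀ : Finset (Fin m)} {K₂ : ℕ → ℕ}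
  {prs : List (Fin m × Fin m)}

theorem mem_seen_append {G : Finset (Fin m)} {r d e : Fin m} :
    e ∈ seen G (prs ++ [(r, d)]) ↔ e ∈ seen G prs ∨ e = r := by
  constructor
  · rintro (h | ⟨p, hp, rfl⟩)
    · exact Or.inl (Or.inl h)
    · rcases List.mem_append.1 hp with hp | hp
      · exact Or.inl (Or.inr ⟨p, hp, rfl⟩)
      · rw [List.mem_singleton.1 hp]; exact Or.inr rfl
  · rintro ((h | ⟨p, hp, rfl⟩) | rfl)
    · exact Or.inl h
    · exact Or.inr ⟨p, by simp [hp], rfl⟩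
    · exact Or.inr ⟨(e, d), by simp, rfl⟩

/-- When the pending edge is a loop, the pointers alone represent the enlarged edge set, and
comparing labels before and after gives the relation between the two trees that `SwapChain.snoc`
requires. -/
theorem SwapState.extend (hIc : I.ExistingConnected) {s : State} (h : I.SwapState X₀ K₂ prs s)
    (hX₀ : X₀ ⊆ I.existing) {r d : Fin m} (hr : r ∉ I.existing)
    (hlast : ∀ p ∈ prs, I.key p.1 < I.key r) {P' K' : ℕ → ℕ} {u : ℕ}
    (hins : I.InsertInv r
      (fun f => (∃ h : f < m, (⟨f, h⟩ : Fin m) ∈ seen I.existing prs) ∨ f = r)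
      (fun y => ∃ x < n - 1, s.word 12 x = y) P' K' u u d) :
    SwapChain I.srcN I.tgtN (n - 1) I.existing (fun e : Fin m => I.key e) X₀ (prs ++ [(r, d)])
      (I.keySet (n - 1) K') ∧
    I.Represents (n - 1)
      (fun e => ∃ h : e < m, (⟨e, h⟩ : Fin m) ∈ seen I.existing (prs ++ [(r, d)])) P' K' := by
  have hseen : ∀ f, f < m → (((∃ h : f < m, (⟨f, h⟩ : Fin m) ∈ seen I.existing prs) ∨ f = r) ↔
      ∃ h : f < m, (⟨f, h⟩ : Fin m) ∈ seen I.existing (prs ++ [(r, d)])) := by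
    intro f hf
    constructor
    · rintro (⟨_, h1⟩ | h1)
      · exact ⟨hf, mem_seen_append.2 (Or.inl h1)⟩
      · exact ⟨hf, mem_seen_append.2 (Or.inr (Fin.ext h1))⟩
    · rintro ⟨_, h1⟩
      rcases mem_seen_append.1 h1 with h1 | h1
      · exact Or.inl ⟨hf, h1⟩
      · exact Or.inr (congrArg Fin.val h1)
  have hrep : I.Represents (n - 1)
      (fun e => ∃ h : e < m, (⟨e, h⟩ : Fin m) ∈ seen I.existing (prs ++ [(r, d)])) P' K' := by
    intro c hc R
    have h1 := hins.thr c hc R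
    constructor
    · intro h2 e he hA hec
      exact h1.1 ⟨h2, fun _ => R.refl u⟩ e he ((hseen e he).2 hA) hec
    · intro h2
      exact (h1.2 fun f hf hA hfc => h2 f hf ((hseen f hf).1 hA) hfc).1
  have hsp : Spanned I.srcN I.tgtN (fun e : Fin m => I.key e) (seen I.existing (prs ++ [(r, d)]))
      (I.keySet (n - 1) K' : Set (Fin m)) := by
    rw [coe_keySet]
    exact hrep.spanned fun e he => ⟨e.2, he⟩
  refine ⟨?_, hrep⟩
  refine h.chain.snoc (fun S hS => le_card_of_spans hIc S hS) (spans_existing hIc)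
    key_injective_coe hX₀ key_lt_of_notMem hr hlast ?_ ?_ hins.le hsp
  · refine card_keySet_eq hIc rfl (hsp.spans fun e => ?_)
    exact conn_mono (fun x hx => Or.inl hx) (spans_existing hIc e)
  · ext y
    simp only [Finset.mem_insert, mem_keySet]
    have := hins.img y
    simpa only [Fin.ext_iff] using this

/-- The arrays that are used for the computation of the exchanges. -/
def swapArrays : List ℕ := [11, 12, 14, 15, 21, 22, 23, 24, 25, 26, 27, 28, 29]

theorem runs_prepare {s : State} {b : ℕ} (hI : I.Input s) (hW : n + m + 1 ≤ W)
    (hb : s.word 22 0 = b) (hbm : b < m) :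
    Runs W prepare s 50 (fun s' => SameExcept [21, 23, 24, 25] s s' ∧ s'.word 21 0 = b ∧
      s'.word 23 0 = b ∧ s'.word 24 0 = I.srcV b ∧ s'.word 25 0 = I.tgtV b) := by
  have h1 := I.srcV_lt hbm
  have h2 := I.tgtV_lt hbm
  refine Runs.straight (by decide) ?_ ?_
  · simp [prepare, Program.Fits, Program.eval, WExp.val, hb, hI.src b hbm, hI.tgt b hbm]
    omega
  · refine ⟨?_, ?_⟩
    · exact ((((SameExcept.refl _ s).putWord (by simp)).putWord (by simp)).putWord
        (by simp)).putWord (by simp)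
    simp [prepare, WExp.val, hb, hI.src b hbm, hI.tgt b hbm, Program.eval]

theorem runs_record {s : State} {b d q : ℕ} (hI : I.Input s) (hW : n + m + 1 ≤ W)
    (hb : s.word 22 0 = b) (hbm : b < m) (hd : s.word 23 0 = d) (hdm : d < m)
    (hq : s.word 29 0 = q) (hqm : q + 1 ≤ W) :
    Runs W record s 50 (fun s' => (∀ a ∉ [27, 28, 29], s'.word a = s.word a) ∧
      (∀ a, a ≠ 1 → s'.real a = s.real a) ∧ s'.word 29 0 = q + 1 ∧
      (∀ i, s'.word 27 i = if i = q then b else s.word 27 i) ∧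
      (∀ i, s'.word 28 i = if i = q then d else s.word 28 i) ∧
      (∀ i, s'.real 1 i = if i = q then I.wt d - I.wt b else s.real 1 i)) := by
  refine Runs.straight (by decide) ?_ ?_
  · simp [record, Program.Fits, Program.eval, WExp.val, hb, hd, hq]
    omega
  · refine ⟨fun a ha => ?_, fun a ha => ?_, ?_, fun i => ?_, fun i => ?_, fun i => ?_⟩
    · simp only [List.mem_cons, List.not_mem_nil, or_false, not_or] at ha
      funext i
      simp [record, Program.eval, WExp.val, ha]
    · funext i
      simp [record, Program.eval, WExp.val, ha]
    · simp [record, Program.eval, WExp.val, hq]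
    · simp [record, Program.eval, WExp.val, hq, hb]
    · simp [record, Program.eval, WExp.val, hq, hd]
    · simp [record, Program.eval, WExp.val, RExp.val, hq, hd, hb, hI.wt]

/-- Search, insertion and record are each linear in n. If the search returns the sentinel, every
label of the forest of new edges has already been inserted. -/
theorem runs_nextExchange (hIc : I.ExistingConnected) (hX₀ : X₀ ⊆ I.existing) {s : State}
    (hW : n + m + 1 ≤ W) (hK₂ : ∀ x < n, I.Valid 0 (K₂ x)) (h : I.SwapState X₀ K₂ prs s) :
    Runs W nextExchange s ((n + 1) * 900) (fun s' =>
      (∀ a ∉ [11, 12, 15, 21, 22, 23, 24, 25, 26, 27, 28, 29], s'.word a = s.word a) ∧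
      ((∃ p, I.SwapState X₀ K₂ (prs ++ [p]) s') ∨
        (I.SwapState X₀ K₂ prs s' ∧ ∀ x < n, K₂ x < m → ∃ p ∈ prs, (p.1 : ℕ) = K₂ x))) := by
  have hlastm : s.word 21 0 ≤ m := by
    rcases h.last with h1 | ⟨p, -, h1, -⟩
    · exact h1.2.le
    · rw [h1]; exact p.1.2.le
  refine ((runs_nextNew h.input hW (fun x hx => by rw [h.labels]; exact (hK₂ x hx).le)
    hlastm).seq (T' := (n + 1) * 600) ?_).mono (by omega) (fun _ h => h)
  rintro s₁ ⟨hS₁, hbest, hmin⟩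
  have h₁ : I.SwapState X₀ K₂ prs s₁ := h.of_same hS₁
  rw [h.labels] at hbest hmin
  have e21 := hS₁.1 21 (by simp)
  refine (Runs.ite (T := (n + 1) * 500) (fun hb => ?_) (fun hb => ?_)).mono (T' := (n + 1) * 600)
    ?_ (fun _ h => h)
  · have hbm : s₁.word 22 0 < m := by
      simpa [Test.holds, mE, WExp.val, h₁.input.numE] using hb
    obtain ⟨-, ⟨x₀, hx₀, hxb⟩, hbl⟩ := hbest.resolve_left hbm.ne
    set b : Fin m := ⟨s₁.word 22 0, hbm⟩ with hbdef
    have hbv : s₁.word 22 0 = b := rfl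
    have hbr : b ∉ I.existing := by
      have hv := hK₂ x₀ hx₀
      rw [hxb] at hv
      obtain ⟨_, h2⟩ := col_eq_zero.1 (hv.resolve_left hbm.ne).2
      exact h2
    have hlast : ∀ p ∈ prs, I.key p.1 < I.key b := by
      intro p hp
      rcases h.last with h1 | ⟨q, hq, h1, h2⟩
      · rw [h1.1] at hp; simp at hp
      · rw [h1] at hbl
        exact (h2 p hp).trans_lt (hbl.resolve_left q.1.2.ne)
    refine ((runs_prepare h₁.input hW hbv hbm).seq (T' := (n + 1) * 450) ?_).mono (by omega)
      (fun _ h => h)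
    rintro s₂ ⟨hS₂, h21, h23, h24, h25⟩
    have hI₂ := h₁.input.of_same hS₂
    have e11 := hS₂.1 11 (by simp)
    have e12 := hS₂.1 12 (by simp)
    -- Initially the pending edge is `b` between its own end vertices.
    have hinv : I.InsertInv b
        (fun f => (∃ h : f < m, (⟨f, h⟩ : Fin m) ∈ seen I.existing prs) ∨ f = b)
        (fun y => ∃ x < n - 1, s₁.word 12 x = y) (s₂.word 11) (s₂.word 12)
        (s₂.word 24 0) (s₂.word 25 0) (s₂.word 23 0) := by
      rw [h23, h24, h25, e11, e12]
      refine ⟨I.srcV_lt hbm, I.tgtV_lt hbm, hbm, le_rfl, h₁.ptr, fun c hc R => ?_,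
        fun y => Iff.rfl⟩
      rw [h₁.rep c hc R]
      constructor
      · rintro ⟨h1, h2⟩ f hf (hA | hfb) hfc
        · exact h1 f hf hA hfc
        · rw [hfb] at hfc ⊢; exact h2 hfc
      · intro h1
        exact ⟨fun f hf hA hfc => h1 f hf (Or.inl hA) hfc, fun h2 => h1 b hbm (Or.inr rfl) h2⟩
    refine ((runs_insertEdge hI₂ hW hinv).seq (T' := 50) ?_).mono (by omega) (fun _ h => h)
    rintro s₃ ⟨hS₃, u, hinv₃⟩
    have hI₃ := hI₂.of_same hS₃
    set d : Fin m := ⟨s₃.word 23 0, hinv₃.e_lt⟩ with hddef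
    obtain ⟨hchain, hrep⟩ := h₁.extend hIc hX₀ (d := d) hbr hlast hinv₃
    have hq : s₃.word 29 0 = prs.length := by
      rw [hS₃.1 29 (by simp), hS₂.1 29 (by simp)]; exact h₁.len
    have hlen := h.length_le
    refine (runs_record hI₃ hW (b := b) (d := d) (q := prs.length) ?_ hbm rfl d.2 hq
      (by omega)).mono (by omega) ?_
    · rw [hS₃.1 22 (by simp), hS₂.1 22 (by simp)]
    rintro s₄ ⟨hw, hr, h29, h27, h28, hr1⟩
    refine ⟨fun a ha => ?_, Or.inl ⟨(b, d), ?_⟩⟩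
    · simp only [List.mem_cons, List.not_mem_nil, or_false, not_or] at ha
      rw [hw a (by simp [ha]), hS₃.1 a (by simp [ha]), hS₂.1 a (by simp [ha]),
        hS₁.1 a (by simp [ha])]
    have e11' := hw 11 (by simp)
    have e12' := hw 12 (by simp)
    have hreal : s₃.real = s.real := by rw [hS₃.2, hS₂.2, hS₁.2]
    refine ⟨⟨?_, ?_, ?_, ?_, ?_, ?_⟩, ?_, ?_, ?_, ?_, ?_, ?_, ?_, ?_, ?_⟩
    · rw [hw 0 (by simp)]; exact hI₃.numV
    · rw [hw 0 (by simp)]; exact hI₃.numE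
    · rw [hw 1 (by simp)]; exact hI₃.src
    · rw [hw 2 (by simp)]; exact hI₃.tgt
    · rw [hw 3 (by simp)]; exact hI₃.col
    · rw [hr 0 (by norm_num)]; exact hI₃.wt
    · rw [e12']; exact hchain
    · rw [e11', e12']; exact hinv₃.ptr
    · rw [e11', e12']; exact hrep
    · rw [hw 20 (by simp), hS₃.1 20 (by simp), hS₂.1 20 (by simp)]; exact h₁.labels
    · simp [h29]
    · intro i hi
      rw [h27, h28, hr1]
      by_cases hil : i = prs.length
      · subst hil
        simp [gain, wt]
      · have hi' : i < prs.length := by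
          rw [List.length_append, List.length_singleton] at hi; omega
        rw [if_neg hil, if_neg hil, if_neg hil, List.getElem_append_left hi', hreal,
          hS₃.1 27 (by simp), hS₂.1 27 (by simp), hS₁.1 27 (by simp),
          hS₃.1 28 (by simp), hS₂.1 28 (by simp), hS₁.1 28 (by simp)]
        exact h.out i hi'
    · refine Or.inr ⟨(b, d), by simp, ?_, ?_⟩
      · rw [hw 21 (by simp), hS₃.1 21 (by simp)]; exact h21
      · intro p hp
        rcases List.mem_append.1 hp with hp | hp
        · exact (hlast p hp).le
        · rw [List.mem_singleton.1 hp]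
    · intro p hp
      rcases List.mem_append.1 hp with hp | hp
      · exact h.mem p hp
      · rw [List.mem_singleton.1 hp]; exact ⟨x₀, hx₀, hxb⟩
    · intro x hx hxm
      have h21' : s₄.word 21 0 = b := by
        rw [hw 21 (by simp), hS₃.1 21 (by simp)]; exact h21
      rw [h21']
      rcases h.rest x hx hxm with ⟨p, hp, hpx⟩ | hnew
      · exact Or.inl ⟨p, by simp [hp], hpx⟩
      · have hle := hmin x hx hxm hnew
        -- Equality of keys means that this label is the edge just inserted.
        rcases hle.lt_or_eq with h1 | h1
        · exact Or.inr (Or.inr h1)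
        · exact Or.inl ⟨(b, d), by simp, I.key_injective h1⟩
  · have hbm : ¬ s₁.word 22 0 < m := by
      simpa [Test.holds, mE, WExp.val, h₁.input.numE] using hb
    have hbm' : s₁.word 22 0 = m := hbest.resolve_right fun h' => hbm h'.1
    refine Runs.straight (by simp [Program.maxCost]; omega) trivial ⟨fun a ha => ?_,
      Or.inr ⟨h₁, fun x hx hxm => ?_⟩⟩
    · simp only [List.mem_cons, List.not_mem_nil, or_false, not_or] at ha
      exact hS₁.1 a (by simp [ha])
    · rcases h.rest x hx hxm with h1 | h1
      · exact h1
      · have := hmin x hx hxm h1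
        rw [hbm'] at this
        exact absurd (I.key_lt_dummy hxm) this.not_gt
  · have : (Test.lt (sc 22) mE).cost = 5 := rfl
    rw [this]; omega

/-- Each of the n rounds either adds an exchange or finds that none is left. If all of them add one,
n distinct labels have been inserted, and `SwapState.exhausted` applies. -/
theorem runs_exchanges (hIc : I.ExistingConnected) {s : State} (hW : n + m + 1 ≤ W)
    (hI : I.Input s) (hK₂ : ∀ x < n, I.Valid 0 (s.word 20 x))
    (hP : I.PtrInv 1 n (s.word 11) (s.word 12)) :
    Runs W exchanges s ((n + 1) * ((n + 1) * 1000)) (fun s' =>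
      (∀ a ∉ swapArrays, s'.word a = s.word a) ∧
      ∃ prs, I.SwapState (I.keySet (n - 1) (s.word 12)) (s.word 20) prs s' ∧
        ∀ x < n, s.word 20 x < m → ∃ p ∈ prs, (p.1 : ℕ) = s.word 20 x) := by
  obtain ⟨htree, hsub, hrep, hchain⟩ := hP.tree hIc
  have h1 : Runs W (.setWord 29 (.const 0) (.const 0)) s 10 (fun s' => s' = s.putWord 29 0 0) :=
    Runs.straight (by decide) (by simp [Program.Fits, WExp.val]) (by simp [Program.eval, WExp.val])
  refine (h1.seq (T' := 10 + (n + 1) * ((n + 1) * 900 + 30)) ?_).mono ?_ (fun _ h => h)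
  swap
  · nlinarith [Nat.zero_le n]
  rintro _ rfl
  have h2 : Runs W (.setWord 21 (.const 0) mE) (s.putWord 29 0 0) 10
      (fun s' => s' = (s.putWord 29 0 0).putWord 21 0 m) :=
    Runs.straight (by decide) (by simp [Program.Fits, WExp.val, mE, hI.numE]; omega)
      (by simp [Program.eval, WExp.val, mE, hI.numE])
  refine h2.seq ?_
  rintro _ rfl
  refine (Runs.forTo (k := n) (B := (n + 1) * 900) (fun j s' =>
    (∀ a ∉ swapArrays, s'.word a = s.word a) ∧
    ∃ prs, I.SwapState (I.keySet (n - 1) (s.word 12)) (s.word 20) prs s' ∧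
      (j ≤ prs.length ∨ ∀ x < n, s.word 20 x < m → ∃ p ∈ prs, (p.1 : ℕ) = s.word 20 x))
    (by omega) ?_ ?_ ?_).mono ?_ ?_
  · have hS : SameExcept [29, 21, 14] s (((s.putWord 29 0 0).putWord 21 0 m).putWord 14 0 0) :=
      (((SameExcept.refl _ s).putWord (by simp)).putWord (by simp)).putWord (by simp)
    refine ⟨fun a ha => hS.1 a fun h' => ha ?_, [], ?_, Or.inl (Nat.zero_le _)⟩
    · revert h'; simp [swapArrays]; omega
    · refine ⟨hI.of_same hS, ?_, ?_, ?_, hS.1 20 (by simp), by simp, by simp, by simp, by simp,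
        by simp⟩
      · rw [hS.1 12 (by simp)]; exact hchain
      · rw [hS.1 11 (by simp), hS.1 12 (by simp)]; exact htree
      · rw [hS.1 11 (by simp), hS.1 12 (by simp)]; exact hrep
  · rintro j s' ⟨-, prs, h, -⟩
    simp [WExp.val, nE, h.input.numV]
  · rintro j hj s' hj' ⟨hw, prs, h, hprog⟩
    refine (runs_nextExchange hIc hsub hW hK₂ h).mono le_rfl ?_
    rintro s'' ⟨hw', hcase⟩
    have hS : SameExcept [14] s'' (s''.putWord 14 0 (j + 1)) :=
      (SameExcept.refl _ s'').putWord (by simp)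
    refine ⟨by rw [hw' 14 (by simp), hj'], fun a ha => ?_, ?_⟩
    · have ha' := ha
      simp only [swapArrays, List.mem_cons, List.not_mem_nil, or_false, not_or] at ha'
      rw [hS.1 a (by simp [ha']), hw' a (by simp [ha']), hw a ha]
    · rcases hcase with ⟨p, h'⟩ | ⟨h', hex⟩
      · refine ⟨_, h'.of_same hS, ?_⟩
        rcases hprog with h3 | h3
        · exact Or.inl (by simpa using h3)
        · refine Or.inr fun x hx hxm => ?_
          obtain ⟨p', hp', hpx⟩ := h3 x hx hxm
          exact ⟨p', by simp [hp'], hpx⟩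
      · exact ⟨_, h'.of_same hS, Or.inr hex⟩
  · have : nE.cost = 2 := rfl
    rw [this, Nat.mul_add, Nat.mul_add]
    nlinarith [Nat.zero_le n]
  · rintro s' ⟨hw, prs, h, hprog⟩
    refine ⟨hw, prs, h, ?_⟩
    rcases hprog with h3 | h3
    · exact fun x hx _ => h.exhausted h3 x hx
    · exact h3

end Instance

end IndMst

namespace RAM

/-! ### The program for the output -/

/-- Find the first exchange of maximum gain if there is an exchange of positive gain. -/
def selectBest : Program :=
  .seq (.setReal 2 (.const 0) (.sub (.get 2 (.const 0)) (.get 2 (.const 0))))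
    (.seq (.setWord 30 (.const 0) (sc 29))
      (forTo 15 (sc 29)
        (.ite (.not (.le (.get 1 (sc 15)) (.get 2 (.const 0))))
          (.seq (.setReal 2 (.const 0) (.get 1 (sc 15))) (.setWord 30 (.const 0) (sc 15))) .skip)))

/-- Write the selected exchange to the output and remove it from the candidates. -/
def emit : Program :=
  .seq (.setWord 6 (sc 5) (.get 28 (sc 30))) (.seq (.setWord 7 (sc 5) (.get 27 (sc 30)))
    (.seq (.setWord 5 (.const 0) (.add (sc 5) (.const 1)))
      (.setReal 1 (sc 30) (.sub (.get 2 (.const 0)) (.get 2 (.const 0))))))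

/-- Write the exchanges of positive gain to the output in the order of decreasing gain. -/
def output : Program :=
  forTo 14 (sc 29) (.seq selectBest (.ite (.lt (sc 30) (sc 29)) emit .skip))

/-- Store the labels of a pointer representation. -/
def copyLabels : Program := forTo 14 nE (.setWord 20 (sc 14) (.get 12 (sc 14)))

/-- Write the initial tree to the output. -/
def markTree : Program := forTo 14 nE (.setWord 4 (.get 12 (sc 14)) (.const 1))

/-- The program that solves the incremental network design problem with minimum spanning trees. -/
def main : Program :=
  .seq (.setWord 3 mE (.const 2)) (.seq (forest 0) (.seq copyLabels
    (.seq (forest 1) (.seq markTree (.seq exchanges output)))))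

/-- The current maximum starts at 0 and is replaced only by strictly larger gains. So only positive
gains are selected, and among equal ones the first, which is the one with the smallest new edge. -/
theorem runs_selectBest {W q : ℕ} {s : State} (hq : s.word 29 0 = q) (hW : q ≤ W) :
    Runs W selectBest s ((q + 1) * 200) (fun s' => (∀ a ∉ [15, 30], s'.word a = s.word a) ∧
      (∀ a, a ≠ 2 → s'.real a = s.real a) ∧
      ((s'.word 30 0 = q ∧ ∀ i < q, s.real 1 i ≤ 0) ∨
        (s'.word 30 0 < q ∧ 0 < s.real 1 (s'.word 30 0) ∧
          (∀ i < q, s.real 1 i ≤ s.real 1 (s'.word 30 0)) ∧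
          ∀ i < s'.word 30 0, s.real 1 i < s.real 1 (s'.word 30 0)))) := by
  -- The machine has no real constants; zero is obtained as x - x.
  have h1 : Runs W (.setReal 2 (.const 0) (.sub (.get 2 (.const 0)) (.get 2 (.const 0)))) s 10
      (fun s' => s' = s.putReal 2 0 0) :=
    Runs.straight (by decide) trivial (by simp [Program.eval, WExp.val, RExp.val])
  refine (h1.seq (T' := 10 + (q + 1) * 180) ?_).mono (by omega) (fun _ h => h)
  rintro _ rfl
  have h2 : Runs W (.setWord 30 (.const 0) (sc 29)) (s.putReal 2 0 0) 10
      (fun s' => s' = (s.putReal 2 0 0).putWord 30 0 q) :=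
    Runs.straight (by decide) (by simpa [Program.Fits, hq] using hW)
      (by simp [Program.eval, WExp.val, hq])
  refine h2.seq ?_
  rintro _ rfl
  refine (Runs.forTo (k := q) (B := 150) (fun j s' =>
      (∀ a ∉ [15, 30], s'.word a = s.word a) ∧ (∀ a, a ≠ 2 → s'.real a = s.real a) ∧
      ((s'.word 30 0 = q ∧ s'.real 2 0 = 0 ∧ ∀ i < j, s.real 1 i ≤ 0) ∨
        (s'.word 30 0 < j ∧ s'.real 2 0 = s.real 1 (s'.word 30 0) ∧
          0 < s.real 1 (s'.word 30 0) ∧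
          (∀ i < j, s.real 1 i ≤ s.real 1 (s'.word 30 0)) ∧
          ∀ i < s'.word 30 0, s.real 1 i < s.real 1 (s'.word 30 0)))) hW ?_ ?_ ?_).mono ?_ ?_
  · refine ⟨fun a ha => ?_, fun a ha => ?_, Or.inl ⟨by simp, by simp, by simp⟩⟩
    · simp only [List.mem_cons, List.not_mem_nil, or_false, not_or] at ha
      rw [State.putWord_word_of_ne _ ha.1, State.putWord_word_of_ne _ ha.2, State.putReal_word]
    · rw [State.putWord_real, State.putWord_real, State.putReal_real_of_ne _ ha]
  · rintro j s' ⟨h, -⟩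
    simp [h 29, hq]
  · rintro j hj s' hj' ⟨hw, hr, hcase⟩
    have hD := hr 1 (by norm_num)
    refine Runs.straight (by decide) ?_ ?_
    · refine ⟨fun _ => ?_, fun _ => trivial⟩
      simp [Program.Fits, Program.eval, hj']; omega
    · by_cases hb : s'.real 2 0 < s.real 1 j
      · have hb' : (Test.not (.le (.get 1 (sc 15)) (.get 2 (.const 0)))).holds s' := by
          simpa [Test.holds, RExp.val, WExp.val, hj', hD] using hb
        simp only [Program.eval, if_pos hb']
        refine ⟨by simp [hj'], fun a ha => ?_, fun a ha => ?_, Or.inr ?_⟩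
        · have ha' := ha
          simp only [List.mem_cons, List.not_mem_nil, or_false, not_or] at ha
          rw [State.putWord_word_of_ne _ ha.1, State.putWord_word_of_ne _ ha.2,
            State.putReal_word, hw a ha']
        · rw [State.putWord_real, State.putWord_real, State.putReal_real_of_ne _ ha, hr a ha]
        · have e1 : (((s'.putReal 2 (WExp.val s' (.const 0)) (RExp.val s' (.get 1 (sc 15)))).putWord
              30 (WExp.val (s'.putReal 2 (WExp.val s' (.const 0)) (RExp.val s' (.get 1 (sc 15))))
              (.const 0)) (WExp.val (s'.putReal 2 (WExp.val s' (.const 0))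
              (RExp.val s' (.get 1 (sc 15)))) (sc 15))).putWord 15 0 (j + 1)).word 30 0 = j := by
            simp [WExp.val, hj']
          rw [e1]
          refine ⟨Nat.lt_succ_self j, by simp [RExp.val, WExp.val, hj', hD], ?_, ?_, ?_⟩
          · rcases hcase with ⟨-, h1, -⟩ | ⟨-, h1, h2, -⟩
            · rw [h1] at hb; exact hb
            · rw [h1] at hb; exact h2.trans hb
          · intro i hi
            rcases (show i < j ∨ i = j by omega) with h3 | rfl
            · rcases hcase with ⟨-, h1, h2⟩ | ⟨-, h1, -, h2, -⟩
              · rw [h1] at hb; exact (h2 i h3).trans hb.le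
              · rw [h1] at hb; exact (h2 i h3).trans hb.le
            · exact le_rfl
          · intro i h3
            rcases hcase with ⟨-, h1, h2⟩ | ⟨-, h1, -, h2, -⟩
            · rw [h1] at hb; exact (h2 i h3).trans_lt hb
            · rw [h1] at hb; exact (h2 i h3).trans_lt hb
      · have hb' : ¬ (Test.not (.le (.get 1 (sc 15)) (.get 2 (.const 0)))).holds s' := by
          simpa [Test.holds, RExp.val, WExp.val, hj', hD] using hb
        simp only [Program.eval, if_neg hb']
        rw [not_lt] at hb
        refine ⟨hj', fun a ha => ?_, fun a ha => hr a ha, ?_⟩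
        · have ha' := ha
          simp only [List.mem_cons, List.not_mem_nil, or_false, not_or] at ha
          rw [State.putWord_word_of_ne _ ha.1, hw a ha']
        · rw [State.putWord_word_of_ne _ (by norm_num), State.putWord_real]
          rcases hcase with ⟨h0, h1, h2⟩ | ⟨h0, h1, h2, h3, h4⟩
          · refine Or.inl ⟨h0, h1, fun i hi => ?_⟩
            rcases (show i < j ∨ i = j by omega) with h5 | rfl
            · exact h2 i h5
            · rw [← h1]; exact hb
          · refine Or.inr ⟨by omega, h1, h2, fun i hi => ?_, h4⟩
            rcases (show i < j ∨ i = j by omega) with h5 | rfl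
            · exact h3 i h5
            · rw [← h1]; exact hb
  · have : (sc 29).cost = 2 := rfl
    rw [this]; omega
  · rintro s' ⟨hw, hr, hcase⟩
    refine ⟨hw, hr, ?_⟩
    rcases hcase with ⟨h0, -, h2⟩ | ⟨h0, -, h2, h3, h4⟩
    · exact Or.inl ⟨h0, h2⟩
    · exact Or.inr ⟨h0, h2, h3, h4⟩

end RAM

/-! ### Selection sort of the exchanges by gain -/

namespace IndMst

open RAM

namespace Instance

variable {n m : ℕ} {I : Instance n m} {W : ℕ}

/-- The order in which the exchanges are written to the output. -/
def Precedes (I : Instance n m) (p q : Fin m × Fin m) : Prop :=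
  gain I q < gain I p ∨ gain I p = gain I q ∧ I.key p.1 < I.key q.1

theorem Precedes.ne {p q : Fin m × Fin m} (h : I.Precedes p q) : p ≠ q := by
  rintro rfl
  rcases h with h | h
  · exact lt_irrefl _ h
  · exact lt_irrefl _ h.2

open Classical in
/-- The memory after the exchanges in `L` have been written to the output. -/
structure OutState (I : Instance n m) (prs L : List (Fin m × Fin m)) (s : State) : Prop where
  len : s.word 29 0 = prs.length
  pairs : ∀ (i : ℕ) (h : i < prs.length), s.word 27 i = prs[i].1 ∧ s.word 28 i = prs[i].2
  gains : ∀ (i : ℕ) (h : i < prs.length), s.real 1 i = if prs[i] ∈ L then 0 else gain I prs[i]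
  sub : ∀ p ∈ L, p ∈ prs ∧ 0 < gain I p
  sorted : L.Pairwise I.Precedes
  first : ∀ p ∈ L, ∀ q ∈ prs, 0 < gain I q → q ∉ L → I.Precedes p q
  outLen : s.word 5 0 = L.length
  out : ∀ (i : ℕ) (h : i < L.length), s.word 6 i = L[i].2 ∧ s.word 7 i = L[i].1

theorem runs_emit {s : State} {b q : ℕ} {x y : ℕ} (hW : n + m + 1 ≤ W)
    (hb : s.word 30 0 = b) (hq : s.word 5 0 = q) (hqm : q + 1 ≤ W)
    (hx : s.word 27 b = x) (hy : s.word 28 b = y) (hxm : x < m) (hym : y < m) :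
    Runs W emit s 50 (fun s' => (∀ a ∉ [5, 6, 7], s'.word a = s.word a) ∧
      s'.word 5 0 = q + 1 ∧
      (∀ i, s'.word 6 i = if i = q then y else s.word 6 i) ∧
      (∀ i, s'.word 7 i = if i = q then x else s.word 7 i) ∧
      (∀ i, s'.real 1 i = if i = b then 0 else s.real 1 i)) := by
  refine Runs.straight (by decide) ?_ ?_
  · simp [emit, Program.Fits, Program.eval, WExp.val, hb, hx, hy, hq]
    omega
  · refine ⟨fun a ha => ?_, ?_, fun i => ?_, fun i => ?_, fun i => ?_⟩
    · simp only [List.mem_cons, List.not_mem_nil, or_false, not_or] at ha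
      funext i
      simp [emit, Program.eval, WExp.val, ha]
    · simp [emit, Program.eval, WExp.val, hq]
    · simp [emit, Program.eval, WExp.val, hq, hb, hy]
    · simp [emit, Program.eval, WExp.val, hq, hb, hx]
    · simp [emit, Program.eval, WExp.val, RExp.val, hb]

/-- Setting the stored gain to 0 marks an exchange as done, since only positive gains are ever
selected. The first maximum precedes every remaining candidate: a gain is smaller, or it is equal
and comes later in the list `prs`, which is sorted by new edges. -/
theorem OutState.append {prs L : List (Fin m × Fin m)} {s s' : State}
    (hprs : (prs.map Prod.fst).Pairwise fun a b : Fin m => I.key a < I.key b)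
    (h : I.OutState prs L s) {b : ℕ} (hb : b < prs.length) (hpos : 0 < s.real 1 b)
    (hmax : ∀ i < prs.length, s.real 1 i ≤ s.real 1 b) (hlt : ∀ i < b, s.real 1 i < s.real 1 b)
    (hw : ∀ a ∉ [5, 6, 7, 14, 15, 30], s'.word a = s.word a) (h5 : s'.word 5 0 = L.length + 1)
    (h6 : ∀ i, s'.word 6 i = if i = L.length then (prs[b].2 : ℕ) else s.word 6 i)
    (h7 : ∀ i, s'.word 7 i = if i = L.length then (prs[b].1 : ℕ) else s.word 7 i)
    (hr : ∀ i, s'.real 1 i = if i = b then 0 else s.real 1 i) :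
    I.OutState prs (L ++ [prs[b]]) s' := by
  have hbL : prs[b] ∉ L := by
    intro hmem
    have := h.gains b hb
    rw [if_pos hmem] at this
    exact hpos.ne' this
  have hbg : s.real 1 b = gain I prs[b] := by rw [h.gains b hb, if_neg hbL]
  have hbp : 0 < gain I prs[b] := hbg ▸ hpos
  have hkey : ∀ i j (hi : i < prs.length) (hj : j < prs.length), i < j →
      I.key prs[i].1 < I.key prs[j].1 := by
    intro i j hi hj hij
    have := List.pairwise_iff_getElem.1 hprs i j (by simpa using hi) (by simpa using hj) hij
    simpa using this
  refine ⟨?_, ?_, ?_, ?_, ?_, ?_, ?_, ?_⟩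
  · rw [hw 29 (by simp)]; exact h.len
  · rw [hw 27 (by simp), hw 28 (by simp)]; exact h.pairs
  · intro i hi
    rw [hr]
    by_cases hib : i = b
    · subst hib; simp
    · have hne : prs[i] ≠ prs[b] := by
        intro heq
        rcases lt_or_gt_of_ne hib with h1 | h1
        · exact lt_irrefl _ (heq ▸ hkey i b hi hb h1)
        · exact lt_irrefl _ (heq ▸ hkey b i hb hi h1)
      rw [if_neg hib, h.gains i hi]
      simp [hne]
  · intro p hp
    rcases List.mem_append.1 hp with hp | hp
    · exact h.sub p hp
    · rw [List.mem_singleton.1 hp]; exact ⟨List.getElem_mem hb, hbp⟩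
  · rw [List.pairwise_append]
    refine ⟨h.sorted, by simp, fun p hp q hq => ?_⟩
    rw [List.mem_singleton.1 hq]
    exact h.first p hp _ (List.getElem_mem hb) hbp hbL
  · intro p hp q hq hqp hqL
    have hqL' : q ∉ L ∧ q ≠ prs[b] := by simpa using hqL
    rcases List.mem_append.1 hp with hp | hp
    · exact h.first p hp q hq hqp hqL'.1
    · rw [List.mem_singleton.1 hp]
      obtain ⟨i, hi, rfl⟩ := List.mem_iff_getElem.1 hq
      have hig : s.real 1 i = gain I prs[i] := by rw [h.gains i hi, if_neg hqL'.1]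
      have hle := hmax i hi
      rw [hig, hbg] at hle
      rcases lt_trichotomy i b with h1 | h1 | h1
      · have := hlt i h1
        rw [hig, hbg] at this
        exact Or.inl this
      · subst h1; exact absurd rfl hqL'.2
      · rcases hle.lt_or_eq with h2 | h2
        · exact Or.inl h2
        · exact Or.inr ⟨h2.symm, hkey b i hb hi h1⟩
  · simp [h5]
  · intro i hi
    rw [h6, h7]
    by_cases hil : i = L.length
    · subst hil; simp
    · have hi' : i < L.length := by
        rw [List.length_append, List.length_singleton] at hi; omega
      rw [if_neg hil, if_neg hil, List.getElem_append_left hi']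
      exact h.out i hi'

theorem OutState.of_same {prs L : List (Fin m × Fin m)} {s s' : State} (h : I.OutState prs L s)
    (hw : ∀ a ∉ [14, 15, 30], s'.word a = s.word a) (hr : s'.real 1 = s.real 1) :
    I.OutState prs L s' := by
  refine ⟨?_, ?_, ?_, h.sub, h.sorted, h.first, ?_, ?_⟩
  · rw [hw 29 (by simp)]; exact h.len
  · rw [hw 27 (by simp), hw 28 (by simp)]; exact h.pairs
  · rw [hr]; exact h.gains
  · rw [hw 5 (by simp)]; exact h.outLen
  · rw [hw 6 (by simp), hw 7 (by simp)]; exact h.out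

theorem OutState.nodup {prs L : List (Fin m × Fin m)} {s : State} (h : I.OutState prs L s) :
    L.Nodup := h.sorted.imp Precedes.ne

/-- One selection per exchange suffices. If every round writes an exchange, the duplicate-free
output has the length of `prs` and hence contains all of it; otherwise some round has found no
positive gain. -/
theorem runs_output {prs : List (Fin m × Fin m)} {s : State} (hW : n + m + 1 ≤ W)
    (hlen : prs.length ≤ n)
    (hprs : (prs.map Prod.fst).Pairwise fun a b : Fin m => I.key a < I.key b)
    (h : I.OutState prs [] s) :
    Runs W output s ((n + 1) * ((n + 1) * 400)) (fun s' =>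
      (∀ a ∉ [5, 6, 7, 14, 15, 30], s'.word a = s.word a) ∧
      ∃ L, I.OutState prs L s' ∧ ∀ p ∈ prs, 0 < gain I p → p ∈ L) := by
  refine (Runs.forTo (k := prs.length) (B := (n + 1) * 300) (fun j s' =>
    (∀ a ∉ [5, 6, 7, 14, 15, 30], s'.word a = s.word a) ∧
    ∃ L, I.OutState prs L s' ∧ (j ≤ L.length ∨ ∀ p ∈ prs, 0 < gain I p → p ∈ L)) (by omega)
    ?_ ?_ ?_).mono ?_ ?_
  · refine ⟨fun a ha => ?_, [], h.of_same (fun a ha => ?_) rfl, Or.inl (Nat.zero_le _)⟩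
    · simp only [List.mem_cons, List.not_mem_nil, or_false, not_or] at ha
      exact State.putWord_word_of_ne _ ha.2.2.2.1
    · simp only [List.mem_cons, List.not_mem_nil, or_false, not_or] at ha
      exact State.putWord_word_of_ne _ ha.1
  · rintro j s' ⟨-, L, hL, -⟩
    exact hL.len
  · rintro j hj s' hj' ⟨hw, L, hL, hprog⟩
    refine ((runs_selectBest hL.len (by omega)).seq (T' := (n + 1) * 100) ?_).mono ?_
      (fun _ h => h)
    swap
    · have : (prs.length + 1) * 200 ≤ (n + 1) * 200 := Nat.mul_le_mul_right _ (by omega)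
      omega
    rintro s₁ ⟨hw₁, hr₁, hcase⟩
    have hL₁ : I.OutState prs L s₁ := by
      refine hL.of_same (fun a ha => ?_) (hr₁ 1 (by norm_num))
      simp only [List.mem_cons, List.not_mem_nil, or_false, not_or] at ha
      exact hw₁ a (by simp [ha])
    have hD := hr₁ 1 (by norm_num)
    have hend : ∀ s₂ : State, ∀ L', (∀ a ∉ [5, 6, 7, 15, 30], s₂.word a = s'.word a) →
        I.OutState prs L' s₂ → (j + 1 ≤ L'.length ∨ ∀ p ∈ prs, 0 < gain I p → p ∈ L') →
        s₂.word 14 0 = j ∧ (∀ a ∉ [5, 6, 7, 14, 15, 30],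
          (s₂.putWord 14 0 (j + 1)).word a = s.word a) ∧ ∃ L,
          I.OutState prs L (s₂.putWord 14 0 (j + 1)) ∧
          (j + 1 ≤ L.length ∨ ∀ p ∈ prs, 0 < gain I p → p ∈ L) := by
      intro s₂ L' h1 h2 h3
      refine ⟨by rw [h1 14 (by simp), hj'], fun a ha => ?_, L', h2.of_same (fun a ha => ?_) rfl, h3⟩
      · have ha' := ha
        simp only [List.mem_cons, List.not_mem_nil, or_false, not_or] at ha
        rw [State.putWord_word_of_ne _ ha.2.2.2.1, h1 a (by simp [ha]), hw a ha']
      · simp only [List.mem_cons, List.not_mem_nil, or_false, not_or] at ha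
        exact State.putWord_word_of_ne _ ha.1
    refine (Runs.ite (T := 60) (fun hb => ?_) (fun hb => ?_)).mono (T' := (n + 1) * 100) ?_
      (fun _ h => h)
    · have hb' : s₁.word 30 0 < prs.length := by
        have : s₁.word 30 0 < s₁.word 29 0 := hb
        rwa [hL₁.len] at this
      obtain ⟨-, hpos, hmax, hlt⟩ := hcase.resolve_left (fun h' => by omega)
      rw [← hD] at hpos hmax hlt
      have hLlen : L.length < prs.length := by
        have hnd : (prs[s₁.word 30 0] :: L).Nodup := by
          refine List.nodup_cons.2 ⟨fun hmem => ?_, hL.nodup⟩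
          have := hL₁.gains _ hb'
          rw [if_pos hmem] at this
          exact hpos.ne' this
        have hsp : (prs[s₁.word 30 0] :: L) ⊆ prs := by
          intro p hp
          rcases List.mem_cons.1 hp with rfl | hp
          · exact List.getElem_mem _
          · exact (hL.sub p hp).1
        have := (hnd.subperm hsp).length_le
        rw [List.length_cons] at this
        omega
      refine (runs_emit hW rfl hL₁.outLen (by omega) (hL₁.pairs _ hb').1 (hL₁.pairs _ hb').2
        (Fin.is_lt _) (Fin.is_lt _)).mono (by norm_num) ?_
      rintro s₂ ⟨hw₂, h5, h6, h7, hr₂⟩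
      refine hend s₂ (L ++ [prs[s₁.word 30 0]]) (fun a ha => ?_) ?_ ?_
      · simp only [List.mem_cons, List.not_mem_nil, or_false, not_or] at ha
        rw [hw₂ a (by simp [ha]), hw₁ a (by simp [ha])]
      · refine hL₁.append hprs hb' hpos hmax hlt (fun a ha => ?_) h5 h6 h7 hr₂
        simp only [List.mem_cons, List.not_mem_nil, or_false, not_or] at ha
        exact hw₂ a (by simp [ha])
      · rcases hprog with h1 | h1
        · exact Or.inl (by simpa using h1)
        · exact Or.inr fun p hp hpp => by simp [h1 p hp hpp]
    · have hb' : ¬ s₁.word 30 0 < prs.length := by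
        intro h'
        refine hb ?_
        show s₁.word 30 0 < s₁.word 29 0
        rwa [hL₁.len]
      obtain ⟨-, hnon⟩ := hcase.resolve_right (fun h' => hb' h'.1)
      rw [← hD] at hnon
      refine Runs.straight (by decide) trivial (hend s₁ L (fun a ha => ?_) hL₁ (Or.inr ?_))
      · simp only [List.mem_cons, List.not_mem_nil, or_false, not_or] at ha
        exact hw₁ a (by simp [ha])
      · intro p hp hpp
        by_contra hpL
        obtain ⟨i, hi, rfl⟩ := List.mem_iff_getElem.1 hp
        have h1 := hnon i hi
        rw [hL₁.gains i hi, if_neg hpL] at h1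
        exact h1.not_gt hpp
    · have : (Test.lt (sc 30) (sc 29)).cost = 5 := rfl
      rw [this]; omega
  · have h1 : (sc 29).cost = 2 := rfl
    rw [h1]
    calc (prs.length + 1) * ((n + 1) * 300 + 2 + 12)
        ≤ (n + 1) * ((n + 1) * 300 + 2 + 12) := Nat.mul_le_mul_right _ (by omega)
      _ ≤ (n + 1) * ((n + 1) * 400) := Nat.mul_le_mul_left _ (by omega)
  · rintro s' ⟨hw, L, hL, hprog⟩
    refine ⟨hw, L, hL, ?_⟩
    rcases hprog with h1 | h1
    · intro p hp _
      have hsub : L.Subperm prs := hL.nodup.subperm fun p hp => (hL.sub p hp).1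
      exact (hsub.perm_of_length_le h1).mem_iff.2 hp
    · exact h1

/-! ### Storing labels, marking the initial tree, and assembling the program -/

theorem runs_copyLabels {s : State} {cc : ℕ} (hI : I.Input s) (hW : n + m + 1 ≤ W)
    (hK : ∀ x < n, I.Valid cc (s.word 12 x)) :
    Runs W copyLabels s ((n + 1) * 100) (fun s' => SameExcept [14, 20] s s' ∧
      ∀ x < n, s'.word 20 x = s.word 12 x) := by
  refine (Runs.forTo (k := n) (B := 50) (fun j s' => SameExcept [14, 20] s s' ∧
    ∀ x < j, s'.word 20 x = s.word 12 x) (by omega) ?_ ?_ ?_).mono ?_ (fun _ h => h)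
  · exact ⟨(SameExcept.refl _ s).putWord (by simp), by simp⟩
  · rintro j s' ⟨h, -⟩
    simp [WExp.val, nE, (hI.of_same h).numV]
  · rintro j hj s' hj' ⟨h, h'⟩
    have e12 := h.1 12 (by simp)
    have hle := (hK j hj).le
    refine Runs.straight (by decide) ?_ ?_
    · simp [Program.Fits, WExp.val, hj', e12]; omega
    · simp only [Program.eval, sc_val, hj', WExp.val, e12]
      refine ⟨by simp [hj'], (h.putWord (by simp)).putWord (by simp), fun x hx => ?_⟩
      rcases (show x < j ∨ x = j by omega) with h1 | h1
      · simp [h' x h1, h1.ne]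
      · simp [h1]
  · exact Nat.mul_le_mul_left _ (by simp [WExp.cost, nE])

open Classical in
theorem runs_markTree {s : State} (hI : I.Input s) (hW : n + m + 1 ≤ W) :
    Runs W markTree s ((n + 1) * 100) (fun s' => SameExcept [4, 14] s s' ∧
      ∀ y, s'.word 4 y = if ∃ x < n, s.word 12 x = y then 1 else s.word 4 y) := by
  refine (Runs.forTo (k := n) (B := 50) (fun j s' => SameExcept [4, 14] s s' ∧
    ∀ y, s'.word 4 y = if ∃ x < j, s.word 12 x = y then 1 else s.word 4 y) (by omega)
    ?_ ?_ ?_).mono ?_ (fun _ h => h)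
  · exact ⟨(SameExcept.refl _ s).putWord (by simp), by simp⟩
  · rintro j s' ⟨h, -⟩
    simp [WExp.val, nE, (hI.of_same h).numV]
  · rintro j hj s' hj' ⟨h, h'⟩
    have e12 := h.1 12 (by simp)
    refine Runs.straight (by decide) ?_ ?_
    · simp [Program.Fits, WExp.val]; omega
    · simp only [Program.eval, sc_val, hj', WExp.val, e12]
      refine ⟨by simp [hj'], (h.putWord (by simp)).putWord (by simp), fun y => ?_⟩
      by_cases hy : y = s.word 12 j
      · have : ∃ x < j + 1, s.word 12 x = y := ⟨j, by omega, hy.symm⟩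
        rw [if_pos this]
        simp [hy]
      · have : (∃ x < j + 1, s.word 12 x = y) ↔ ∃ x < j, s.word 12 x = y := by
          constructor
          · rintro ⟨x, hx, hxy⟩
            rcases (show x < j ∨ x = j by omega) with h1 | rfl
            · exact ⟨x, h1, hxy⟩
            · exact absurd hxy.symm hy
          · rintro ⟨x, hx, hxy⟩
            exact ⟨x, by omega, hxy⟩
        rw [if_congr this rfl rfl]
        simp [hy, h' y]
  · exact Nat.mul_le_mul_left _ (by simp [WExp.cost, nE])

theorem SwapState.length_le_numV {X₀ : Finset (Fin m)} {K₂ : ℕ → ℕ} {prs : List (Fin m × Fin m)}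
    {s : State} (h : I.SwapState X₀ K₂ prs s) : prs.length ≤ n := by
  have hnd : (prs.map fun p => (p.1 : ℕ)).Nodup := by
    have := h.fst_nodup.map Fin.val_injective
    rwa [List.map_map] at this
  have hsub : (prs.map fun p => (p.1 : ℕ)).toFinset ⊆ (Finset.range n).image K₂ := by
    intro y hy
    obtain ⟨p, hp, rfl⟩ := List.mem_map.1 (List.mem_toFinset.1 hy)
    obtain ⟨x, hx, hxp⟩ := h.mem p hp
    exact Finset.mem_image.2 ⟨x, Finset.mem_range.2 hx, hxp⟩
  have := (Finset.card_le_card hsub).trans Finset.card_image_le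
  rwa [List.toFinset_card_of_nodup hnd, List.length_map, Finset.card_range] at this

theorem weight_le_of_key_lt (a b : Fin m) (h : a ∈ I.existing ↔ b ∈ I.existing)
    (hab : I.key a < I.key b) : I.weight a ≤ I.weight b := by
  have hc : I.col a = I.col b := by simp [col, h]
  have hw : ∀ e : Fin m, I.wt e = I.weight e := fun e => by simp [wt]
  rw [key_lt_iff, hc, hw, hw] at hab
  rcases hab with h1 | ⟨-, h1 | h1⟩
  · exact absurd h1 (lt_irrefl _)
  · exact h1.le
  · exact h1.1.le

/-- The single write puts the class of the sentinel into entry `m` of array 3, just behind the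
input. -/
theorem input_initialState : I.Input (I.initialState.putWord 3 m 2) := by
  refine ⟨?_, ?_, fun e he => ?_, fun e he => ?_, fun e he => ?_, fun e => ?_⟩
  · simp [initialState]
  · simp [initialState]
  · simp [initialState, srcV, he]
  · simp [initialState, tgtV, he]
  · rcases he.lt_or_eq with h | h
    · simp [initialState, col, h, h.ne]
    · simp [h, col]
  · simp [initialState, wt]

/-- The program computes an optimal solution in time `O(n² + m)`. -/
theorem runs_main (hIc : I.ExistingConnected) (hW : n + m + 1 ≤ W) (hW' : n * n ≤ W)
    (hW2 : 2 ≤ W) :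
    Runs W main I.initialState (50000 * (n * n + m + 1)) (fun s =>
      ∃ (X₀ : Finset (Fin m)) (L : List (Fin m × Fin m)), HasOutput s X₀ L ∧
        L.length ≤ I.horizon ∧ I.IsOptimal (exchangeSeq X₀ L)) := by
  have h0 : Runs W (.setWord 3 mE (.const 2)) I.initialState 10
      (fun s' => s' = I.initialState.putWord 3 m 2) :=
    Runs.straight (by decide) (by simpa [Program.Fits, WExp.val] using hW2)
      (by simp [Program.eval, WExp.val, mE, initialState])
  refine (h0.seq (T' := 5000 * (n * n + m + 1) + ((n + 1) * 100 + (5000 * (n * n + m + 1) +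
    ((n + 1) * 100 + ((n + 1) * ((n + 1) * 1000) + (n + 1) * ((n + 1) * 400)))))) ?_).mono ?_
    (fun _ h => h)
  swap
  · nlinarith [Nat.le_mul_self n]
  rintro _ rfl
  set s₀ := I.initialState.putWord 3 m 2 with hs₀
  have hI₀ : I.Input s₀ := input_initialState
  have hzero : ∀ a, a ≠ 0 → a ≠ 1 → a ≠ 2 → a ≠ 3 → ∀ i, s₀.word a i = 0 := by
    intro a h0 h1 h2 h3 i
    simp [hs₀, initialState, h0, h1, h2, h3]
  refine (runs_forest 0 hI₀ hW hW').seq ?_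
  rintro s₁ ⟨hS₁, hP₁⟩
  have hI₁ := hI₀.of_same hS₁
  refine (runs_copyLabels hI₁ hW hP₁.validK).seq ?_
  rintro s₂ ⟨hS₂, hcopy⟩
  have hI₂ := hI₁.of_same hS₂
  refine (runs_forest 1 hI₂ hW hW').seq ?_
  rintro s₃ ⟨hS₃, hP₃⟩
  have hI₃ := hI₂.of_same hS₃
  refine (runs_markTree hI₃ hW).seq ?_
  rintro s₄ ⟨hS₄, hmark⟩
  have hI₄ := hI₃.of_same hS₄
  have e20 : ∀ x < n, s₄.word 20 x = s₁.word 12 x := by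
    intro x hx
    rw [hS₄.1 20 (by simp), hS₃.1 20 (by simp), hcopy x hx]
  have e12 := hS₄.1 12 (by simp)
  have e11 := hS₄.1 11 (by simp)
  refine (runs_exchanges hIc hW hI₄ (fun x hx => by rw [e20 x hx]; exact hP₁.validK x hx)
    (by rw [e11, e12]; exact hP₃)).seq ?_
  rintro s₅ ⟨hw₅, prs, hsw, hex⟩
  have hX₀ : I.keySet (n - 1) (s₄.word 12) ⊆ I.existing := by
    rw [e12]; exact (hP₃.tree hIc).2.1
  have hz : ∀ a ∈ [5, 6, 7], ∀ i, s₅.word a i = 0 := by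
    intro a ha i
    simp only [List.mem_cons, List.not_mem_nil, or_false] at ha
    rcases ha with rfl | rfl | rfl <;>
    · rw [hw₅ _ (by simp [swapArrays]), hS₄.1 _ (by simp), hS₃.1 _ (by simp), hS₂.1 _ (by simp),
        hS₁.1 _ (by simp)]
      exact hzero _ (by norm_num) (by norm_num) (by norm_num) (by norm_num) i
  have hout : I.OutState prs [] s₅ := by
    refine ⟨hsw.len, fun i hi => ⟨(hsw.out i hi).1, (hsw.out i hi).2.1⟩, fun i hi => ?_, by simp,
      List.Pairwise.nil, by simp, hz 5 (by simp) 0, by simp⟩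
    simpa using (hsw.out i hi).2.2
  refine (runs_output hW hsw.length_le_numV hsw.chain.sorted hout).mono le_rfl ?_
  rintro s₆ ⟨hw₆, L, hL, hall⟩
  refine ⟨I.keySet (n - 1) (s₄.word 12), L.map Prod.swap, ⟨fun e => ?_, ?_, fun i hi => ?_⟩, ?_⟩
  · rw [hw₆ 4 (by simp), hw₅ 4 (by simp [swapArrays]), hmark, e12, hS₃.1 4 (by simp),
      hS₂.1 4 (by simp), hS₁.1 4 (by simp),
      hzero 4 (by norm_num) (by norm_num) (by norm_num) (by norm_num)]
    -- The program marks the labels of all n vertices, but the root `n - 1` carries the sentinel,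
    -- whose mark in entry `m` lies outside the output.
    refine if_congr ?_ rfl rfl
    rw [mem_keySet]
    constructor
    · rintro ⟨x, hx, hxe⟩
      refine ⟨x, ?_, hxe⟩
      by_contra hge
      have := (hP₃.rest x hx (by omega)).2
      have := e.2
      omega
    · rintro ⟨x, hx, hxe⟩
      exact ⟨x, by omega, hxe⟩
  · rw [hL.outLen, List.length_map]
  · have hi' : i < L.length := by simpa using hi
    rw [List.getElem_map]
    exact hL.out i hi'
  -- The labels of the first forest span all new edges below every threshold, and each of these
  -- labels occurs as the first component of some exchange.
  · have hcov : ∀ e ∉ I.existing, conn I.srcN I.tgtN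
        {x | (∃ p ∈ prs, p.1 = x) ∧ I.key x ≤ I.key e} (I.srcN e) (I.tgtN e) := by
      intro e he
      have hsp := hP₁.rep.spanned (B := {e | e ∉ I.existing}) (fun f hf =>
        ⟨col_eq_zero.2 ⟨f.2, hf⟩, I.srcV_lt f.2, I.tgtV_lt f.2⟩)
      refine conn_mono ?_ (hsp e he)
      rintro x ⟨⟨y, hy, hyx⟩, hxe⟩
      refine ⟨?_, hxe⟩
      obtain ⟨p, hp, hpy⟩ := hex y hy (by rw [e20 y hy, hyx]; exact x.2)
      exact ⟨p, hp, Fin.ext (by rw [hpy, e20 y hy, hyx])⟩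
    have := isOptimal_exchangeSeq hIc key_injective_coe weight_le_of_key_lt hX₀ hsw.chain hcov L
      (fun p => ⟨hL.sub p, fun h => hall p h.1 h.2⟩) hL.sorted
    rwa [List.length_map]

end Instance

end IndMst

/-! ### The final time bound -/

theorem theorem4 :
    ∃ (p : RAM.Program) (C c : ℕ),
      ∀ (n m : ℕ) (I : IndMst.Instance n m), I.ExistingConnected →
        ∃ (t : ℕ) (s : RAM.State),
          RAM.Exec ((n + m + 1) ^ c) p I.initialState t s ∧
          (t : ℝ) ≤ (C : ℝ) * max ((n : ℝ) ^ 2) ((m : ℝ) * Real.log (m : ℝ)) ∧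
          ∃ (X₀ : Finset (Fin m)) (L : List (Fin m × Fin m)),
            IndMst.HasOutput s X₀ L ∧
            L.length ≤ I.horizon ∧
            I.IsOptimal (IndMst.exchangeSeq X₀ L) := by
  -- Exponent 2 makes room for the matrix index, which runs up to n². With M the maximum in the
  -- claim, n² ≤ M, m ≤ 2M and 1 ≤ M, so the factor 50000 of the program is multiplied by 4.
  refine ⟨RAM.main, 200000, 2, fun n m I hI => ?_⟩
  have hn : 1 ≤ n := Fin.pos_iff_nonempty.2 hI.nonempty
  obtain ⟨t, s, hexec, ht, hout⟩ := IndMst.Instance.runs_main (W := (n + m + 1) ^ 2) hI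
    (by nlinarith [Nat.zero_le (n + m)]) (by nlinarith [Nat.zero_le (n * m), Nat.zero_le (m * m)])
    (by nlinarith [Nat.zero_le (n + m)])
  refine ⟨t, s, hexec, ?_, hout⟩
  set M := max ((n : ℝ) ^ 2) ((m : ℝ) * Real.log (m : ℝ)) with hM
  have h1 : (n : ℝ) ^ 2 ≤ M := le_max_left _ _
  have hn' : (1 : ℝ) ≤ n := by exact_mod_cast hn
  have h2 : (1 : ℝ) ≤ M := le_trans (by nlinarith) h1
  -- For m ≥ 3 the logarithm is at least 1, because e < 3. For m ≤ 2 the bound 1 ≤ M suffices.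
  have h3 : (m : ℝ) ≤ 2 * M := by
    rcases le_or_gt m 2 with hm | hm
    · have : (m : ℝ) ≤ 2 := by exact_mod_cast hm
      linarith
    · have hm' : (3 : ℝ) ≤ m := by exact_mod_cast hm
      have hlog : 1 ≤ Real.log m := by
        rw [Real.le_log_iff_exp_le (by linarith)]
        linarith [Real.exp_one_lt_d9]
      have h4 : (m : ℝ) * Real.log m ≤ M := le_max_right _ _
      nlinarith
  have ht' : (t : ℝ) ≤ 50000 * ((n : ℝ) * n + m + 1) := by exact_mod_cast ht
  push_cast
  nlinarith
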